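/- **Notation.** Let $q=p^a$ ($p$ prime, $a\ge1$), $J=\left(\begin{smallmatrix}0&I\\-I&0\end{smallmatrix}\right)$, $\omega_0(x,y)={}^t\!xJy$ and $\tau_0=\left(\begin{smallmatrix}-I&0\\0&I\end{smallmatrix}\right)$, of size $2n$. For a ring $R$ let $\mathrm{GSp}_{2n}(R)=\{g\in \mathrm{GL}_{2n}(R):{}^t\!gJg=cJ,\ c\in R^\times\}$ ($c$ is the multiplier of $g$), and let $\mathrm{GL}_n^*(R)$ be its subgroup of elements commuting with $\tau_0$; over a field of characteristic $0$ these are the matrices $\delta(\lambda,X)=\left(\begin{smallmatrix}\lambda X&0\\0&{}^t\!X^{-1}\end{smallmatrix}\right)$. Call $\gamma\in\mathrm{GSp}_{2n}(\mathbb Q)$ *$q$-inversive* if it is semisimple, has multiplier $q$ and $\tau_0\gamma\tau_0^{-1}=q\gamma^{-1}$. Let $\overline{\mathbb Q}$ be the algebraic closure of $\mathbb Q$ in $\mathbb C$. Fix an embedding $\varepsilon:W(\overline{\mathbb F}_p)\to\mathbb C$; it determines a $p$-adic valuation $\mathrm{val}_p$ on $\overline{\mathbb Q}$. A *Deligne module*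 of rank $2n$ over $\mathbb F_q$ is a free $\mathbb Z$-module $T$ of rank $2n$ with a semisimple endomorphism $F$ such that all complex eigenvalues of $F$ have absolute value $\sqrt q$; exactly half of its eigenvalues in $\overline{\mathbb Q}_p$ are units and half are divisible by $q$; the middle coefficient of the characteristic polynomial is prime to $p$; and $FV=VF=q$ for some endomorphism $V$ of $T$. Let $\Phi_\varepsilon$ be the set of homomorphisms $\phi:\mathbb Q[F]\to\mathbb C$ with $\mathrm{val}_p(\phi(F))>0$ (a CM type). A *real polarized Deligne module* $(T,F,\omega,\tau)$ is a Deligne module with an alternating form $\omega:T\times T\to\mathbb Z$, nondegenerate over $\mathbb Q$, with $\omega(Fx,y)=\omega(x,Vy)$, which is $\Phi_\varepsilon$-positive, i.e. $\omega(x,\iota y)$ is symmetric and positive definite on $T\otimes\mathbb Q$ for some purely imaginary $\iota\in\mathbb Q[F]$ with $\operatorname{Im}\phi(\iota)>0$ for all $\phi\in\Phi_\varepsilon$; and with an involution $\tau$ of $T$ such that $\tau F\tau^{-1}=V$ and $\omega(\tau x,\tau y)=-\omega(x,y)$. An *$S$-isogeny* of such modules is an isomorphism $\varphi:T_1\otimes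 S\to T_2\otimes S$ commuting with $F$ and $\tau$ and with $\varphi^*\omega_2=c\,\omega_1$ for some $c\in S^\times$. **Proposition.** Let $L_0\subset\mathbb Q^{2n}$ be a lattice and $\gamma_0=\left(\begin{smallmatrix}A_0&B_0\\C_0&{}^t\!A_0\end{smallmatrix}\right)\in\mathrm{GSp}_{2n}(\mathbb Q)$ a $q$-inversive element such that $(L_0,\gamma_0,\omega_0,\tau_0)$ is a real polarized Deligne module. For a field $K\supseteq\mathbb Q$ let $I_0(K)$ be the centralizer of $\gamma_0$ in $\mathrm{GL}_n^*(K)$. The following sets are in canonical bijection. 1. The symmetric $B\in\mathrm{GL}_n(\mathbb Q)$ with $A_0B=B\,{}^t\!A_0$ such that for every real $\beta$ the forms ${}^t\!vBv$ and ${}^t\!vB_0v$ have the same signature on the $\beta$-eigenspace of ${}^t\!A_0$ in $\mathbb R^n$, modulo the equivalence $B\sim\lambda XB\,{}^t\!X$ with $\lambda\in\mathbb Q^\times$ and $X\in\mathrm{GL}_n(\mathbb Q)$ commuting with $A_0$. 2. The $\mathbb Q$-isogeny classes of real polarized Deligne modules that are $\overline{\mathbb Q}$-isogenous to $(L_0,\gamma_0,\omega_0,\tau_0)$.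 3. The $\mathrm{GL}_n^*(\mathbb Q)$-conjugacy classes of $q$-inversive $\gamma$ that are conjugate to $\gamma_0$ by an element of $\mathrm{GL}_n^*(\overline{\mathbb Q})$ and by an element of $\mathrm{GSp}_{2n}(\mathbb R)$. 4. The $\mathrm{GL}_n^*(\mathbb Q)$-conjugacy classes of $q$-inversive $\gamma$ that are conjugate to $\gamma_0$ by an element of $\mathrm{GL}_n^*(\mathbb R)$. 5. $\ker\bigl(H^1(\mathrm{Gal}(\overline{\mathbb Q}/\mathbb Q),I_0(\overline{\mathbb Q}))\to H^1(\mathrm{Gal}(\mathbb C/\mathbb R),I_0(\mathbb C))\bigr)$ (continuous cocycles). Here (1)→(4) sends $B$ to $\gamma=\left(\begin{smallmatrix}A_0&B\\B^{-1}(A_0^2-qI)&{}^t\!A_0\end{smallmatrix}\right)$; (2)→(4) sends a module to the matrix $\gamma$ of $F$ in any basis of $T\otimes\mathbb Q$ in which $\omega,\tau$ become $\omega_0,\tau_0$ (such bases exist); the sets of $\gamma$ in (3) and (4) are equal; and (4)→(5) sends $\gamma=g\gamma_0g^{-1}$, $g\in \mathrm{GL}_n^*(\overline{\mathbb Q})$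 (such $g$ exist), to the class of $\sigma\mapsto g^{-1}\sigma(g)$. Moreover, for every field $K\supseteq\mathbb Q$, $I_0(K)$ is the group of self-$K$-isogenies of $(L_0,\gamma_0,\omega_0,\tau_0)$, and $\delta(\lambda,X)\mapsto X$ is an isomorphism of $I_0(K)$ onto $\{X\in\mathrm{GL}_n(K): XA_0=A_0X,\ XB_0{}^t\!X=\mu B_0\text{ for some }\mu\in K^\times\}$. -/

import Mathlib

open Matrix TensorProduct

noncomputable section

namespace RealDeligne

/-! ### The groups `GSp₂ₙ` and `GLₙ*` -/

/-- The index set of the standard basis of `R²ⁿ = Rⁿ ⊕ Rⁿ`. -/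
abbrev Idx (n : ℕ) : Type := Fin n ⊕ Fin n

/-- The matrix `(0 I; -I 0)` of the standard symplectic form `ω₀(x, y) = ᵗx J y`. -/
def stdJ (n : ℕ) (R : Type*) [CommRing R] : Matrix (Idx n) (Idx n) R :=
  fromBlocks 0 1 (-1) 0

/-- The standard involution `τ₀(x, y) = (-x, y)`. -/
def tau0 (n : ℕ) (R : Type*) [CommRing R] : Matrix (Idx n) (Idx n) R :=
  fromBlocks (-1) 0 0 1

/-- `g` multiplies the standard symplectic form by `c`. -/
def HasMultiplier {n : ℕ} {R : Type*} [CommRing R] (g : GL (Idx n) R) (c : R) : Prop :=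
  (g.val)ᵀ * stdJ n R * g.val = c • stdJ n R

/-- The group `GSp₂ₙ(R)` of symplectic similitudes. -/
def GSp (n : ℕ) (R : Type*) [CommRing R] : Subgroup (GL (Idx n) R) where
  carrier := {g | ∃ c : Rˣ, HasMultiplier g (c : R)}
  one_mem' := ⟨1, by simp [HasMultiplier]⟩
  mul_mem' := by
    rintro g h ⟨c, hc⟩ ⟨d, hd⟩
    refine ⟨c * d, ?_⟩
    unfold HasMultiplier at *
    calc ((g * h).val)ᵀ * stdJ n R * (g * h).val
        = (h.val)ᵀ * ((g.val)ᵀ * stdJ n R * g.val) * h.val := by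
          simp [Matrix.transpose_mul, Matrix.mul_assoc]
      _ = ((c * d : Rˣ) : R) • stdJ n R := by
          rw [hc, Matrix.mul_smul, Matrix.smul_mul, hd, smul_smul, Units.val_mul]
  inv_mem' := by
    rintro g ⟨c, hc⟩
    refine ⟨c⁻¹, ?_⟩
    unfold HasMultiplier at *
    have h1 : g.val * (g⁻¹).val = 1 := by rw [← Units.val_mul]; simp
    have h2 : ((g⁻¹).val)ᵀ * (g.val)ᵀ = 1 := by
      rw [← Matrix.transpose_mul, h1, Matrix.transpose_one]
    have h3 : (c : R) • (((g⁻¹).val)ᵀ * stdJ n R * (g⁻¹).val) = stdJ n R := by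
      calc (c : R) • (((g⁻¹).val)ᵀ * stdJ n R * (g⁻¹).val)
          = ((g⁻¹).val)ᵀ * ((c : R) • stdJ n R) * (g⁻¹).val := by
            rw [Matrix.mul_smul, Matrix.smul_mul]
        _ = (((g⁻¹).val)ᵀ * (g.val)ᵀ) * stdJ n R * (g.val * (g⁻¹).val) := by
            rw [← hc]; simp only [Matrix.mul_assoc]
        _ = stdJ n R := by rw [h1, h2]; simp
    calc ((g⁻¹).val)ᵀ * stdJ n R * (g⁻¹).val
        = ((c⁻¹ : Rˣ) : R) • ((c : R) • (((g⁻¹).val)ᵀ * stdJ n R * (g⁻¹).val)) := by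
          rw [smul_smul, Units.inv_mul, one_smul]
      _ = _ := by rw [h3]

/-- The group `GLₙ*(R)`: the elements of `GSp₂ₙ(R)` fixed under conjugation by `τ₀`. -/
def GLstar (n : ℕ) (R : Type*) [CommRing R] : Subgroup (GL (Idx n) R) where
  carrier := {g | g ∈ GSp n R ∧ tau0 n R * g.val = g.val * tau0 n R}
  one_mem' := ⟨one_mem _, by simp⟩
  mul_mem' := by
    rintro g h ⟨hg, hg'⟩ ⟨hh, hh'⟩
    refine ⟨mul_mem hg hh, ?_⟩
    rw [Units.val_mul, ← Matrix.mul_assoc, hg', Matrix.mul_assoc, hh', Matrix.mul_assoc]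
  inv_mem' := by
    rintro g ⟨hg, hg'⟩
    refine ⟨inv_mem hg, ?_⟩
    have h1 : g.val * (g⁻¹).val = 1 := by rw [← Units.val_mul]; simp
    have h2 : (g⁻¹).val * g.val = 1 := by rw [← Units.val_mul]; simp
    calc tau0 n R * (g⁻¹).val
        = ((g⁻¹).val * g.val) * tau0 n R * (g⁻¹).val := by rw [h2, Matrix.one_mul]
      _ = (g⁻¹).val * (tau0 n R * g.val) * (g⁻¹).val := by
          rw [hg']; simp only [Matrix.mul_assoc]
      _ = (g⁻¹).val * tau0 n R * (g.val * (g⁻¹).val) := by simp only [Matrix.mul_assoc]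
      _ = (g⁻¹).val * tau0 n R := by rw [h1, Matrix.mul_one]

/-- The matrix `δ(lam, X) = (lam X, 0; 0, ᵗX⁻¹)`. -/
def delta {n : ℕ} {R : Type*} [CommRing R] (lam : Rˣ) (X : GL (Fin n) R) :
    Matrix (Idx n) (Idx n) R :=
  fromBlocks ((lam : R) • X.val) 0 0 (X⁻¹).valᵀ

/-- The image in `GL(K)` of a rational matrix. -/
abbrev ratMap {m : Type*} [Fintype m] [DecidableEq m] (K : Type*) [Field K] [CharZero K] :
    GL m ℚ →* GL m K :=
  Matrix.GeneralLinearGroup.map (Rat.castHom K)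

/-- `γ` is `q`-inversive: semisimple, in `GSp₂ₙ(ℚ)` with multiplier `q`, and
`τ₀ γ τ₀⁻¹ = q γ⁻¹`. -/
structure IsQInversive {n : ℕ} (q : ℕ) (γ : GL (Idx n) ℚ) : Prop where
  semisimple : Module.End.IsSemisimple (Matrix.toLin' γ.val)
  multiplier : HasMultiplier γ (q : ℚ)
  inversive : tau0 n ℚ * γ.val * (tau0 n ℚ)⁻¹ = (q : ℚ) • (γ⁻¹).val

/-- `y` is conjugate to `x` by an element of `H`. -/
def ConjBy {G : Type*} [Group G] (H : Subgroup G) (x y : G) : Prop :=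
  ∃ h ∈ H, h * x * h⁻¹ = y

/-- `H`-conjugacy on a set `S` of elements of the ambient group. -/
def conjSetoid {G : Type*} [Group G] (H : Subgroup G) (S : Set G) : Setoid S where
  r x y := ConjBy H (x : G) (y : G)
  iseqv :=
    { refl := fun x => ⟨1, one_mem _, by simp⟩
      symm := by
        rintro x y ⟨h, hh, e⟩
        exact ⟨h⁻¹, inv_mem hh, by rw [← e]; group⟩
      trans := by
        rintro x y z ⟨h, hh, e⟩ ⟨k, hk, e'⟩
        exact ⟨k * h, mul_mem hk hh, by rw [← e', ← e]; group⟩ }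

/-- The algebraic closure `ℚ̄` of `ℚ` in `ℂ`. -/
abbrev QBar : Type := algebraicClosure ℚ ℂ

instance isAlgClosure_QBar : IsAlgClosure ℚ QBar := algebraicClosure.isAlgClosure ℚ ℂ

/-! ### Deligne modules -/

open scoped Classical in
/-- A Deligne module of rank `2n` over the field with `q = p ^ a` elements. -/
structure DeligneModule (p a n : ℕ) [Fact p.Prime] where
  T : Type
  [addCommGroup : AddCommGroup T]
  [free : Module.Free ℤ T]
  [finite : Module.Finite ℤ T]
  finrank_eq : Module.finrank ℤ T = 2 * n
  F : T →ₗ[ℤ] T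
  semisimple : Module.End.IsSemisimple (F.baseChange ℚ)
  /-- All complex eigenvalues have absolute value `√q`. -/
  weil : ∀ z ∈ (F.charpoly.map (Int.castRingHom ℂ)).roots, ‖z‖ = Real.sqrt ((p ^ a : ℕ) : ℝ)
  /-- Exactly half of the eigenvalues in `ℚ̄_p` are units. -/
  half_units : ((F.charpoly.map (Int.castRingHom (PadicAlgCl p))).roots.filter
    (fun z => ‖z‖ = 1)).card = n
  /-- Half of the eigenvalues in `ℚ̄_p` are divisible by `q`. -/
  half_divisible : ((F.charpoly.map (Int.castRingHom (PadicAlgCl p))).roots.filter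
    (fun z => ‖z‖ ≤ ‖((p ^ a : ℕ) : PadicAlgCl p)‖)).card = n
  middle_coeff : IsCoprime (F.charpoly.coeff n) (p : ℤ)
  /-- The Verschiebung (unique, since `T` is torsion free). -/
  V : T →ₗ[ℤ] T
  F_V : ∀ x, F (V x) = (p ^ a : ℕ) • x
  V_F : ∀ x, V (F x) = (p ^ a : ℕ) • x

attribute [instance] DeligneModule.addCommGroup DeligneModule.free DeligneModule.finite

/-- The valuation ring `O` of `ℂ` lies above the embedding `ε : W(k̄) → ℂ`, i.e. it contains
`ε(W(k̄))` and `p` is in its maximal ideal. On the algebraic closure of `ℚ` in `ℂ` every such `O`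
induces the `p`-adic valuation determined by `ε`, and an algebraic number `z` has positive
valuation exactly if it lies in the maximal ideal `O.nonunits`. -/
structure LiesAbove {p : ℕ} [Fact p.Prime]
    (ε : WittVector p (AlgebraicClosure (ZMod p)) →+* ℂ) (O : ValuationSubring ℂ) : Prop where
  map_mem : ∀ w, ε w ∈ O
  p_mem : (p : ℂ) ∈ O.nonunits

variable {p a n : ℕ} [Fact p.Prime]

/-- The algebra `ℚ[F]`, acting on `T ⊗ ℚ`. -/
abbrev DeligneModule.QF (M : DeligneModule p a n) :
    Subalgebra ℚ (Module.End ℚ (ℚ ⊗[ℤ] M.T)) :=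
  Algebra.adjoin ℚ {M.F.baseChange ℚ}

/-- `F` as an element of `ℚ[F]`. -/
def DeligneModule.genF (M : DeligneModule p a n) : M.QF :=
  ⟨M.F.baseChange ℚ, Algebra.self_mem_adjoin_singleton ℚ _⟩

/-- The CM type `Φ_ε` on `ℚ[F]`: the `φ : ℚ[F] → ℂ` for which `φ(F)` has positive valuation. -/
def DeligneModule.cmType (O : ValuationSubring ℂ) (M : DeligneModule p a n) :
    Set (M.QF →ₐ[ℚ] ℂ) :=
  {φ | φ M.genF ∈ O.nonunits}

/-- `ι ∈ ℚ[F]` is purely imaginary and totally `Φ`-positive imaginary. (The canonical conjugation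
of `ℚ[F]` becomes complex conjugation under every `φ`, so that `ι` is purely imaginary exactly if
all `φ(ι)` are.) -/
def DeligneModule.IsPositiveImaginary (M : DeligneModule p a n) (Φ : Set (M.QF →ₐ[ℚ] ℂ))
    (ι : M.QF) : Prop :=
  (∀ φ : M.QF →ₐ[ℚ] ℂ, (φ ι).re = 0) ∧ ∀ φ ∈ Φ, 0 < (φ ι).im

/-- A real polarized Deligne module `(T, F, ω, τ)`: a Deligne module with a `Φ_ε`-positive
polarization `ω` and a real structure `τ` compatible with `ω`. -/
structure RealPolarizedModule (p a n : ℕ) [Fact p.Prime] (O : ValuationSubring ℂ)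
    extends DeligneModule p a n where
  ω : LinearMap.BilinForm ℤ T
  alternating : ω.IsAlt
  nondegenerate : (ω.baseChange ℚ).Nondegenerate
  ω_F : ∀ x y, ω (F x) y = ω x (V y)
  positive : ∃ ι : toDeligneModule.QF,
    toDeligneModule.IsPositiveImaginary (toDeligneModule.cmType O) ι ∧
    (∀ x y, (ω.baseChange ℚ) x (ι.val y) = (ω.baseChange ℚ) y (ι.val x)) ∧
    ∀ x, x ≠ 0 → 0 < (ω.baseChange ℚ) x (ι.val x)
  τ : T →ₗ[ℤ] T
  τ_τ : ∀ x, τ (τ x) = x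
  τ_F : ∀ x, τ (F (τ x)) = V x
  ω_τ : ∀ x y, ω (τ x) (τ y) = - ω x y

variable {O : ValuationSubring ℂ}

/-- `φ` is an `S`-isogeny of real polarized Deligne modules: an isomorphism
`T₁ ⊗ S → T₂ ⊗ S` commuting with `F` and `τ` with `φ^*(ω₂) = c ω₁` for some `c ∈ Sˣ`. -/
structure IsIsogeny (S : Type*) [CommRing S] (M₁ M₂ : RealPolarizedModule p a n O)
    (φ : (S ⊗[ℤ] M₁.T) ≃ₗ[S] (S ⊗[ℤ] M₂.T)) : Prop where
  comm_F : ∀ x, φ (M₁.F.baseChange S x) = M₂.F.baseChange S (φ x)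
  comm_τ : ∀ x, φ (M₁.τ.baseChange S x) = M₂.τ.baseChange S (φ x)
  multiplier : ∃ c : Sˣ, ∀ x y,
    (M₂.ω.baseChange S) (φ x) (φ y) = (c : S) * (M₁.ω.baseChange S) x y

theorem IsIsogeny.refl (S : Type*) [CommRing S] (M : RealPolarizedModule p a n O) :
    IsIsogeny S M M (LinearEquiv.refl S _) :=
  ⟨fun _ => rfl, fun _ => rfl, 1, fun _ _ => by simp⟩

theorem IsIsogeny.symm {S : Type*} [CommRing S] {M₁ M₂ : RealPolarizedModule p a n O}
    {φ : (S ⊗[ℤ] M₁.T) ≃ₗ[S] (S ⊗[ℤ] M₂.T)} (h : IsIsogeny S M₁ M₂ φ) :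
    IsIsogeny S M₂ M₁ φ.symm := by
  obtain ⟨hF, hτ, c, hc⟩ := h
  refine ⟨fun x => ?_, fun x => ?_, c⁻¹, fun x y => ?_⟩
  · rw [LinearEquiv.symm_apply_eq, hF, LinearEquiv.apply_symm_apply]
  · rw [LinearEquiv.symm_apply_eq, hτ, LinearEquiv.apply_symm_apply]
  · have := hc (φ.symm x) (φ.symm y)
    rw [LinearEquiv.apply_symm_apply, LinearEquiv.apply_symm_apply] at this
    rw [this, ← mul_assoc, Units.inv_mul, one_mul]

theorem IsIsogeny.trans {S : Type*} [CommRing S] {M₁ M₂ M₃ : RealPolarizedModule p a n O}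
    {φ : (S ⊗[ℤ] M₁.T) ≃ₗ[S] (S ⊗[ℤ] M₂.T)} {χ : (S ⊗[ℤ] M₂.T) ≃ₗ[S] (S ⊗[ℤ] M₃.T)}
    (h : IsIsogeny S M₁ M₂ φ) (h' : IsIsogeny S M₂ M₃ χ) :
    IsIsogeny S M₁ M₃ (φ.trans χ) := by
  obtain ⟨hF, hτ, c, hc⟩ := h
  obtain ⟨hF', hτ', c', hc'⟩ := h'
  refine ⟨fun x => ?_, fun x => ?_, c' * c, fun x y => ?_⟩
  · simp only [LinearEquiv.trans_apply]; rw [hF, hF']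
  · simp only [LinearEquiv.trans_apply]; rw [hτ, hτ']
  · simp only [LinearEquiv.trans_apply]; rw [hc', hc, Units.val_mul, mul_assoc]

/-- `M₁` and `M₂` are `S`-isogenous. -/
def Isogenous (S : Type*) [CommRing S] (M₁ M₂ : RealPolarizedModule p a n O) : Prop :=
  ∃ φ : (S ⊗[ℤ] M₁.T) ≃ₗ[S] (S ⊗[ℤ] M₂.T), IsIsogeny S M₁ M₂ φ

/-- The `S`-isogeny relation on the `S'`-isogeny class of `M₀`. -/
def isogenySetoid (S S' : Type*) [CommRing S] [CommRing S'] (M₀ : RealPolarizedModule p a n O) :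
    Setoid {M : RealPolarizedModule p a n O // Isogenous S' M M₀} where
  r M N := Isogenous S M.1 N.1
  iseqv :=
    { refl := fun M => ⟨_, IsIsogeny.refl S M.1⟩
      symm := fun ⟨_, h⟩ => ⟨_, h.symm⟩
      trans := fun ⟨_, h⟩ ⟨_, h'⟩ => ⟨_, h.trans h'⟩ }

/-- The group of self `S`-isogenies of `M`. -/
def selfIsogenies (S : Type*) [CommRing S] (M : RealPolarizedModule p a n O) :
    Subgroup ((S ⊗[ℤ] M.T) ≃ₗ[S] (S ⊗[ℤ] M.T)) where
  carrier := {φ | IsIsogeny S M M φ}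
  one_mem' := IsIsogeny.refl S M
  mul_mem' := fun h h' => IsIsogeny.trans h' h
  inv_mem' := fun h => IsIsogeny.symm h

/-- `ψ` embeds `T` as a lattice `L = ψ(T)` in `ℚ²ⁿ` such that `(T, F, ω, τ)` becomes
`(L, γ, ω₀, τ₀)`. -/
structure IsCoordinates (M : RealPolarizedModule p a n O) (γ : GL (Idx n) ℚ)
    (ψ : M.T →ₗ[ℤ] (Idx n → ℚ)) : Prop where
  injective : Function.Injective ψ
  map_F : ∀ x, ψ (M.F x) = γ.val *ᵥ ψ x
  map_ω : ∀ x y, ((M.ω x y : ℤ) : ℚ) = ψ x ⬝ᵥ (stdJ n ℚ *ᵥ ψ y)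
  map_τ : ∀ x, ψ (M.τ x) = tau0 n ℚ *ᵥ ψ x

/-- The `K`-linear extension `T ⊗ K → K²ⁿ` of coordinates. -/
def extendCoords (K : Type*) [Field K] [CharZero K] {T : Type*} [AddCommGroup T]
    (ψ : T →ₗ[ℤ] (Idx n → ℚ)) : (K ⊗[ℤ] T) →ₗ[K] (Idx n → K) :=
  LinearMap.liftBaseChange K
    ({ toFun := fun x i => ((ψ x i : ℚ) : K)
       map_add' := fun x y => by ext i; simp
       map_smul' := fun m x => by ext i; simp } : T →ₗ[ℤ] (Idx n → K))

/-! ### Nonabelian cohomology -/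

/-- Continuous 1-cocycles of `G` with values in the discrete `G`-group `A`. -/
abbrev Cocycle (G A : Type*) [Group G] [TopologicalSpace G] [Group A] [MulDistribMulAction G A] :
    Type _ :=
  {f : G → A // IsLocallyConstant f ∧ ∀ σ τ, f (σ * τ) = f σ * σ • f τ}

/-- Two cocycles are cohomologous. -/
def cohomologous (G A : Type*) [Group G] [TopologicalSpace G] [Group A]
    [MulDistribMulAction G A] : Setoid (Cocycle G A) where
  r f f' := ∃ b : A, ∀ σ, f'.1 σ = b⁻¹ * f.1 σ * σ • b
  iseqv :=
    { refl := fun f => ⟨1, fun σ => by simp⟩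
      symm := by
        rintro f f' ⟨b, h⟩
        exact ⟨b⁻¹, fun σ => by rw [h, smul_inv']; group⟩
      trans := by
        rintro f f' f'' ⟨b, h⟩ ⟨c, h'⟩
        exact ⟨b * c, fun σ => by rw [h', h, smul_mul']; group⟩ }

/-- The pointed set `H¹(G, A)`. -/
def H1 (G A : Type*) [Group G] [TopologicalSpace G] [Group A] [MulDistribMulAction G A] :
    Type _ :=
  Quotient (cohomologous G A)

/-- The class of a cocycle. -/
def H1.mk {G A : Type*} [Group G] [TopologicalSpace G] [Group A] [MulDistribMulAction G A]
    (f : Cocycle G A) : H1 G A :=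
  Quotient.mk (cohomologous G A) f

/-- The distinguished element of `H¹(G, A)`. -/
def H1.base (G A : Type*) [Group G] [TopologicalSpace G] [Group A] [MulDistribMulAction G A] :
    H1 G A :=
  H1.mk ⟨fun _ => 1, IsLocallyConstant.const 1, fun _ _ => by simp⟩

/-- The map `H¹(G, A) → H¹(G', A')` induced by compatible homomorphisms `ρ : G' → G` and
`j : A → A'`. -/
def H1.map {G A G' A' : Type*} [Group G] [TopologicalSpace G] [Group A]
    [MulDistribMulAction G A] [Group G'] [TopologicalSpace G'] [Group A']
    [MulDistribMulAction G' A'] (ρ : G' →* G) (hρ : Continuous ρ) (j : A →* A')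
    (hj : ∀ g b, j (ρ g • b) = g • j b) : H1 G A → H1 G' A' :=
  Quotient.map (sa := cohomologous G A) (sb := cohomologous G' A')
    (fun f => ⟨fun g => j (f.1 (ρ g)), (f.2.1.comp_continuous hρ).comp j, fun σ τ => by
      beta_reduce
      rw [map_mul, f.2.2, map_mul, hj]⟩)
    (by
      rintro f f' ⟨b, h⟩
      exact ⟨j b, fun σ => by simp only [h, map_mul, map_inv, hj]⟩)

/-! ### The group `I₀` -/

/-- The group `I₀(K)`: the centralizer of `γ₀` in `GLₙ*(K)`. -/
def I0 (γ₀ : GL (Idx n) ℚ) (K : Type*) [Field K] [CharZero K] : Subgroup (GL (Idx n) K) :=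
  GLstar n K ⊓ Subgroup.centralizer {ratMap K γ₀}

theorem map_ratMap {m : Type*} [Fintype m] [DecidableEq m] {K L : Type*} [Field K] [CharZero K]
    [Field L] [CharZero L] (f : K →+* L) (γ : GL m ℚ) :
    Matrix.GeneralLinearGroup.map f (ratMap K γ) = ratMap L γ := by
  ext i j
  simp [ratMap]

theorem map_mem_GLstar {K L : Type*} [Field K] [Field L] (f : K →+* L) {x : GL (Idx n) K}
    (hx : x ∈ GLstar n K) : Matrix.GeneralLinearGroup.map f x ∈ GLstar n L := by
  obtain ⟨⟨c, hc⟩, ht⟩ := hx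
  have hJ : (stdJ n K).map f = stdJ n L := by
    simp [stdJ, fromBlocks_map, Matrix.map_zero, Matrix.map_one, Matrix.map_neg]
  have hT : (tau0 n K).map f = tau0 n L := by
    simp [tau0, fromBlocks_map, Matrix.map_zero, Matrix.map_one, Matrix.map_neg]
  have hv : (Matrix.GeneralLinearGroup.map f x).val = x.val.map f := rfl
  refine ⟨⟨Units.map f c, ?_⟩, ?_⟩
  · have := congrArg (fun A => A.map f) hc
    simp only [Matrix.map_mul, Matrix.transpose_map, hJ] at this
    unfold HasMultiplier
    rw [hv, this]
    ext i j
    simp [← hJ]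
  · have := congrArg (fun A => A.map f) ht
    simp only [Matrix.map_mul, hT] at this
    rw [hv, this]

theorem map_mem_I0 {γ₀ : GL (Idx n) ℚ} {K L : Type*} [Field K] [CharZero K] [Field L]
    [CharZero L] (f : K →+* L) {x : GL (Idx n) K} (hx : x ∈ I0 γ₀ K) :
    Matrix.GeneralLinearGroup.map f x ∈ I0 γ₀ L := by
  refine ⟨map_mem_GLstar f hx.1, ?_⟩
  have h := Subgroup.mem_centralizer_singleton_iff.mp hx.2
  refine Subgroup.mem_centralizer_singleton_iff.mpr ?_
  rw [← map_ratMap f, ← map_mul, h, map_mul]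

/-- The homomorphism `I₀(K) → I₀(L)` induced by a field homomorphism. -/
def I0.map {γ₀ : GL (Idx n) ℚ} {K L : Type*} [Field K] [CharZero K] [Field L]
    [CharZero L] (f : K →+* L) : I0 γ₀ K →* I0 γ₀ L where
  toFun x := ⟨Matrix.GeneralLinearGroup.map f x.1, map_mem_I0 f x.2⟩
  map_one' := by ext1; simp
  map_mul' x y := by ext1; simp

/-- The Galois action on `I₀(K)`, entry by entry. -/
instance galoisAction (γ₀ : GL (Idx n) ℚ) (k K : Type*) [Field k] [Field K] [CharZero K]
    [Algebra k K] : MulDistribMulAction Gal(K/k) (I0 γ₀ K) where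
  smul σ x := I0.map (σ : K →+* K) x
  one_smul x := by
    ext i j
    rfl
  mul_smul σ τ x := by
    ext i j
    rfl
  smul_one σ := map_one (I0.map (σ : K →+* K))
  smul_mul σ x y := map_mul (I0.map (σ : K →+* K)) x y

/-- The restriction `Gal(ℂ/ℝ) → Gal(ℚ̄/ℚ)`. -/
def restrictGal : Gal(ℂ/ℝ) →* Gal(QBar/ℚ) :=
  (AlgEquiv.restrictNormalHom QBar).comp
    { toFun := fun σ : Gal(ℂ/ℝ) => (AlgEquiv.restrictScalars ℚ σ : Gal(ℂ/ℚ))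
      map_one' := rfl
      map_mul' := fun _ _ => rfl }

/-- The map `H¹(Gal(ℚ̄/ℚ), I₀) → H¹(Gal(ℂ/ℝ), I₀)`. -/
def realization (γ₀ : GL (Idx n) ℚ) :
    H1 Gal(QBar/ℚ) (I0 γ₀ QBar) → H1 Gal(ℂ/ℝ) (I0 γ₀ ℂ) :=
  H1.map restrictGal continuous_of_discreteTopology (I0.map (algebraMap QBar ℂ)) (by
    intro σ x
    ext i j
    exact AlgEquiv.restrictNormal_commutes (AlgEquiv.restrictScalars ℚ σ) QBar (x.1.val i j))

/-- The kernel of `H¹(Gal(ℚ̄/ℚ), I₀) → H¹(Gal(ℂ/ℝ), I₀)`. -/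
def kerH1 (γ₀ : GL (Idx n) ℚ) : Set (H1 Gal(QBar/ℚ) (I0 γ₀ QBar)) :=
  {c | realization γ₀ c = H1.base _ _}

/-- The group `Z(A₀) ∩ GO(B₀)` over `K`. -/
def centralizerGO (A₀ B₀ : Matrix (Fin n) (Fin n) ℚ) (K : Type*) [Field K] [CharZero K] :
    Subgroup (GL (Fin n) K) where
  carrier := {X | X.val * A₀.map (Rat.castHom K) = A₀.map (Rat.castHom K) * X.val ∧
    ∃ μ : Kˣ, X.val * B₀.map (Rat.castHom K) * (X.val)ᵀ = (μ : K) • B₀.map (Rat.castHom K)}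
  one_mem' := ⟨by simp, 1, by simp⟩
  mul_mem' := by
    rintro X Y ⟨hX, μ, hμ⟩ ⟨hY, ν, hν⟩
    refine ⟨?_, ν * μ, ?_⟩
    · rw [Units.val_mul, Matrix.mul_assoc, hY, ← Matrix.mul_assoc, hX, Matrix.mul_assoc]
    · calc (X * Y).val * B₀.map (Rat.castHom K) * ((X * Y).val)ᵀ
          = X.val * (Y.val * B₀.map (Rat.castHom K) * (Y.val)ᵀ) * (X.val)ᵀ := by
            simp [Matrix.transpose_mul, Matrix.mul_assoc]
        _ = _ := by
            rw [hν, Matrix.mul_smul, Matrix.smul_mul, hμ, smul_smul, Units.val_mul]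
  inv_mem' := by
    rintro X ⟨hX, μ, hμ⟩
    have h1 : X.val * (X⁻¹).val = 1 := by rw [← Units.val_mul]; simp
    have h2 : (X⁻¹).val * X.val = 1 := by rw [← Units.val_mul]; simp
    have h3 : (X.val)ᵀ * ((X⁻¹).val)ᵀ = 1 := by
      rw [← Matrix.transpose_mul, h2, Matrix.transpose_one]
    refine ⟨?_, μ⁻¹, ?_⟩
    · calc (X⁻¹).val * A₀.map (Rat.castHom K)
          = (X⁻¹).val * (A₀.map (Rat.castHom K) * X.val) * (X⁻¹).val := by
            rw [Matrix.mul_assoc, Matrix.mul_assoc, h1, Matrix.mul_one]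
        _ = ((X⁻¹).val * X.val) * A₀.map (Rat.castHom K) * (X⁻¹).val := by
            rw [← hX]; simp only [Matrix.mul_assoc]
        _ = _ := by rw [h2, Matrix.one_mul]
    · have h4 : (μ : K) • ((X⁻¹).val * B₀.map (Rat.castHom K) * ((X⁻¹).val)ᵀ) =
          B₀.map (Rat.castHom K) := by
        calc (μ : K) • ((X⁻¹).val * B₀.map (Rat.castHom K) * ((X⁻¹).val)ᵀ)
            = (X⁻¹).val * ((μ : K) • B₀.map (Rat.castHom K)) * ((X⁻¹).val)ᵀ := by
              rw [Matrix.mul_smul, Matrix.smul_mul]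
          _ = ((X⁻¹).val * X.val) * B₀.map (Rat.castHom K) * ((X.val)ᵀ * ((X⁻¹).val)ᵀ) := by
              rw [← hμ]; simp only [Matrix.mul_assoc]
          _ = _ := by rw [h2, h3, Matrix.one_mul, Matrix.mul_one]
      calc (X⁻¹).val * B₀.map (Rat.castHom K) * ((X⁻¹).val)ᵀ
          = ((μ⁻¹ : Kˣ) : K) •
            ((μ : K) • ((X⁻¹).val * B₀.map (Rat.castHom K) * ((X⁻¹).val)ᵀ)) := by
              rw [smul_smul, Units.inv_mul, one_smul]
        _ = _ := by rw [h4]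

/-! ### The sets of matrices -/

/-- The form `v ↦ ᵗv B v` on the eigenspace of `ᵗA` in `ℝⁿ` with eigenvalue `β`. -/
def eigenForm (A B : Matrix (Fin n) (Fin n) ℚ) (β : ℝ) :
    QuadraticForm ℝ
      (Module.End.eigenspace (Matrix.toLin' (A.map (Rat.castHom ℝ))ᵀ) β) :=
  (Matrix.toQuadraticForm' (B.map (Rat.castHom ℝ))).restrict _

/-- The equality `sig(B; A) = sig(B'; A)` of collections of signatures, one for each real
eigenvalue. -/
def SameSignatures (A B B' : Matrix (Fin n) (Fin n) ℚ) : Prop :=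
  ∀ β : ℝ, sigPos (eigenForm A B β) = sigPos (eigenForm A B' β) ∧
    sigNeg (eigenForm A B β) = sigNeg (eigenForm A B' β)

/-- The symmetric nonsingular `B` with `A₀ B = B ᵗA₀` and `sig(B; A₀) = sig(B₀; A₀)`. -/
def setB (A₀ B₀ : Matrix (Fin n) (Fin n) ℚ) : Set (Matrix (Fin n) (Fin n) ℚ) :=
  {B | B.IsSymm ∧ IsUnit B.det ∧ A₀ * B = B * A₀ᵀ ∧ SameSignatures A₀ B B₀}

/-- The relation `B' = lam X B ᵗX` with `lam ∈ ℚˣ` and `X ∈ GLₙ(ℚ)` commuting with `A₀`, which is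
the effect on `B` of conjugation by the elements `δ(lam, X)` of `GLₙ*(ℚ)` that fix `A₀`. -/
def congruenceSetoid (A₀ B₀ : Matrix (Fin n) (Fin n) ℚ) : Setoid (setB A₀ B₀) where
  r B B' := ∃ (lam : ℚˣ) (X : GL (Fin n) ℚ), X.val * A₀ = A₀ * X.val ∧
    B'.1 = (lam : ℚ) • (X.val * B.1 * (X.val)ᵀ)
  iseqv :=
    { refl := fun B => ⟨1, 1, by simp, by simp⟩
      symm := by
        rintro B B' ⟨lam, X, hX, hB⟩
        have h1 : X.val * (X⁻¹).val = 1 := by rw [← Units.val_mul]; simp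
        have h2 : (X⁻¹).val * X.val = 1 := by rw [← Units.val_mul]; simp
        have h3 : (X.val)ᵀ * ((X⁻¹).val)ᵀ = 1 := by
          rw [← Matrix.transpose_mul, h2, Matrix.transpose_one]
        refine ⟨lam⁻¹, X⁻¹, ?_, ?_⟩
        · calc (X⁻¹).val * A₀ = (X⁻¹).val * (A₀ * X.val) * (X⁻¹).val := by
                rw [Matrix.mul_assoc, Matrix.mul_assoc, h1, Matrix.mul_one]
            _ = ((X⁻¹).val * X.val) * A₀ * (X⁻¹).val := by
                rw [← hX]; simp only [Matrix.mul_assoc]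
            _ = _ := by rw [h2, Matrix.one_mul]
        · rw [hB, Matrix.mul_smul, Matrix.smul_mul, smul_smul, Units.inv_mul, one_smul]
          calc B.1 = ((X⁻¹).val * X.val) * B.1 * ((X.val)ᵀ * ((X⁻¹).val)ᵀ) := by
                rw [h2, h3, Matrix.one_mul, Matrix.mul_one]
            _ = _ := by simp only [Matrix.mul_assoc]
      trans := by
        rintro B B' B'' ⟨lam, X, hX, hB⟩ ⟨lam', Y, hY, hB'⟩
        refine ⟨lam' * lam, Y * X, ?_, ?_⟩
        · rw [Units.val_mul, Matrix.mul_assoc, hX, ← Matrix.mul_assoc, hY, Matrix.mul_assoc]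
        · rw [hB', hB, Matrix.mul_smul, Matrix.smul_mul, smul_smul, Units.val_mul]
          simp [Matrix.transpose_mul, Matrix.mul_assoc] }

/-- The `q`-inversive `γ` that are conjugate to `γ₀` by an element of `GLₙ*(ℚ̄)` and by an element
of `GSp₂ₙ(ℝ)`. -/
def setQBarReal (q : ℕ) (γ₀ : GL (Idx n) ℚ) : Set (GL (Idx n) ℚ) :=
  {γ | IsQInversive q γ ∧ ConjBy (GLstar n QBar) (ratMap QBar γ₀) (ratMap QBar γ) ∧
    ConjBy (GSp n ℝ) (ratMap ℝ γ₀) (ratMap ℝ γ)}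

/-- The `q`-inversive `γ` that are conjugate to `γ₀` by an element of `GLₙ*(ℝ)`. -/
def setReal (q : ℕ) (γ₀ : GL (Idx n) ℚ) : Set (GL (Idx n) ℚ) :=
  {γ | IsQInversive q γ ∧ ConjBy (GLstar n ℝ) (ratMap ℝ γ₀) (ratMap ℝ γ)}

/-- The set of `GLₙ*(ℚ)`-conjugacy classes in `setReal`. -/
abbrev RealClasses (q : ℕ) (γ₀ : GL (Idx n) ℚ) : Type :=
  Quotient (conjSetoid (GLstar n ℚ) (setReal q γ₀))

end RealDeligne

end

noncomputable section

namespace RealDeligne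

/-! ### Rational points and rational similarity -/

section Rationality

variable {K m : Type*} [Field K] [CharZero K] [Fintype m] [DecidableEq m]

/-! Conjugating a `q`-inversive γ = (A, B; C, ᵗA) by δ(λ, X) turns A into XAX⁻¹ and B into λXBᵗX,
and C is recovered from BC = A² − q as soon as B is invertible. Matrices that are similar over an
extension field are similar over ℚ (`exists_rat_similar`), so A can be moved to A₀ by rational
conjugation. What remains is the classification of the symmetric B with A₀B = BᵗA₀ up to scaled
congruence by the centralizer of A₀, and I₀ is the group of those X in this centralizer that
multiply B₀ by a scalar.

The Weil condition and the `p`-adic condition together say that the eigenvalues of γ₀ are nonreal of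
absolute value √q (`IsCoordinates.root`). Since γ + qγ⁻¹ = 2 diag(A, ᵗA), the matrix A₀ is
diagonalizable over ℝ with eigenvalues β satisfying β² < q, so A₀² − q and B are invertible. The
decisive point is that positivity of the polarization makes ᵗvBv definite on each eigenspace of ᵗA₀,
with a sign that depends only on whether β + i√(q − β²) has positive valuation
(`definiteWith_forcedSign`). Hence equality of signatures with B₀ means definiteness with these
signs, and a module whose γ is `GLₙ*`-conjugate to γ₀ over any extension field satisfies it
automatically (`IsCoordinates.hasNormalForm`).

If B and B₀ are definite with the same signs, a polynomial in ᵗA₀ taking the value of the sign at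
each eigenvalue makes both positive definite, so S = BB₀⁻¹ is diagonalizable with positive
eigenvalues. A square root X = f(S), with f a polynomial, commutes with A₀ and satisfies XB₀ᵗX = B
(`exists_congr_of_diagonalizable`). Such an f exists over ℝ, and also over every algebraically
closed field, because the rational minimal polynomial of S is squarefree. Conversely, an element of
GSp(ℝ) conjugating γ₀ to γ respects the eigenspaces of γ + qγ⁻¹ and multiplies the form ᵗxJγx by its
multiplier, so the signs agree up to one global sign, which δ(−1, 1) absorbs. Thus both real
descriptions of the set of γ amount to `HasNormalForm`.

For modules, a symplectic basis adapted to the involution gives coordinates, in which isogenies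
become elements of `GLₙ*`. To realize a given class, the lattice, Frobenius and involution of the
base module are kept, and only the polarization is replaced. The cohomological description is the
usual one: g⁻¹σ(g) is a cocycle in the centralizer, and Hilbert 90 for `GLₙ*`, which is GLₙ × GL₁
for n > 0, shows that every cocycle arises in this way. -/

/-- A linear pencil of matrices that is nonsingular at some point is nonsingular at a rational
point. -/
theorem exists_rat_det_ne_zero {ι : Type*} [Fintype ι] (b : ι → Matrix m m K) (t : ι → K)
    (h : (∑ i, t i • b i).det ≠ 0) : ∃ r : ι → ℚ, (∑ i, (r i : K) • b i).det ≠ 0 := by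
  classical
  -- The determinant is a polynomial in the parameters. If it vanished at all rational points it
  -- would be zero, because ℚ is an infinite subset of the domain `K`.
  let P : MvPolynomial ι K := (∑ i, (MvPolynomial.X i : MvPolynomial ι K) •
    (b i).map (MvPolynomial.C : K →+* MvPolynomial ι K)).det
  have hP : ∀ x : ι → K, MvPolynomial.eval x P = (∑ i, x i • b i).det := by
    intro x
    rw [RingHom.map_det]
    congr 1
    ext k l
    simp [Matrix.sum_apply]
  by_contra! hr
  have h0 : P = 0 := by
    refine MvPolynomial.funext_set (fun _ : ι => Set.range ((↑) : ℚ → K))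
      (fun _ => Set.infinite_range_of_injective Rat.cast_injective) fun x hx => ?_
    have hx' : ∀ i, ∃ r : ℚ, (r : K) = x i := fun i => hx i (Set.mem_univ i)
    choose r hr' using hx'
    rw [hP, map_zero, ← hr r]
    simp [hr']
  exact h (by rw [← hP, h0, map_zero])

/-- Two families of rational matrices that are simultaneously similar over an extension field are
simultaneously similar over `ℚ`. -/
theorem exists_rat_similar {J : Type*} (M N : J → Matrix m m ℚ) (X : GL m K)
    (h : ∀ j, X.val * (M j).map (Rat.castHom K) = (N j).map (Rat.castHom K) * X.val) :
    ∃ Y : GL m ℚ, ∀ j, Y.val * M j = N j * Y.val := by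
  classical
  -- Expand the entries of `X` in a ℚ-basis of `K`. The matrices `M j` and `N j` being rational,
  -- each coordinate matrix `Z i` satisfies the same intertwining relations. `X` is a nonsingular
  -- `K`-combination of the `Z i`, so some rational combination is nonsingular as well.
  let β := Module.Basis.ofVectorSpace ℚ K
  let s : Finset (Module.Basis.ofVectorSpaceIndex ℚ K) :=
    Finset.univ.biUnion fun i => Finset.univ.biUnion fun j => (β.repr (X.val i j)).support
  let Z : s → Matrix m m ℚ := fun i => X.val.map (fun x => β.repr x i)
  have hX : X.val = ∑ i : s, β i • (Z i).map (Rat.castHom K) := by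
    ext k l
    rw [Matrix.sum_apply]
    simp only [Matrix.smul_apply, Matrix.map_apply, Z, smul_eq_mul, Rat.coe_castHom]
    rw [Finset.sum_coe_sort s (fun i => β i * ((β.repr (X.val k l) i : ℚ) : K))]
    conv_lhs => rw [← β.linearCombination_repr (X.val k l), Finsupp.linearCombination_apply]
    rw [Finsupp.sum_of_support_subset (s := s)]
    · refine Finset.sum_congr rfl fun i _ => ?_
      rw [Algebra.smul_def, mul_comm]; rfl
    · intro i hi
      simp only [s, Finset.mem_biUnion, Finset.mem_univ, true_and]
      exact ⟨k, l, hi⟩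
    · simp
  have hZ : ∀ i j, Z i * M j = N j * Z i := by
    intro i j
    ext k l
    have e := congrArg (fun A => β.repr (A k l) i) (h j)
    simp only [Matrix.mul_apply, Matrix.map_apply, map_sum, Finsupp.finsetSum_apply] at e
    simp only [Matrix.mul_apply, Z, Matrix.map_apply]
    have e1 : ∀ (x : K) (r : ℚ), β.repr (x * Rat.castHom K r) i = β.repr x i * r := by
      intro x r
      have : x * Rat.castHom K r = r • x := by rw [Algebra.smul_def, mul_comm]; rfl
      rw [this, map_smul, Finsupp.smul_apply, smul_eq_mul, mul_comm]
    simp only [mul_comm (Rat.castHom K _), e1] at e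
    rw [e]
    exact Finset.sum_congr rfl fun _ _ => mul_comm _ _
  have hdet : (∑ i : s, β i • (Z i).map (Rat.castHom K)).det ≠ 0 := by
    rw [← hX]; exact ((Matrix.isUnit_iff_isUnit_det _).mp X.isUnit).ne_zero
  obtain ⟨r, hr⟩ := exists_rat_det_ne_zero _ _ hdet
  have hY : (∑ i, r i • Z i).det ≠ 0 := by
    intro h0
    apply hr
    have : ∑ i, (r i : K) • (Z i).map (Rat.castHom K) =
        (∑ i, r i • Z i).map (Rat.castHom K) := by
      ext k l
      simp [Matrix.sum_apply]
    rw [this, ← RingHom.mapMatrix_apply, ← RingHom.map_det, h0, map_zero]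
  refine ⟨Matrix.GeneralLinearGroup.mkOfDetNeZero _ hY, fun j => ?_⟩
  change (∑ i, r i • Z i) * M j = N j * ∑ i, r i • Z i
  simp [Finset.sum_mul, Finset.mul_sum, hZ]

end Rationality

/-! ### Square roots of diagonalizable matrices -/

section SquareRoot

open Polynomial

variable {K m : Type*} [Field K] [Fintype m] [DecidableEq m]

/-- A diagonalizable matrix whose eigenvalues are squares is the square of a polynomial in it. -/
theorem exists_aeval_sq_eq (S : Matrix m m K) (s : Finset K)
    (hs : aeval S (∏ x ∈ s, (X - C x)) = 0) (hsq : ∀ x ∈ s, IsSquare x) :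
    ∃ f : K[X], aeval S f * aeval S f = S := by
  classical
  have : ∀ x : K, ∃ y, x ∈ s → x = y * y := fun x => by
    by_cases hx : x ∈ s
    · obtain ⟨y, hy⟩ := hsq x hx; exact ⟨y, fun _ => hy⟩
    · exact ⟨0, fun h => absurd h hx⟩
  choose r hr using this
  -- `f` takes a square root of `x` as its value at every eigenvalue `x`, so f² − X is divisible by
  -- the annihilating product.
  let f := Lagrange.interpolate s id r
  have hf : ∀ x ∈ s, f.eval x = r x := fun x hx =>
    Lagrange.eval_interpolate_at_node (v := id) r (Set.injOn_id _) hx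
  have hdvd : ∏ x ∈ s, (X - C x) ∣ f * f - X := by
    refine Finset.prod_dvd_of_coprime
      (fun x _ y _ hxy => isCoprime_X_sub_C_of_isUnit_sub (sub_ne_zero.mpr hxy).isUnit)
      fun x hx => ?_
    rw [dvd_iff_isRoot, IsRoot.def, eval_sub, eval_mul, hf x hx, eval_X, ← hr x hx, sub_self]
  obtain ⟨g, hg⟩ := hdvd
  refine ⟨f, ?_⟩
  have := congrArg (aeval S) hg
  rw [map_mul, hs, zero_mul, map_sub, map_mul, aeval_X, sub_eq_zero] at this
  exact this

/-- If `B B₀⁻¹` is diagonalizable with square eigenvalues, then `B` and `B₀` are congruent through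
a matrix in the centralizer of `A`. -/
theorem exists_congr_of_diagonalizable {A B B₀ : Matrix m m K} (hB : B.IsSymm) (hB₀ : B₀.IsSymm)
    (hB' : IsUnit B.det) (hB₀' : IsUnit B₀.det) (hA : A * B = B * Aᵀ) (hA₀ : A * B₀ = B₀ * Aᵀ)
    (s : Finset K) (hs : aeval (B * B₀⁻¹) (∏ x ∈ s, (Polynomial.X - C x)) = 0)
    (hsq : ∀ x ∈ s, IsSquare x) :
    ∃ X : GL m K, X.val * A = A * X.val ∧ X.val * B₀ * (X.val)ᵀ = B := by
  obtain ⟨f, hf⟩ := exists_aeval_sq_eq _ s hs hsq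
  -- The congruence will be f(S) with f(S)² = S. As S commutes with A and SB₀ = B₀ᵗS, one has
  -- f(S)B₀ᵗf(S) = f(S)²B₀ = SB₀ = B.
  set S := B * B₀⁻¹ with hS
  have hSB : S * B₀ = B := by rw [hS, Matrix.mul_assoc, Matrix.nonsing_inv_mul _ hB₀', mul_one]
  have hST : B₀ * Sᵀ = B := by
    rw [hS, Matrix.transpose_mul, Matrix.transpose_nonsing_inv, hB.eq, hB₀.eq, ← Matrix.mul_assoc,
      Matrix.mul_nonsing_inv _ hB₀', one_mul]
  have hcA : A * S = S * A := by
    have h1 : Aᵀ * B₀⁻¹ = B₀⁻¹ * A := by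
      calc Aᵀ * B₀⁻¹ = B₀⁻¹ * (B₀ * Aᵀ) * B₀⁻¹ := by
            rw [← Matrix.mul_assoc, Matrix.nonsing_inv_mul _ hB₀', one_mul]
        _ = _ := by
            rw [← hA₀, Matrix.mul_assoc, Matrix.mul_assoc, Matrix.mul_nonsing_inv _ hB₀', mul_one]
    rw [hS, ← Matrix.mul_assoc, hA, Matrix.mul_assoc, h1, Matrix.mul_assoc]
  have hfA : Commute A (aeval S f) := by
    refine f.induction_on (motive := fun f => Commute A (aeval S f)) ?_ ?_ ?_
    · intro x; rw [aeval_C]; exact (Algebra.commutes x A).symm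
    · intro p q hp hq; rw [map_add]; exact hp.add_right hq
    · intro k x _
      rw [map_mul, aeval_C, map_pow, aeval_X]
      exact (show Commute A (algebraMap K _ x) from (Algebra.commutes x A).symm).mul_right
        ((show Commute A S from hcA).pow_right _)
  have hfT : B₀ * (aeval S f)ᵀ = aeval S f * B₀ := by
    have hpow : ∀ k : ℕ, B₀ * (S ^ k)ᵀ = S ^ k * B₀ := by
      intro k
      induction k with
      | zero => simp
      | succ k ih =>
        rw [pow_succ, Matrix.transpose_mul, ← Matrix.mul_assoc, hST, ← hSB, Matrix.mul_assoc,
          ih, ← Matrix.mul_assoc, ← pow_succ', ← pow_succ]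
    rw [aeval_eq_sum_range]
    simp only [Matrix.transpose_sum, Matrix.transpose_smul, Finset.mul_sum, Finset.sum_mul,
      Matrix.mul_smul, Matrix.smul_mul, hpow]
  have hdet : IsUnit (aeval S f).det := by
    have : IsUnit S.det := by
      rw [hS, Matrix.det_mul]; exact hB'.mul ((Matrix.isUnit_nonsing_inv_det_iff).mpr hB₀')
    rw [← hf, Matrix.det_mul] at this
    exact isUnit_of_mul_isUnit_left this
  refine ⟨Matrix.nonsingInvUnit _ hdet, hfA.eq.symm, ?_⟩
  change aeval S f * B₀ * (aeval S f)ᵀ = B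
  rw [Matrix.mul_assoc, hfT, ← Matrix.mul_assoc, hf, hSB]

end SquareRoot

end RealDeligne

namespace RealDeligne

/-! ### Block matrices -/

variable {n : ℕ}

theorem tau0_mul_tau0 {R : Type*} [CommRing R] : tau0 n R * tau0 n R = 1 := by
  simp [tau0, fromBlocks_multiply, fromBlocks_one]

theorem tau0_inv {R : Type*} [CommRing R] : (tau0 n R)⁻¹ = tau0 n R :=
  Matrix.inv_eq_right_inv tau0_mul_tau0

theorem map_stdJ {K L : Type*} [CommRing K] [CommRing L] (f : K →+* L) :
    (stdJ n K).map f = stdJ n L := by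
  simp [stdJ, fromBlocks_map, Matrix.map_zero, Matrix.map_one, Matrix.map_neg]

theorem map_tau0 {K L : Type*} [CommRing K] [CommRing L] (f : K →+* L) :
    (tau0 n K).map f = tau0 n L := by
  simp [tau0, fromBlocks_map, Matrix.map_zero, Matrix.map_one, Matrix.map_neg]

/-- `δ(lam, X)` as an invertible matrix. -/
def deltaGL {R : Type*} [CommRing R] (lam : Rˣ) (X : GL (Fin n) R) : GL (Idx n) R where
  val := delta lam X
  inv := delta lam⁻¹ X⁻¹
  val_inv := by
    have h : ((X⁻¹).val)ᵀ * (X.val)ᵀ = 1 := by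
      rw [← Matrix.transpose_mul, ← Units.val_mul, mul_inv_cancel, Units.val_one,
        Matrix.transpose_one]
    simp [delta, fromBlocks_multiply, fromBlocks_one, smul_smul, h, -coe_units_inv]
  inv_val := by
    have h : (X.val)ᵀ * ((X⁻¹).val)ᵀ = 1 := by
      rw [← Matrix.transpose_mul, ← Units.val_mul, inv_mul_cancel, Units.val_one,
        Matrix.transpose_one]
    simp [delta, fromBlocks_multiply, fromBlocks_one, smul_smul, h, -coe_units_inv]

@[simp] theorem deltaGL_val {R : Type*} [CommRing R] (lam : Rˣ) (X : GL (Fin n) R) :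
    (deltaGL lam X).val = delta lam X := rfl

theorem hasMultiplier_deltaGL {R : Type*} [CommRing R] (lam : Rˣ) (X : GL (Fin n) R) :
    HasMultiplier (deltaGL lam X) (lam : R) := by
  have h : (X.val)ᵀ * ((X⁻¹).val)ᵀ = 1 := by
    rw [← Matrix.transpose_mul, ← Units.val_mul, inv_mul_cancel, Units.val_one,
      Matrix.transpose_one]
  have h' : (X⁻¹).val * X.val = 1 := by
    rw [← Units.val_mul, inv_mul_cancel, Units.val_one]
  simp [HasMultiplier, delta, stdJ, fromBlocks_multiply, fromBlocks_transpose, fromBlocks_smul, h,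
    h', -coe_units_inv]

theorem deltaGL_mem {R : Type*} [CommRing R] (lam : Rˣ) (X : GL (Fin n) R) :
    deltaGL lam X ∈ GLstar n R :=
  ⟨⟨lam, hasMultiplier_deltaGL lam X⟩, by simp [tau0, delta, fromBlocks_multiply]⟩

/-- A matrix commuting with `τ₀` is block diagonal. -/
theorem exists_blockDiag_of_commute {K : Type*} [Field K] [CharZero K]
    {M : Matrix (Idx n) (Idx n) K} (h : tau0 n K * M = M * tau0 n K) :
    ∃ P Q, M = fromBlocks P 0 0 Q := by
  rw [← fromBlocks_toBlocks M, tau0, fromBlocks_multiply, fromBlocks_multiply,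
    fromBlocks_inj] at h
  simp only [zero_mul, add_zero, mul_zero, zero_add, neg_mul, one_mul, mul_neg, mul_one] at h
  have h0 : ∀ N : Matrix (Fin n) (Fin n) K, N = -N → N = 0 := fun N hN => by
    ext i j
    exact self_eq_neg.mp (congrFun (congrFun hN i) j)
  refine ⟨M.toBlocks₁₁, M.toBlocks₂₂, ?_⟩
  conv_lhs => rw [← fromBlocks_toBlocks M, h0 _ h.2.1.symm, h0 _ h.2.2.1]

/-- Commuting with τ₀ leaves two diagonal blocks P and Q, and the symplectic relation reads ᵗPQ = c.
So X = ᵗQ⁻¹ gives P = cX, with the multiplier as the scalar. -/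
theorem exists_eq_deltaGL {K : Type*} [Field K] [CharZero K] {g : GL (Idx n) K}
    (hg : g ∈ GLstar n K) : ∃ (lam : Kˣ) (X : GL (Fin n) K), g = deltaGL lam X := by
  obtain ⟨⟨c, hc⟩, ht⟩ := hg
  obtain ⟨P, Q, hPQ⟩ := exists_blockDiag_of_commute ht
  rw [HasMultiplier, hPQ, fromBlocks_transpose, stdJ, fromBlocks_multiply, fromBlocks_multiply,
    fromBlocks_smul, fromBlocks_inj] at hc
  obtain ⟨-, h1, h2, -⟩ := hc
  simp only [mul_one, mul_zero, add_zero, zero_add, Matrix.transpose_zero, zero_mul] at h1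
  have h3 : Q * (((c⁻¹ : Kˣ) : K) • Pᵀ) = 1 := by
    rw [mul_eq_one_comm, Matrix.smul_mul, h1, smul_smul, Units.inv_mul, one_smul]
  let Y : GL (Fin n) K := ⟨Q, ((c⁻¹ : Kˣ) : K) • Pᵀ, h3, by rw [mul_eq_one_comm, h3]⟩
  let X : GL (Fin n) K := ⟨(Y⁻¹).valᵀ, Y.valᵀ,
    by rw [← Matrix.transpose_mul, ← Units.val_mul]; simp,
    by rw [← Matrix.transpose_mul, ← Units.val_mul]; simp⟩
  refine ⟨c, X, Units.ext ?_⟩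
  rw [hPQ, deltaGL_val, delta, fromBlocks_inj]
  refine ⟨?_, rfl, rfl, ?_⟩
  · change P = (c : K) • (((c⁻¹ : Kˣ) : K) • Pᵀ)ᵀ
    rw [Matrix.transpose_smul, smul_smul, Units.mul_inv, one_smul, Matrix.transpose_transpose]
  · change Q = Qᵀᵀ
    rw [Matrix.transpose_transpose]

/-- The blocks `A, B, C` of an inversive symplectic similitude `(A, B; C, ᵗA)` with
multiplier `q`. -/
structure InversiveBlocks {K : Type*} [Field K] (q : K) (A B C : Matrix (Fin n) (Fin n) K) :
    Prop where
  symm_B : B.IsSymm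
  symm_C : C.IsSymm
  AB : A * B = B * Aᵀ
  CA : C * A = Aᵀ * C
  BC : B * C = A ^ 2 - q • (1 : Matrix (Fin n) (Fin n) K)
  CB : C * B = Aᵀ ^ 2 - q • (1 : Matrix (Fin n) (Fin n) K)

/-- The relations `ᵗγJγ = qJ` and `τ₀γτ₀γ = q`. -/
def IsInversive {K : Type*} [Field K] (q : K) (γ : GL (Idx n) K) : Prop :=
  HasMultiplier γ q ∧ tau0 n K * γ.val * tau0 n K * γ.val = q • 1

/-- Combining ᵗγJγ = qJ with τ₀γτ₀γ = q and cancelling γ gives the linear relation ᵗγJ = Jτ₀γτ₀. Its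
blocks say that D = ᵗA and that B and C are symmetric; the remaining relations are the blocks of
τ₀γτ₀γ = q. -/
theorem isInversive_iff_blocks {K : Type*} [Field K] {q : K}
    {γ : GL (Idx n) K} {A B C D : Matrix (Fin n) (Fin n) K} (hγ : γ.val = fromBlocks A B C D) :
    IsInversive q γ ↔ D = Aᵀ ∧ InversiveBlocks q A B C := by
  have key : IsInversive q γ ↔ ((Aᵀ * C = Cᵀ * A ∧ Aᵀ * D - Cᵀ * B = q • 1 ∧
      Bᵀ * C - Dᵀ * A = -(q • 1) ∧ Bᵀ * D = Dᵀ * B) ∧ (A * A - B * C = q • 1 ∧ A * B = B * D ∧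
      D * C = C * A ∧ D * D - C * B = q • 1)) := by
    rw [IsInversive, HasMultiplier, hγ, fromBlocks_transpose, stdJ, fromBlocks_multiply,
      fromBlocks_multiply, fromBlocks_smul, fromBlocks_inj, ← fromBlocks_one, tau0,
      fromBlocks_multiply, fromBlocks_multiply, fromBlocks_multiply, fromBlocks_smul,
      fromBlocks_inj]
    refine and_congr (and_congr ?_ (and_congr ?_ (and_congr ?_ ?_)))
      (and_congr ?_ (and_congr ?_ (and_congr ?_ ?_))) <;>
    simp only [mul_one, mul_zero, add_zero, zero_add, zero_mul, mul_neg, neg_mul, smul_zero,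
      smul_neg, one_mul, neg_neg] <;>
      constructor <;> intro h <;>
      linear_combination (norm := abel) h
  have hJ : IsInversive q γ → (γ.val)ᵀ * stdJ n K = stdJ n K * (tau0 n K * γ.val * tau0 n K) := by
    rintro ⟨h1, h2⟩
    have h3 : γ.val * (γ⁻¹).val = 1 := by rw [← Units.val_mul]; simp
    calc (γ.val)ᵀ * stdJ n K = ((γ.val)ᵀ * stdJ n K * γ.val) * (γ⁻¹).val := by
          rw [Matrix.mul_assoc, h3, mul_one]
      _ = stdJ n K * (q • 1) * (γ⁻¹).val := by
          rw [show (γ.val)ᵀ * stdJ n K * γ.val = q • stdJ n K from h1]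
          simp
      _ = stdJ n K * (tau0 n K * γ.val * tau0 n K) * (γ.val * (γ⁻¹).val) := by
          rw [← h2]; simp only [Matrix.mul_assoc]
      _ = _ := by rw [h3, mul_one]
  constructor
  · intro h
    have h4 := hJ h
    rw [hγ, fromBlocks_transpose, stdJ, tau0, fromBlocks_multiply, fromBlocks_multiply,
      fromBlocks_multiply, fromBlocks_multiply, fromBlocks_inj] at h4
    simp only [mul_one, mul_zero, add_zero, zero_add, zero_mul, mul_neg, neg_mul, one_mul,
      neg_neg, neg_zero] at h4
    obtain ⟨hC, hD, hD', hB⟩ := h4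
    obtain ⟨-, h5, h6, h7, h8⟩ := key.mp h
    obtain rfl : D = Aᵀ := hD.symm
    refine ⟨rfl, hB, neg_inj.mp hC, h6, h7.symm, ?_, ?_⟩
    · rw [← h5, pow_two]; abel
    · rw [← h8, pow_two]; abel
  · rintro ⟨rfl, h⟩
    obtain ⟨hB, hC, h1, h2, h3, h4⟩ := h
    rw [key, hB.eq, hC.eq, Matrix.transpose_transpose, h3, h4, pow_two, pow_two]
    refine ⟨⟨h2.symm, ?_, ?_, h1.symm⟩, ?_, h1, h2.symm, ?_⟩ <;> abel

theorem exists_inversiveBlocks {K : Type*} [Field K] {q : K}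
    {γ : GL (Idx n) K} (h : IsInversive q γ) :
    ∃ A B C, γ.val = fromBlocks A B C Aᵀ ∧ InversiveBlocks q A B C := by
  have e := (fromBlocks_toBlocks γ.val).symm
  obtain ⟨h1, h2⟩ := (isInversive_iff_blocks e).mp h
  exact ⟨_, _, _, by rw [← h1]; exact e, h2⟩

/-- Multiplying by γ removes the inverse; in this polynomial form the condition is easily
transported along field extensions and conjugations. -/
theorem isQInversive_iff {q : ℕ} {γ : GL (Idx n) ℚ} :
    IsQInversive q γ ↔ Module.End.IsSemisimple (Matrix.toLin' γ.val) ∧ IsInversive (q : ℚ) γ := by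
  have h1 : γ.val * (γ⁻¹).val = 1 := by rw [← Units.val_mul]; simp
  have h2 : (γ⁻¹).val * γ.val = 1 := by rw [← Units.val_mul]; simp
  constructor
  · rintro ⟨hs, hm, hi⟩
    refine ⟨hs, hm, ?_⟩
    rw [tau0_inv] at hi
    rw [hi, Matrix.smul_mul, h2]
  · rintro ⟨hs, hm, hi⟩
    refine ⟨hs, hm, ?_⟩
    rw [tau0_inv]
    calc _ = tau0 n ℚ * γ.val * tau0 n ℚ * (γ.val * (γ⁻¹).val) := by rw [h1, mul_one]
      _ = _ := by rw [← Matrix.mul_assoc, hi, Matrix.smul_mul, one_mul]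

/-- The equations for `δ(lam, X)` to conjugate one inversive element to another. -/
theorem delta_mul_eq_iff {K : Type*} [Field K] {q : K} {A B C A' B' C' : Matrix (Fin n) (Fin n) K}
    (h : InversiveBlocks q A B C) (h' : InversiveBlocks q A' B' C') (hB' : IsUnit B'.det)
    (lam : Kˣ) (X : GL (Fin n) K) :
    delta lam X * fromBlocks A B C Aᵀ = fromBlocks A' B' C' A'ᵀ * delta lam X ↔
      X.val * A = A' * X.val ∧ (lam : K) • (X.val * B * (X.val)ᵀ) = B' := by
  have t1 : (X⁻¹).valᵀ * (X.val)ᵀ = 1 := by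
    rw [← Matrix.transpose_mul, ← Units.val_mul, mul_inv_cancel, Units.val_one,
      Matrix.transpose_one]
  have t2 : (X.val)ᵀ * (X⁻¹).valᵀ = 1 := by
    rw [← Matrix.transpose_mul, ← Units.val_mul, inv_mul_cancel, Units.val_one,
      Matrix.transpose_one]
  rw [delta, fromBlocks_multiply, fromBlocks_multiply, fromBlocks_inj]
  simp only [zero_mul, add_zero, mul_zero, zero_add, Matrix.smul_mul, Matrix.mul_smul]
  constructor
  · rintro ⟨e1, e2, -, -⟩
    refine ⟨?_, ?_⟩
    · have := congrArg (fun M => ((lam⁻¹ : Kˣ) : K) • M) e1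
      simpa only [smul_smul, Units.inv_mul, one_smul] using this
    · rw [← Matrix.smul_mul, e2, Matrix.mul_assoc, t1, mul_one]
  · rintro ⟨e1, e2⟩
    have e2' : (lam : K) • (X.val * B) = B' * (X⁻¹).valᵀ := by
      rw [← e2, Matrix.smul_mul, Matrix.mul_assoc, t2, mul_one]
    refine ⟨by rw [e1], e2', ?_, ?_⟩
    -- The lower left block carries no new condition: after multiplication by the invertible B' it
    -- becomes a consequence of BC = A² − q and B'C' = A'² − q.
    · have hc : B' * ((X⁻¹).valᵀ * C) = B' * ((lam : K) • (C' * X.val)) := by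
        rw [← Matrix.mul_assoc, ← e2', Matrix.smul_mul, Matrix.mul_assoc, h.BC, Matrix.mul_smul,
          ← Matrix.mul_assoc, h'.BC, pow_two, pow_two, mul_sub, sub_mul, ← Matrix.mul_assoc, e1,
          Matrix.mul_assoc, e1, Matrix.mul_assoc]
        simp
      have := congrArg (fun M => B'⁻¹ * M) hc
      simpa only [← Matrix.mul_assoc, Matrix.nonsing_inv_mul _ hB', one_mul] using this
    · have e3 : A ᵀ * (X.val)ᵀ = (X.val)ᵀ * A'ᵀ := by
        rw [← Matrix.transpose_mul, e1, Matrix.transpose_mul]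
      calc (X⁻¹).valᵀ * Aᵀ = (X⁻¹).valᵀ * (Aᵀ * (X.val)ᵀ) * (X⁻¹).valᵀ := by
            rw [Matrix.mul_assoc, Matrix.mul_assoc, t2, mul_one]
        _ = _ := by rw [e3, ← Matrix.mul_assoc, t1, one_mul]

end RealDeligne

namespace RealDeligne

/-! ### Galois descent for matrices -/

section Descent

variable {L m : Type*} [Field L] [CharZero L] [Fintype m] [DecidableEq m]

theorem exists_adjoin_singleton_eq {k F : Type*} [Field k] [Field F] [Algebra k F]
    (E : IntermediateField k F) [FiniteDimensional k E] [Algebra.IsSeparable k E] :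
    ∃ θ : F, IntermediateField.adjoin k {θ} = E := by
  obtain ⟨α, hα⟩ := Field.exists_primitive_element k E
  refine ⟨α, ?_⟩
  have := congrArg IntermediateField.lift hα
  rwa [IntermediateField.lift_adjoin_simple, IntermediateField.lift_top] at this

/-- A locally constant function that is `1` at the identity of the absolute Galois group is
trivial on the stabilizer of some element. -/
theorem exists_primitive_of_locallyConstant [IsGalois ℚ L] {G : Type*} [Group G]
    {f : Gal(L/ℚ) → G} (hf : IsLocallyConstant f) (h1 : f 1 = 1) :
    ∃ θ : L, ∀ σ : Gal(L/ℚ), σ θ = θ → f σ = 1 := by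
  -- A neighbourhood of 1 in the Krull topology contains the fixing group of a finite extension, and
  -- a primitive element of this extension is the required `θ`.
  have ho : f ⁻¹' {1} ∈ nhds (1 : Gal(L/ℚ)) := (hf {1}).mem_nhds h1
  rw [krullTopology_mem_nhds_one_iff] at ho
  obtain ⟨E, hE, hsub⟩ := ho
  have : Algebra.IsSeparable ℚ E := Algebra.isSeparable_tower_bot_of_isSeparable ℚ E L
  obtain ⟨α, hE'⟩ := exists_adjoin_singleton_eq E
  refine ⟨α, fun σ hσ => hsub ?_⟩
  have : E ≤ IntermediateField.fixedField (Subgroup.zpowers σ) := by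
    rw [← hE', IntermediateField.adjoin_simple_le_iff]
    rintro ⟨τ, hτ⟩
    obtain ⟨k, rfl⟩ := Subgroup.mem_zpowers_iff.mp hτ
    have : σ ∈ MulAction.stabilizer Gal(L/ℚ) α := hσ
    exact zpow_mem this k
  rw [IntermediateField.le_iff_le] at this
  exact this (Subgroup.mem_zpowers σ)

/-- Hilbert's Theorem 90 for the general linear group over a Galois extension of `ℚ`. -/
theorem exists_eq_inv_mul_map [IsGalois ℚ L] (f : Gal(L/ℚ) → GL m L) (hf : IsLocallyConstant f)
    (hc : ∀ σ τ : Gal(L/ℚ), f (σ * τ) =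
      f σ * Matrix.GeneralLinearGroup.map (σ : L →+* L) (f τ)) :
    ∃ g : GL m L, ∀ σ : Gal(L/ℚ),
      f σ = g⁻¹ * Matrix.GeneralLinearGroup.map (σ : L →+* L) g := by
  classical
  have h1 : f 1 = 1 := by
    have := hc 1 1
    have e : Matrix.GeneralLinearGroup.map ((1 : Gal(L/ℚ)) : L →+* L) (f 1) = f 1 := by
      ext i j; rfl
    rw [mul_one, e] at this
    exact left_eq_mul.mp this
  obtain ⟨θ, hθ⟩ := exists_primitive_of_locallyConstant hf h1
  -- Since `f` is trivial on the stabilizer of `θ`, the cocycle relation makes f(σ) depend only on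
  -- the conjugate σ(θ).
  have hwd : ∀ σ τ : Gal(L/ℚ), σ θ = τ θ → f σ = f τ := by
    intro σ τ h
    have e : σ = τ * (τ⁻¹ * σ) := by group
    have h2 : (τ⁻¹ * σ) θ = θ := by
      rw [AlgEquiv.mul_apply, h]; exact τ.symm_apply_apply θ
    rw [e, hc, hθ _ h2, map_one, mul_one]
  let R : Finset L := ((minpoly ℚ θ).rootSet L).toFinset
  have hint : IsIntegral ℚ θ := Algebra.IsIntegral.isIntegral θ
  have hR : ∀ x, x ∈ R ↔ Polynomial.aeval x (minpoly ℚ θ) = 0 := fun x => by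
    rw [Set.mem_toFinset, Polynomial.mem_rootSet]
    exact and_iff_right (minpoly.ne_zero hint)
  have hσR : ∀ (σ : Gal(L/ℚ)) x, x ∈ R → σ x ∈ R := fun σ x hx => by
    rw [hR] at hx ⊢
    rw [Polynomial.aeval_algHom_apply, hx, map_zero]
  have hθR : θ ∈ R := (hR θ).mpr (minpoly.aeval ℚ θ)
  have hex : ∀ x, ∃ σ : Gal(L/ℚ), x ∈ R → σ θ = x := fun x => by
    by_cases hx : x ∈ R
    · obtain ⟨σ, hσ⟩ := minpoly.exists_algEquiv_of_root' hint.isAlgebraic ((hR x).mp hx)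
      exact ⟨σ, fun _ => hσ⟩
    · exact ⟨1, fun h => absurd h hx⟩
  choose s hs using hex
  -- F(x) is the value f(σ) for any σ with σ(θ) = x. The cocycle relation becomes the equivariance
  -- F(σx) = f(σ)·σ(F(x)) on the finite set `R` of conjugates.
  let F : L → Matrix m m L := fun x => (f (s x)).val
  have hF : ∀ σ : Gal(L/ℚ), F (σ θ) = (f σ).val := fun σ =>
    congrArg Units.val (hwd _ _ (hs _ (hσR σ θ hθR)))
  have hFθ : F θ = 1 := by simpa [h1] using hF 1
  have hFσ : ∀ (σ : Gal(L/ℚ)) x, x ∈ R → F (σ x) = (f σ).val * (F x).map σ := by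
    intro σ x hx
    have := hF (σ * s x)
    rw [AlgEquiv.mul_apply, hs x hx, hc] at this
    exact this
  -- An invertible sum Σ c(x)F(x) is wanted in which c is a polynomial with rational coefficients.
  -- The Lagrange polynomial at θ gives the sum F(θ) = 1, but has coefficients in `L`. It serves
  -- only to show that the pencil of such sums is nonsingular somewhere, hence at a rational point.
  let ℓ := Lagrange.basis R id θ
  let d := ℓ.natDegree + 1
  let b : Fin d → Matrix m m L := fun j => ∑ x ∈ R, x ^ (j : ℕ) • F x
  have hb : ∀ t : Fin d → L, ∑ j, t j • b j = ∑ x ∈ R, (∑ j, t j * x ^ (j : ℕ)) • F x := by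
    intro t
    simp only [b, Finset.smul_sum, smul_smul, Finset.sum_smul]
    exact Finset.sum_comm
  have hℓ : ∀ x, ∑ j : Fin d, ℓ.coeff j * x ^ (j : ℕ) = ℓ.eval x := fun x => by
    rw [Polynomial.eval_eq_sum_range]
    exact Fin.sum_univ_eq_sum_range (fun j => ℓ.coeff j * x ^ j) d
  have hdet : (∑ j : Fin d, ℓ.coeff j • b j).det ≠ 0 := by
    have : ∑ j : Fin d, ℓ.coeff j • b j = 1 := by
      rw [hb, Finset.sum_eq_single_of_mem θ hθR, hℓ, hFθ]
      · rw [show ℓ.eval θ = 1 from Lagrange.eval_basis_self (v := id) (Set.injOn_id _) hθR,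
          one_smul]
      · intro x hx hne
        rw [hℓ, show ℓ.eval x = 0 from Lagrange.eval_basis_of_ne (v := id) hne.symm hx, zero_smul]
    rw [this, det_one]
    exact one_ne_zero
  obtain ⟨r, hr⟩ := exists_rat_det_ne_zero b _ hdet
  rw [hb] at hr
  -- Rationality of the coefficients gives c(σx) = σ(c(x)). Then σ permutes the terms of B = Σ
  -- c(x)F(x), with the result that B = f(σ)σ(B), and B⁻¹ trivializes the cocycle.
  let c : L → L := fun x => ∑ j : Fin d, (r j : L) * x ^ (j : ℕ)
  have hcσ : ∀ (σ : Gal(L/ℚ)) x, c (σ x) = σ (c x) := fun σ x => by simp [c]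
  let B := Matrix.GeneralLinearGroup.mkOfDetNeZero (∑ x ∈ R, c x • F x) hr
  have hB : ∀ σ : Gal(L/ℚ), B = f σ * Matrix.GeneralLinearGroup.map (σ : L →+* L) B := by
    intro σ
    apply Units.ext
    change ∑ x ∈ R, c x • F x = (f σ).val * (∑ x ∈ R, c x • F x).map σ
    have e : (∑ x ∈ R, c x • F x).map σ = ∑ x ∈ R, σ (c x) • (F x).map σ := by
      ext i j; simp [Matrix.sum_apply]
    rw [e, Finset.mul_sum]
    symm
    refine Finset.sum_bij (fun x _ => σ x) (fun x hx => hσR σ x hx)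
      (fun x _ y _ h => σ.injective h)
      (fun y hy => ⟨σ⁻¹ y, hσR _ y hy, σ.apply_symm_apply y⟩) fun x hx => ?_
    rw [hcσ, hFσ σ x hx, Matrix.mul_smul]
  refine ⟨B⁻¹, fun σ => ?_⟩
  rw [inv_inv, map_inv, eq_mul_inv_iff_mul_eq]
  exact (hB σ).symm

/-- The finitely many entries of `g` generate a finite extension of ℚ. Its fixing group is open, and
the function is constant on the left cosets of this group. -/
theorem isLocallyConstant_apply [IsGalois ℚ L] (g : GL m L) :
    IsLocallyConstant fun σ : Gal(L/ℚ) => Matrix.GeneralLinearGroup.map (σ : L →+* L) g := by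
  rw [IsLocallyConstant.iff_exists_open]
  intro σ
  let S : Set L := Set.range fun x : m × m => g.val x.1 x.2
  have : FiniteDimensional ℚ (IntermediateField.adjoin ℚ S) := by
    have : Finite S := Set.finite_range _
    exact IntermediateField.finiteDimensional_adjoin fun x _ => Algebra.IsIntegral.isIntegral x
  have ho := IntermediateField.fixingSubgroup_isOpen (IntermediateField.adjoin ℚ S)
  refine ⟨(fun τ => σ⁻¹ * τ) ⁻¹' (IntermediateField.adjoin ℚ S).fixingSubgroup,
    ho.preimage (continuous_const_mul _), by simp [one_mem], fun τ hτ => ?_⟩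
  ext i j
  have hx : g.val i j ∈ IntermediateField.adjoin ℚ S :=
    IntermediateField.subset_adjoin ℚ S ⟨(i, j), rfl⟩
  have h := (IntermediateField.mem_fixingSubgroup_iff _ _).mp hτ _ hx
  change τ (g.val i j) = σ (g.val i j)
  have := congrArg σ h
  rw [AlgEquiv.mul_apply] at this
  rw [← this]
  exact (σ.apply_symm_apply _).symm

/-- A Galois invariant matrix is rational. -/
theorem exists_ratMap_eq [IsGalois ℚ L] (g : GL m L)
    (h : ∀ σ : Gal(L/ℚ), Matrix.GeneralLinearGroup.map (σ : L →+* L) g = g) :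
    ∃ y : GL m ℚ, ratMap L y = g := by
  have hij : ∀ i j, ∃ r : ℚ, (r : L) = g.val i j := fun i j => by
    have : g.val i j ∈ (⊥ : IntermediateField ℚ L) := by
      rw [InfiniteGalois.mem_bot_iff_fixed]
      intro σ
      exact congrArg (fun g : GL m L => g.val i j) (h σ)
    obtain ⟨r, hr⟩ := IntermediateField.mem_bot.mp this
    exact ⟨r, by rw [← hr]; simp⟩
  choose y hy using hij
  let Y : Matrix m m ℚ := Matrix.of y
  have hy' : Y.map (Rat.castHom L) = g.val := by ext i j; exact hy i j
  have hdet : Y.det ≠ 0 := by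
    intro h0
    have h2 := (Matrix.isUnit_iff_isUnit_det _).mp g.isUnit
    rw [← hy', ← RingHom.mapMatrix_apply, ← RingHom.map_det, h0, map_zero] at h2
    exact not_isUnit_zero h2
  exact ⟨Matrix.GeneralLinearGroup.mkOfDetNeZero _ hdet, Units.ext hy'⟩

/-- A complex matrix invariant under conjugation is real. -/
theorem exists_realMap_eq (g : GL m ℂ)
    (h : ∀ σ : Gal(ℂ/ℝ), Matrix.GeneralLinearGroup.map (σ : ℂ →+* ℂ) g = g) :
    ∃ y : GL m ℝ, Matrix.GeneralLinearGroup.map (algebraMap ℝ ℂ) y = g := by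
  have hij : ∀ i j, ∃ r : ℝ, (r : ℂ) = g.val i j := fun i j => by
    have := congrArg (fun g : GL m ℂ => g.val i j) (h Complex.conjAe)
    obtain ⟨r, hr⟩ := Complex.conj_eq_iff_real.mp this
    exact ⟨r, hr.symm⟩
  choose y hy using hij
  let Y : Matrix m m ℝ := Matrix.of y
  have hy' : Y.map (algebraMap ℝ ℂ) = g.val := by ext i j; exact hy i j
  have hdet : Y.det ≠ 0 := by
    intro h0
    have h2 := (Matrix.isUnit_iff_isUnit_det _).mp g.isUnit
    rw [← hy', ← RingHom.mapMatrix_apply, ← RingHom.map_det, h0, map_zero] at h2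
    exact not_isUnit_zero h2
  exact ⟨Matrix.GeneralLinearGroup.mkOfDetNeZero _ hdet, Units.ext hy'⟩

end Descent

end RealDeligne

namespace RealDeligne

/-! ### Coordinates -/

section Coordinates

variable {p a n : ℕ} [Fact p.Prime] {O : ValuationSubring ℂ}

theorem card_idx : Fintype.card (Idx n) = 2 * n := by simp [Idx, two_mul]

/-- A `ℤ`-basis of a Deligne module, indexed like the standard basis. -/
def DeligneModule.basis (M : DeligneModule p a n) : Module.Basis (Idx n) ℤ M.T :=
  (Module.finBasisOfFinrankEq ℤ M.T M.finrank_eq).reindex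
    (Fintype.equivOfCardEq (by rw [card_idx, Fintype.card_fin]))

theorem extendCoords_tmul (K : Type*) [Field K] [CharZero K] {T : Type*} [AddCommGroup T]
    (ψ : T →ₗ[ℤ] (Idx n → ℚ)) (c : K) (x : T) :
    extendCoords K ψ (c ⊗ₜ x) = c • fun i => ((ψ x i : ℚ) : K) := by
  simp [extendCoords]

/-- The matrix of coordinates of the chosen basis. -/
def coordMatrix (M : DeligneModule p a n) (ψ : M.T →ₗ[ℤ] (Idx n → ℚ)) :
    Matrix (Idx n) (Idx n) ℚ :=
  Matrix.of fun i j => ψ (M.basis j) i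

/-- Clearing denominators, vectors of ℚ²ⁿ that are independent over ℤ are independent over ℚ. So the
images of a ℤ-basis of the module form a basis of ℚ²ⁿ. -/
theorem isUnit_det_coordMatrix (M : DeligneModule p a n) {ψ : M.T →ₗ[ℤ] (Idx n → ℚ)}
    (hψ : Function.Injective ψ) : IsUnit (coordMatrix M ψ).det := by
  have h1 : LinearIndependent ℤ (ψ ∘ M.basis) :=
    M.basis.linearIndependent.map' ψ (LinearMap.ker_eq_bot.mpr hψ)
  rw [LinearIndependent.iff_fractionRing ℤ ℚ] at h1
  rw [← Matrix.isUnit_iff_isUnit_det]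
  exact Matrix.linearIndependent_cols_iff_isUnit.mp h1

theorem extendCoords_eq (K : Type*) [Field K] [CharZero K] (M : DeligneModule p a n)
    (ψ : M.T →ₗ[ℤ] (Idx n → ℚ)) (x : K ⊗[ℤ] M.T) :
    extendCoords K ψ x =
      (coordMatrix M ψ).map (Rat.castHom K) *ᵥ (M.basis.baseChange K).equivFun x := by
  have : extendCoords K ψ = (Matrix.toLin' ((coordMatrix M ψ).map (Rat.castHom K))) ∘ₗ
      (M.basis.baseChange K).equivFun.toLinearMap := by
    refine (M.basis.baseChange K).ext fun j => ?_
    simp only [LinearMap.comp_apply, LinearEquiv.coe_coe, Matrix.toLin'_apply]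
    rw [Module.Basis.baseChange_apply, extendCoords_tmul, one_smul]
    ext i
    have hs : (M.basis.baseChange K).equivFun (1 ⊗ₜ[ℤ] M.basis j) = Pi.single j 1 := by
      rw [← Module.Basis.baseChange_apply]
      ext i
      simp [Finsupp.single_apply, Pi.single_apply, eq_comm]
    rw [hs, Matrix.mulVec_single_one]
    rfl
  rw [this]; rfl

/-- The extension of coordinates to `T ⊗ K`, as an isomorphism. -/
def coordsEquiv (K : Type*) [Field K] [CharZero K] (M : DeligneModule p a n)
    {ψ : M.T →ₗ[ℤ] (Idx n → ℚ)} (hψ : Function.Injective ψ) :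
    (K ⊗[ℤ] M.T) ≃ₗ[K] (Idx n → K) :=
  LinearEquiv.ofBijective (extendCoords K ψ) (by
    have hu : IsUnit ((coordMatrix M ψ).map (Rat.castHom K)) := by
      rw [Matrix.isUnit_iff_isUnit_det, ← RingHom.mapMatrix_apply, ← RingHom.map_det]
      exact (isUnit_det_coordMatrix M hψ).map _
    have e : (extendCoords K ψ : K ⊗[ℤ] M.T → Idx n → K) =
        ((coordMatrix M ψ).map (Rat.castHom K)).mulVec ∘ (M.basis.baseChange K).equivFun :=
      funext fun x => extendCoords_eq K M ψ x
    rw [e]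
    exact Function.Bijective.comp
      ⟨Matrix.mulVec_injective_of_isUnit hu, Matrix.mulVec_surjective_iff_isUnit.mpr hu⟩
      (LinearEquiv.bijective _))

@[simp] theorem coordsEquiv_apply (K : Type*) [Field K] [CharZero K] (M : DeligneModule p a n)
    {ψ : M.T →ₗ[ℤ] (Idx n → ℚ)} (hψ : Function.Injective ψ) (x : K ⊗[ℤ] M.T) :
    coordsEquiv K M hψ x = extendCoords K ψ x := rfl

theorem ratCast_mulVec (K : Type*) [Field K] [CharZero K] (A : Matrix (Idx n) (Idx n) ℚ)
    (v : Idx n → ℚ) :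
    (fun i => (((A *ᵥ v) i : ℚ) : K)) = A.map (Rat.castHom K) *ᵥ fun i => (v i : K) := by
  ext i
  simp [Matrix.mulVec, dotProduct]

theorem extendCoords_baseChange (K : Type*) [Field K] [CharZero K] {T : Type*} [AddCommGroup T]
    {ψ : T →ₗ[ℤ] (Idx n → ℚ)} {f : T →ₗ[ℤ] T} {A : Matrix (Idx n) (Idx n) ℚ}
    (h : ∀ x, ψ (f x) = A *ᵥ ψ x) (x : K ⊗[ℤ] T) :
    extendCoords K ψ (f.baseChange K x) = A.map (Rat.castHom K) *ᵥ extendCoords K ψ x := by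
  induction x with
  | zero => simp
  | add x y hx hy => rw [map_add, map_add, hx, hy, map_add, Matrix.mulVec_add]
  | tmul c x =>
    rw [LinearMap.baseChange_tmul, extendCoords_tmul, extendCoords_tmul, h, ratCast_mulVec,
      Matrix.mulVec_smul]

theorem baseChange_form_eq (K : Type*) [Field K] [CharZero K] {T : Type*} [AddCommGroup T]
    {ψ : T →ₗ[ℤ] (Idx n → ℚ)} {ω : LinearMap.BilinForm ℤ T} {A : Matrix (Idx n) (Idx n) ℚ}
    (h : ∀ x y, ((ω x y : ℤ) : ℚ) = ψ x ⬝ᵥ (A *ᵥ ψ y)) (x y : K ⊗[ℤ] T) :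
    (ω.baseChange K) x y =
      extendCoords K ψ x ⬝ᵥ (A.map (Rat.castHom K) *ᵥ extendCoords K ψ y) := by
  induction x with
  | zero => simp
  | add x x' hx hx' => rw [map_add, map_add, LinearMap.add_apply, hx, hx', add_dotProduct]
  | tmul c x =>
    induction y with
    | zero => simp
    | add y y' hy hy' => rw [map_add, map_add, hy, hy', Matrix.mulVec_add, dotProduct_add]
    | tmul d y =>
      rw [LinearMap.BilinForm.baseChange_tmul, extendCoords_tmul, extendCoords_tmul,
        Matrix.mulVec_smul, ← ratCast_mulVec, smul_dotProduct, dotProduct_smul]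
      have : (fun i => ((ψ x i : ℚ) : K)) ⬝ᵥ (fun i => (((A *ᵥ ψ y) i : ℚ) : K)) =
          ((ω x y : ℤ) : K) := by
        rw [← Rat.cast_intCast (α := K), h]
        simp [dotProduct]
      rw [this]
      simp [mul_comm, mul_assoc]

/-- Matrices that agree on a lattice are equal. -/
theorem matrix_ext_of_coords (M : DeligneModule p a n) {ψ : M.T →ₗ[ℤ] (Idx n → ℚ)}
    (hψ : Function.Injective ψ) {A B : Matrix (Idx n) (Idx n) ℚ}
    (h : ∀ x, A *ᵥ ψ x = B *ᵥ ψ x) : A = B := by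
  have e : A * coordMatrix M ψ = B * coordMatrix M ψ := by
    ext i j
    exact congrFun (h (M.basis j)) i
  have hu := isUnit_det_coordMatrix M hψ
  have := congrArg (fun N => N * (coordMatrix M ψ)⁻¹) e
  simpa only [Matrix.mul_assoc, Matrix.mul_nonsing_inv _ hu, mul_one] using this

/-- Bilinear forms that agree on a lattice are equal. -/
theorem form_ext_of_coords (M : DeligneModule p a n) {ψ : M.T →ₗ[ℤ] (Idx n → ℚ)}
    (hψ : Function.Injective ψ) {A B : Matrix (Idx n) (Idx n) ℚ}
    (h : ∀ x y, ψ x ⬝ᵥ (A *ᵥ ψ y) = ψ x ⬝ᵥ (B *ᵥ ψ y)) : A = B := by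
  refine matrix_ext_of_coords M hψ fun y => ?_
  have hu := isUnit_det_coordMatrix M hψ
  have e : (coordMatrix M ψ)ᵀ *ᵥ (A *ᵥ ψ y) = (coordMatrix M ψ)ᵀ *ᵥ (B *ᵥ ψ y) := by
    ext j
    exact h (M.basis j) y
  refine Matrix.mulVec_injective_of_isUnit ?_ e
  rw [Matrix.isUnit_iff_isUnit_det, Matrix.det_transpose]
  exact hu

/-- All identities are tested on the lattice. The multiplier comes from ω(Fx, Fy) = ω(x, VFy) =
qω(x, y), and the inversive relation from τFτF = VF = q. -/
theorem IsCoordinates.isQInversive {M : RealPolarizedModule p a n O} {γ : GL (Idx n) ℚ}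
    {ψ : M.T →ₗ[ℤ] (Idx n → ℚ)} (h : IsCoordinates M γ ψ) : IsQInversive (p ^ a) γ := by
  have hV : ∀ x, γ.val *ᵥ ψ (M.V x) = ((p ^ a : ℕ) : ℚ) • ψ x := fun x => by
    rw [← h.map_F, M.F_V, map_nsmul, Nat.cast_smul_eq_nsmul]
  refine isQInversive_iff.mpr ⟨?_, ?_, ?_⟩
  · refine (LinearEquiv.isSemisimple_iff (f := M.F.baseChange ℚ) (Matrix.toLin' γ.val)
      (coordsEquiv ℚ M.toDeligneModule h.injective) (LinearMap.ext fun x => ?_)).mp M.semisimple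
    change extendCoords ℚ ψ (M.F.baseChange ℚ x) = γ.val *ᵥ extendCoords ℚ ψ x
    rw [extendCoords_baseChange ℚ h.map_F]
    rfl
  · refine form_ext_of_coords M.toDeligneModule h.injective fun x y => ?_
    have e1 : ψ x ⬝ᵥ (((γ.val)ᵀ * stdJ n ℚ * γ.val) *ᵥ ψ y) =
        (γ.val *ᵥ ψ x) ⬝ᵥ (stdJ n ℚ *ᵥ (γ.val *ᵥ ψ y)) := by
      rw [Matrix.mulVec_mulVec, Matrix.mul_assoc, ← Matrix.mulVec_mulVec,
        Matrix.dotProduct_mulVec, Matrix.vecMul_transpose]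
    rw [e1, ← h.map_F, ← h.map_F, ← h.map_ω, M.ω_F, M.V_F, Matrix.smul_mulVec, dotProduct_smul,
      ← h.map_ω]
    simp
  · refine matrix_ext_of_coords M.toDeligneModule h.injective fun x => ?_
    rw [← Matrix.mulVec_mulVec, ← h.map_F, ← Matrix.mulVec_mulVec, ← h.map_τ,
      ← Matrix.mulVec_mulVec, ← h.map_F, ← h.map_τ, M.τ_F, M.V_F, map_nsmul, Matrix.smul_mulVec,
      Matrix.one_mulVec, Nat.cast_smul_eq_nsmul]

/-- The dictionary between modules and matrices. The lattice spans `K²ⁿ`, so each of the three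
conditions on `φ` is equivalent to an identity for its matrix `g`. -/
theorem isIsogeny_iff {K : Type*} [Field K] [CharZero K] {M₁ M₂ : RealPolarizedModule p a n O}
    {γ₁ γ₂ : GL (Idx n) ℚ} {ψ₁ : M₁.T →ₗ[ℤ] (Idx n → ℚ)} {ψ₂ : M₂.T →ₗ[ℤ] (Idx n → ℚ)}
    (h₁ : IsCoordinates M₁ γ₁ ψ₁) (h₂ : IsCoordinates M₂ γ₂ ψ₂)
    (φ : (K ⊗[ℤ] M₁.T) ≃ₗ[K] (K ⊗[ℤ] M₂.T)) (g : GL (Idx n) K)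
    (hg : ∀ x, extendCoords K ψ₂ (φ x) = g.val *ᵥ extendCoords K ψ₁ x) :
    IsIsogeny K M₁ M₂ φ ↔ g ∈ GLstar n K ∧ g * ratMap K γ₁ = ratMap K γ₂ * g := by
  let e₁ := coordsEquiv K M₁.toDeligneModule h₁.injective
  let e₂ := coordsEquiv K M₂.toDeligneModule h₂.injective
  have inj₂ : ∀ x y, extendCoords K ψ₂ x = extendCoords K ψ₂ y ↔ x = y := fun x y =>
    e₂.injective.eq_iff
  have ext₁ : ∀ {A B : Matrix (Idx n) (Idx n) K},
      (∀ x, A *ᵥ extendCoords K ψ₁ x = B *ᵥ extendCoords K ψ₁ x) ↔ A = B := by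
    intro A B
    refine ⟨fun h => ?_, fun h x => by rw [h]⟩
    refine Matrix.ext_of_mulVec_single fun i => ?_
    have := h (e₁.symm (Pi.single i 1))
    rwa [← coordsEquiv_apply K M₁.toDeligneModule h₁.injective, LinearEquiv.apply_symm_apply]
      at this
  have bil₁ : ∀ {A B : Matrix (Idx n) (Idx n) K},
      (∀ x y, extendCoords K ψ₁ x ⬝ᵥ (A *ᵥ extendCoords K ψ₁ y) =
        extendCoords K ψ₁ x ⬝ᵥ (B *ᵥ extendCoords K ψ₁ y)) ↔ A = B := by
    intro A B
    refine ⟨fun h => ext₁.mp fun y => ?_, fun h x y => by rw [h]⟩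
    ext i
    have := h (e₁.symm (Pi.single i 1)) y
    rw [← coordsEquiv_apply K M₁.toDeligneModule h₁.injective, LinearEquiv.apply_symm_apply]
      at this
    simpa using this
  have hF : (∀ x, φ (M₁.F.baseChange K x) = M₂.F.baseChange K (φ x)) ↔
      g * ratMap K γ₁ = ratMap K γ₂ * g := by
    rw [Units.ext_iff, ← ext₁]
    refine forall_congr' fun x => ?_
    rw [← inj₂, hg, extendCoords_baseChange K h₁.map_F, extendCoords_baseChange K h₂.map_F, hg,
      Matrix.mulVec_mulVec, Matrix.mulVec_mulVec]
    rfl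
  have hτ : (∀ x, φ (M₁.τ.baseChange K x) = M₂.τ.baseChange K (φ x)) ↔
      tau0 n K * g.val = g.val * tau0 n K := by
    rw [eq_comm (a := tau0 n K * g.val), ← ext₁]
    refine forall_congr' fun x => ?_
    rw [← inj₂, hg, extendCoords_baseChange K h₁.map_τ, extendCoords_baseChange K h₂.map_τ, hg,
      Matrix.mulVec_mulVec, Matrix.mulVec_mulVec, map_tau0]
  have hω : ∀ c : Kˣ, (∀ x y, (M₂.ω.baseChange K) (φ x) (φ y) =
      (c : K) * (M₁.ω.baseChange K) x y) ↔ HasMultiplier g (c : K) := by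
    intro c
    rw [HasMultiplier, ← bil₁]
    refine forall₂_congr fun x y => ?_
    rw [baseChange_form_eq K h₁.map_ω, baseChange_form_eq K h₂.map_ω, hg, hg, map_stdJ,
      Matrix.smul_mulVec, dotProduct_smul, smul_eq_mul, Matrix.mul_assoc, ← Matrix.mulVec_mulVec,
      Matrix.dotProduct_mulVec _ (g.val)ᵀ, Matrix.vecMul_transpose, Matrix.mulVec_mulVec]
  constructor
  · rintro ⟨h1, h2, c, h3⟩
    exact ⟨⟨⟨c, (hω c).mp h3⟩, hτ.mp h2⟩, hF.mp h1⟩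
  · rintro ⟨⟨⟨c, h3⟩, h2⟩, h1⟩
    exact ⟨hF.mpr h1, hτ.mpr h2, c, (hω c).mpr h3⟩

/-- The matrix of an isomorphism `T₁ ⊗ K ≃ T₂ ⊗ K` in coordinates. -/
def isoMatrix {K : Type*} [Field K] [CharZero K] {M₁ M₂ : DeligneModule p a n}
    {ψ₁ : M₁.T →ₗ[ℤ] (Idx n → ℚ)} {ψ₂ : M₂.T →ₗ[ℤ] (Idx n → ℚ)}
    (h₁ : Function.Injective ψ₁) (h₂ : Function.Injective ψ₂)
    (φ : (K ⊗[ℤ] M₁.T) ≃ₗ[K] (K ⊗[ℤ] M₂.T)) : GL (Idx n) K :=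
  Matrix.GeneralLinearGroup.toLin.symm (LinearMap.GeneralLinearGroup.ofLinearEquiv
    ((coordsEquiv K M₁ h₁).symm.trans (φ.trans (coordsEquiv K M₂ h₂))))

theorem isoMatrix_mulVec {K : Type*} [Field K] [CharZero K] {M₁ M₂ : DeligneModule p a n}
    {ψ₁ : M₁.T →ₗ[ℤ] (Idx n → ℚ)} {ψ₂ : M₂.T →ₗ[ℤ] (Idx n → ℚ)}
    (h₁ : Function.Injective ψ₁) (h₂ : Function.Injective ψ₂)
    (φ : (K ⊗[ℤ] M₁.T) ≃ₗ[K] (K ⊗[ℤ] M₂.T)) (x : K ⊗[ℤ] M₁.T) :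
    extendCoords K ψ₂ (φ x) = (isoMatrix h₁ h₂ φ).val *ᵥ extendCoords K ψ₁ x := by
  have : (isoMatrix h₁ h₂ φ).val = LinearMap.toMatrix'
    ((coordsEquiv K M₁ h₁).symm.trans (φ.trans (coordsEquiv K M₂ h₂))).toLinearMap := rfl
  rw [this, ← Matrix.toLin'_apply, Matrix.toLin'_toMatrix', ← coordsEquiv_apply K M₁ h₁,
    LinearEquiv.coe_coe, LinearEquiv.trans_apply, LinearEquiv.trans_apply,
    LinearEquiv.symm_apply_apply, coordsEquiv_apply]

/-- The isomorphism `T₁ ⊗ K ≃ T₂ ⊗ K` with a given matrix in coordinates. -/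
def matrixIso {K : Type*} [Field K] [CharZero K] {M₁ M₂ : DeligneModule p a n}
    {ψ₁ : M₁.T →ₗ[ℤ] (Idx n → ℚ)} {ψ₂ : M₂.T →ₗ[ℤ] (Idx n → ℚ)}
    (h₁ : Function.Injective ψ₁) (h₂ : Function.Injective ψ₂)
    (g : GL (Idx n) K) : (K ⊗[ℤ] M₁.T) ≃ₗ[K] (K ⊗[ℤ] M₂.T) :=
  (coordsEquiv K M₁ h₁).trans
    ((LinearMap.GeneralLinearGroup.toLinearEquiv (Matrix.GeneralLinearGroup.toLin g)).trans
      (coordsEquiv K M₂ h₂).symm)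

theorem matrixIso_apply {K : Type*} [Field K] [CharZero K] {M₁ M₂ : DeligneModule p a n}
    {ψ₁ : M₁.T →ₗ[ℤ] (Idx n → ℚ)} {ψ₂ : M₂.T →ₗ[ℤ] (Idx n → ℚ)}
    (h₁ : Function.Injective ψ₁) (h₂ : Function.Injective ψ₂)
    (g : GL (Idx n) K) (x : K ⊗[ℤ] M₁.T) :
    extendCoords K ψ₂ (matrixIso h₁ h₂ g x) = g.val *ᵥ extendCoords K ψ₁ x := by
  rw [← coordsEquiv_apply K M₂ h₂, matrixIso, LinearEquiv.trans_apply, LinearEquiv.trans_apply,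
    LinearEquiv.apply_symm_apply]
  rfl

theorem isogenous_iff {K : Type*} [Field K] [CharZero K] {M₁ M₂ : RealPolarizedModule p a n O}
    {γ₁ γ₂ : GL (Idx n) ℚ} {ψ₁ : M₁.T →ₗ[ℤ] (Idx n → ℚ)} {ψ₂ : M₂.T →ₗ[ℤ] (Idx n → ℚ)}
    (h₁ : IsCoordinates M₁ γ₁ ψ₁) (h₂ : IsCoordinates M₂ γ₂ ψ₂) :
    Isogenous K M₁ M₂ ↔ ConjBy (GLstar n K) (ratMap K γ₁) (ratMap K γ₂) := by
  constructor
  · rintro ⟨φ, hφ⟩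
    obtain ⟨hg, e⟩ := (isIsogeny_iff h₁ h₂ φ _
      (isoMatrix_mulVec h₁.injective h₂.injective φ)).mp hφ
    exact ⟨_, hg, mul_inv_eq_iff_eq_mul.mpr e⟩
  · rintro ⟨g, hg, e⟩
    exact ⟨_, (isIsogeny_iff h₁ h₂ _ g (matrixIso_apply h₁.injective h₂.injective g)).mpr
      ⟨hg, mul_inv_eq_iff_eq_mul.mp e⟩⟩

theorem mem_I0_iff {γ₀ : GL (Idx n) ℚ} {K : Type*} [Field K] [CharZero K] {g : GL (Idx n) K} :
    g ∈ I0 γ₀ K ↔ g ∈ GLstar n K ∧ g * ratMap K γ₀ = ratMap K γ₀ * g := by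
  rw [I0, Subgroup.mem_inf, Subgroup.mem_centralizer_singleton_iff]

/-- `I₀(K)` is the group of self-`K`-isogenies. -/
theorem exists_selfIsogenies_mulEquiv (K : Type*) [Field K] [CharZero K]
    {M : RealPolarizedModule p a n O} {γ : GL (Idx n) ℚ} {ψ : M.T →ₗ[ℤ] (Idx n → ℚ)}
    (h : IsCoordinates M γ ψ) :
    ∃ e : selfIsogenies K M ≃* I0 γ K, ∀ (φ : selfIsogenies K M) (x : K ⊗[ℤ] M.T),
      extendCoords K ψ (φ.1 x) = (e φ).1.val *ᵥ extendCoords K ψ x := by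
  have i := h.injective
  have ext₁ : ∀ {A B : GL (Idx n) K},
      (∀ x, A.val *ᵥ extendCoords K ψ x = B.val *ᵥ extendCoords K ψ x) → A = B := by
    intro A B h'
    refine Units.ext (Matrix.ext_of_mulVec_single fun j => ?_)
    have := h' ((coordsEquiv K M.toDeligneModule i).symm (Pi.single j 1))
    rwa [← coordsEquiv_apply K M.toDeligneModule i, LinearEquiv.apply_symm_apply] at this
  refine ⟨{ toFun := fun φ => ⟨isoMatrix i i φ.1, mem_I0_iff.mpr
              ((isIsogeny_iff h h φ.1 _ (isoMatrix_mulVec i i φ.1)).mp φ.2)⟩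
            invFun := fun g => ⟨matrixIso i i g.1,
              (isIsogeny_iff h h _ _ (matrixIso_apply i i g.1)).mpr (mem_I0_iff.mp g.2)⟩
            left_inv := fun φ => Subtype.ext (LinearEquiv.ext fun x => ?_)
            right_inv := fun g => Subtype.ext (ext₁ fun x => ?_)
            map_mul' := fun φ χ => Subtype.ext (ext₁ fun x => ?_) },
    fun φ x => isoMatrix_mulVec i i φ.1 x⟩
  · apply (coordsEquiv K M.toDeligneModule i).injective
    simp only [coordsEquiv_apply]
    rw [matrixIso_apply, ← isoMatrix_mulVec]
  · change (isoMatrix i i (matrixIso i i g.1)).val *ᵥ _ = _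
    rw [← isoMatrix_mulVec, matrixIso_apply]
  · change (isoMatrix i i (φ.1 * χ.1)).val *ᵥ _ = (isoMatrix i i φ.1 * isoMatrix i i χ.1).val *ᵥ _
    rw [← isoMatrix_mulVec, Units.val_mul, ← Matrix.mulVec_mulVec, ← isoMatrix_mulVec,
      ← isoMatrix_mulVec]
    rfl

end Coordinates

end RealDeligne

namespace RealDeligne

/-! ### Existence of coordinates -/

section Symplectic

variable {K V : Type*} [Field K] [CharZero K] [AddCommGroup V] [Module K V]

/-- A nondegenerate form for which the `±1`-eigenspaces of an involution are isotropic pairs the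
two eigenspaces perfectly. -/
theorem injective_domRestrict_eigenspaces {Ω : LinearMap.BilinForm K V} (hΩ : Ω.Nondegenerate)
    {t : V →ₗ[K] V} (htt : ∀ x, t (t x) = x) (hΩt : ∀ x y, Ω (t x) (t y) = -Ω x y)
    (c : K) (hc : c = 1 ∨ c = -1) :
    Function.Injective ((LinearMap.domRestrict₁₂ Ω (LinearMap.ker (t - c • 1))
      (LinearMap.ker (t + c • 1)))) := by
  have hc2 : c * c = 1 := by rcases hc with rfl | rfl <;> ring
  rw [← LinearMap.ker_eq_bot, LinearMap.ker_eq_bot']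
  rintro ⟨x, hx⟩ h
  rw [LinearMap.mem_ker, LinearMap.sub_apply, LinearMap.smul_apply, Module.End.one_apply,
    sub_eq_zero] at hx
  refine Subtype.ext (hΩ.1 x fun y => ?_)
  -- This vector lies in the opposite eigenspace, which `x` kills, so Ω(x, ty) = cΩ(x, y).
  -- Anti-invariance under `t` gives the same value with the opposite sign.
  have h1 : t y - c • y ∈ LinearMap.ker (t + c • (1 : Module.End K V)) := by
    rw [LinearMap.mem_ker, LinearMap.add_apply, LinearMap.smul_apply, Module.End.one_apply,
      map_sub, map_smul, htt, smul_sub, smul_smul, hc2, one_smul]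
    abel
  have h2 : Ω x (t y) = c * Ω x y := by
    have := LinearMap.congr_fun h ⟨_, h1⟩
    simp only [LinearMap.domRestrict₁₂_apply, map_sub, map_smul, smul_eq_mul,
      LinearMap.zero_apply] at this
    exact sub_eq_zero.mp this
  have h3 : Ω x (t y) = -(c * Ω x y) := by
    have := hΩt x y
    rw [hx, map_smul, LinearMap.smul_apply, smul_eq_mul] at this
    rw [← mul_neg, ← this, ← mul_assoc, hc2, one_mul]
  have h4 : c * Ω x y = 0 := self_eq_neg.mp (h2.symm.trans h3)
  rcases mul_eq_zero.mp h4 with h5 | h5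
  · rw [h5] at hc2; simp at hc2
  · exact h5

/-- A symplectic basis adapted to an anti-symplectic involution. -/
theorem exists_symplectic_basis [FiniteDimensional K V] {n : ℕ} (hdim : Module.finrank K V = 2 * n)
    {Ω : LinearMap.BilinForm K V} (hΩ : Ω.Nondegenerate) (halt : Ω.IsAlt)
    {t : V →ₗ[K] V} (htt : ∀ x, t (t x) = x) (hΩt : ∀ x y, Ω (t x) (t y) = -Ω x y) :
    ∃ v : Module.Basis (Idx n) K V, (∀ i j, Ω (v i) (v j) = stdJ n K i j) ∧
      (∀ i, t (v (Sum.inl i)) = -v (Sum.inl i)) ∧ ∀ i, t (v (Sum.inr i)) = v (Sum.inr i) := by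
  classical
  let Vm := LinearMap.ker (t - (-1 : K) • (1 : Module.End K V))
  let Vp := LinearMap.ker (t + (-1 : K) • (1 : Module.End K V))
  have memm : ∀ x, x ∈ Vm ↔ t x = -x := fun x => by
    rw [LinearMap.mem_ker, LinearMap.sub_apply, LinearMap.smul_apply, Module.End.one_apply,
      sub_eq_zero, neg_one_smul]
  have memp : ∀ x, x ∈ Vp ↔ t x = x := fun x => by
    rw [LinearMap.mem_ker, LinearMap.add_apply, LinearMap.smul_apply, Module.End.one_apply,
      neg_one_smul, ← sub_eq_add_neg, sub_eq_zero]
  let fm : Vm →ₗ[K] Module.Dual K Vp := LinearMap.domRestrict₁₂ Ω Vm Vp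
  let fp : Vp →ₗ[K] Module.Dual K Vm := LinearMap.domRestrict₁₂ Ω Vp Vm
  have hfm : Function.Injective fm := injective_domRestrict_eigenspaces hΩ htt hΩt (-1) (Or.inr rfl)
  have hfp : Function.Injective fp := by
    have := injective_domRestrict_eigenspaces hΩ htt hΩt 1 (Or.inl rfl)
    have e1 : Vp = LinearMap.ker (t - (1 : K) • (1 : Module.End K V)) := by
      rw [one_smul, sub_eq_add_neg, ← neg_one_smul K (1 : Module.End K V)]
    have e2 : Vm = LinearMap.ker (t + (1 : K) • (1 : Module.End K V)) := by
      simp only [Vm, neg_smul, sub_neg_eq_add]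
    simp only [fp]
    rw [e1, e2]
    exact this
  -- Each eigenspace embeds in the dual of the other, so their dimensions agree. As they are
  -- complementary in a space of dimension 2n, both have dimension n.
  have d1 : Module.finrank K Vm ≤ Module.finrank K Vp := by
    rw [← Subspace.dual_finrank_eq (K := K) (V := Vp)]
    exact LinearMap.finrank_le_finrank_of_injective hfm
  have d2 : Module.finrank K Vp ≤ Module.finrank K Vm := by
    rw [← Subspace.dual_finrank_eq (K := K) (V := Vm)]
    exact LinearMap.finrank_le_finrank_of_injective hfp
  have hcompl : IsCompl Vm Vp := by
    constructor
    · rw [Submodule.disjoint_def]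
      intro x hx hx'
      rw [memm] at hx
      rw [memp, hx] at hx'
      have h2 : (2 : K) • x = 0 := by
        rw [two_smul]
        nth_rewrite 1 [← hx']
        abel
      exact (smul_eq_zero.mp h2).resolve_left two_ne_zero
    · rw [codisjoint_iff, eq_top_iff]
      intro x _
      rw [Submodule.mem_sup]
      refine ⟨(2⁻¹ : K) • (x - t x), ?_, (2⁻¹ : K) • (x + t x), ?_, ?_⟩
      · rw [memm, map_smul, map_sub, htt, ← smul_neg]; congr 1; abel
      · rw [memp, map_smul, map_add, htt, add_comm]
      · rw [← smul_add, show x - t x + (x + t x) = (2 : K) • x by rw [two_smul]; abel, smul_smul,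
          inv_mul_cancel₀ two_ne_zero, one_smul]
  have hm : Module.finrank K Vm = n := by
    have := Submodule.finrank_add_eq_of_isCompl hcompl
    omega
  have hfp' : Function.Surjective fp :=
    (LinearMap.injective_iff_surjective_of_finrank_eq_finrank
      (by rw [Subspace.dual_finrank_eq]; omega)).mp hfp
  let u := Module.finBasisOfFinrankEq K Vm hm
  -- The minus sign makes Ω(u i, w i) = 1, which is the upper right block of the matrix of ω₀, while
  -- Ω(w i, u i) = −1.
  choose w hw using fun j => hfp' (-u.coord j)
  have huw : ∀ i j, Ω (w j) (u i) = -if i = j then 1 else 0 := fun i j => by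
    have := LinearMap.congr_fun (hw j) (u i)
    rw [LinearMap.neg_apply, Module.Basis.coord_apply, Module.Basis.repr_self,
      Finsupp.single_apply] at this
    exact this
  have hiso : ∀ x y, t x = x → t y = y → Ω x y = 0 := fun x y hx hy => by
    have := hΩt x y
    rw [hx, hy] at this
    exact self_eq_neg.mp this
  have hiso' : ∀ x y, t x = -x → t y = -y → Ω x y = 0 := fun x y hx hy => by
    have := hΩt x y
    rw [hx, hy, map_neg, map_neg, LinearMap.neg_apply, neg_neg] at this
    exact self_eq_neg.mp this
  let v : Idx n → V := Sum.elim (fun i => (u i : V)) fun j => (w j : V)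
  have hvm : ∀ i, t (u i) = -(u i : V) := fun i => (memm _).mp (u i).2
  have hvp : ∀ i, t (w i) = (w i : V) := fun i => (memp _).mp (w i).2
  have hJ : ∀ i j, Ω (v i) (v j) = stdJ n K i j := by
    rintro (i | i) (j | j)
    · exact hiso' _ _ (hvm i) (hvm j)
    · change Ω (u i) (w j) = (1 : Matrix (Fin n) (Fin n) K) i j
      rw [← neg_neg (Ω (u i) (w j)), halt.neg_eq, huw, neg_neg, Matrix.one_apply]
    · change Ω (w i) (u j) = (-1 : Matrix (Fin n) (Fin n) K) i j
      rw [huw, Matrix.neg_apply, Matrix.one_apply]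
      simp only [eq_comm]
    · exact hiso _ _ (hvp i) (hvp j)
  have hJJ : IsUnit (stdJ n K) := by
    refine IsUnit.of_mul_eq_one (-stdJ n K) ?_
    simp [stdJ, fromBlocks_multiply, fromBlocks_one, fromBlocks_neg]
  have hli : LinearIndependent K v := by
    rw [Fintype.linearIndependent_iff]
    intro c hc
    have : stdJ n K *ᵥ c = 0 := by
      ext i
      have h := congrArg (Ω (v i)) hc
      simp only [map_sum, map_smul, hJ, smul_eq_mul, map_zero] at h
      rw [Matrix.mulVec, dotProduct, Pi.zero_apply, ← h]
      exact Finset.sum_congr rfl fun _ _ => mul_comm _ _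
    have hc0 : c = 0 := Matrix.mulVec_injective_of_isUnit hJJ (by rw [this, Matrix.mulVec_zero])
    intro i
    rw [hc0]; rfl
  have hspan : ⊤ ≤ Submodule.span K (Set.range v) :=
    (hli.span_eq_top_of_card_eq_finrank' (by rw [card_idx, hdim])).ge
  refine ⟨Module.Basis.mk hli hspan, fun i j => ?_, fun i => ?_, fun i => ?_⟩
  · rw [Module.Basis.mk_apply, Module.Basis.mk_apply, hJ]
  · rw [Module.Basis.mk_apply]
    exact hvm i
  · rw [Module.Basis.mk_apply]
    exact hvp i

end Symplectic

variable {p a n : ℕ} [Fact p.Prime] {O : ValuationSubring ℂ}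

theorem isAlt_baseChange {T : Type*} [AddCommGroup T] {ω : LinearMap.BilinForm ℤ T}
    (h : ω.IsAlt) : (ω.baseChange ℚ).IsAlt := by
  have hanti : ∀ x y, (ω.baseChange ℚ) x y = -(ω.baseChange ℚ) y x := by
    intro x y
    induction x with
    | zero => simp
    | add x x' hx hx' => simp only [map_add, LinearMap.add_apply, hx, hx', neg_add]
    | tmul c x =>
      induction y with
      | zero => simp
      | add y y' hy hy' => simp only [map_add, LinearMap.add_apply, hy, hy', neg_add]
      | tmul d y =>
        rw [LinearMap.BilinForm.baseChange_tmul, LinearMap.BilinForm.baseChange_tmul,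
          ← h.neg_eq y x, neg_smul, mul_comm]
  exact fun x => self_eq_neg.mp (hanti x x)

/-- Every real polarized Deligne module has coordinates. -/
theorem exists_isCoordinates (M : RealPolarizedModule p a n O) :
    ∃ γ ψ, IsCoordinates M γ ψ := by
  classical
  have hdim : Module.finrank ℚ (ℚ ⊗[ℤ] M.T) = 2 * n := by
    rw [Module.finrank_baseChange, M.finrank_eq]
  have htt : ∀ x, M.τ.baseChange ℚ (M.τ.baseChange ℚ x) = x := by
    intro x
    rw [← LinearMap.comp_apply, ← LinearMap.baseChange_comp,
      show M.τ ∘ₗ M.τ = LinearMap.id from LinearMap.ext M.τ_τ, LinearMap.baseChange_id]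
    rfl
  have hωt : ∀ x y, (M.ω.baseChange ℚ) (M.τ.baseChange ℚ x) (M.τ.baseChange ℚ y) =
      -(M.ω.baseChange ℚ) x y := by
    intro x y
    induction x with
    | zero => simp
    | add x x' hx hx' => simp only [map_add, LinearMap.add_apply, hx, hx', neg_add]
    | tmul c x =>
      induction y with
      | zero => simp
      | add y y' hy hy' => simp only [map_add, hy, hy', neg_add]
      | tmul d y =>
        rw [LinearMap.baseChange_tmul, LinearMap.baseChange_tmul,
          LinearMap.BilinForm.baseChange_tmul, LinearMap.BilinForm.baseChange_tmul, M.ω_τ, neg_smul]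
  obtain ⟨v, hv, hm, hp⟩ := exists_symplectic_basis hdim M.nondegenerate
    (isAlt_baseChange M.alternating) htt hωt
  let ψ : M.T →ₗ[ℤ] (Idx n → ℚ) :=
    (v.equivFun.toLinearMap.restrictScalars ℤ) ∘ₗ (TensorProduct.mk ℤ ℚ M.T 1)
  have hψ : ∀ x, ψ x = v.equivFun (1 ⊗ₜ x) := fun _ => rfl
  have hend : ∀ (f : Module.End ℚ (ℚ ⊗[ℤ] M.T)) X, v.equivFun (f X) =
      LinearMap.toMatrix v v f *ᵥ v.equivFun X := fun f X =>
    (LinearMap.toMatrix_mulVec_repr v v f X).symm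
  -- FV = q makes Frobenius invertible over ℚ, with V/q as its inverse. This supplies the inverse
  -- component of `γ`.
  have hFV : LinearMap.toMatrix v v (M.F.baseChange ℚ) *
      ((((p ^ a : ℕ) : ℚ)⁻¹) • LinearMap.toMatrix v v (M.V.baseChange ℚ)) = 1 := by
    have hq : ((p ^ a : ℕ) : ℚ) ≠ 0 := Nat.cast_ne_zero.mpr (pow_ne_zero _ (Fact.out : p.Prime).ne_zero)
    have : M.F.baseChange ℚ * M.V.baseChange ℚ = ((p ^ a : ℕ) : ℚ) • 1 := by
      rw [← LinearMap.baseChange_mul, show M.F * M.V = ((p ^ a : ℕ) : ℤ) • 1 from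
        LinearMap.ext fun x => by
          rw [Module.End.mul_apply, M.F_V, LinearMap.smul_apply, Module.End.one_apply,
            natCast_zsmul], LinearMap.baseChange_smul, LinearMap.baseChange_one]
      rw [natCast_zsmul, Nat.cast_smul_eq_nsmul]
    rw [Matrix.mul_smul, ← LinearMap.toMatrix_mul, this, map_smul, LinearMap.toMatrix_one,
      smul_smul, inv_mul_cancel₀ hq, one_smul]
  let γ : GL (Idx n) ℚ := ⟨_, _, hFV, by rw [mul_eq_one_comm, hFV]⟩
  refine ⟨γ, ψ, ?_, ?_, ?_, ?_⟩
  · intro x y hxy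
    have h := v.equivFun.injective hxy
    have h' : ∀ i, M.basis.repr x i = M.basis.repr y i := fun i => by
      have : (M.basis.baseChange ℚ).repr (1 ⊗ₜ x) i = (M.basis.baseChange ℚ).repr (1 ⊗ₜ y) i :=
        congrArg (fun z => (M.basis.baseChange ℚ).repr z i) h
      simpa [Module.Basis.baseChange_repr_tmul] using this
    exact M.basis.repr.injective (Finsupp.ext h')
  · intro x
    rw [hψ, hψ, show (1 : ℚ) ⊗ₜ[ℤ] M.F x = M.F.baseChange ℚ (1 ⊗ₜ x) from
      (LinearMap.baseChange_tmul _ _ _).symm]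
    exact hend (M.F.baseChange ℚ) _
  · intro x y
    have h : ∀ X Y, (M.ω.baseChange ℚ) X Y =
        v.equivFun X ⬝ᵥ (stdJ n ℚ *ᵥ v.equivFun Y) := by
      intro X Y
      conv_lhs => rw [← v.sum_equivFun X, ← v.sum_equivFun Y]
      simp only [map_sum, LinearMap.sum_apply, map_smul, LinearMap.smul_apply, hv, dotProduct,
        mulVec, Finset.mul_sum, smul_eq_mul]
      rw [Finset.sum_comm]
      exact Finset.sum_congr rfl fun i _ => Finset.sum_congr rfl fun j _ => by ring
    rw [hψ, hψ, ← h, LinearMap.BilinForm.baseChange_tmul]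
    simp
  · intro x
    rw [hψ, hψ, show (1 : ℚ) ⊗ₜ[ℤ] M.τ x = M.τ.baseChange ℚ (1 ⊗ₜ x) from
      (LinearMap.baseChange_tmul _ _ _).symm]
    generalize (1 : ℚ) ⊗ₜ[ℤ] x = X
    rw [hend]
    congr 1
    ext i j
    rw [LinearMap.toMatrix_apply]
    rcases j with j | j
    · rw [hm, map_neg, Finsupp.neg_apply, Module.Basis.repr_self, tau0]
      rcases i with i | i <;> simp [Finsupp.single_apply, Matrix.one_apply, eq_comm]
    · rw [hp, Module.Basis.repr_self, tau0]
      rcases i with i | i <;> simp [Finsupp.single_apply, Matrix.one_apply, eq_comm]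

end RealDeligne

namespace RealDeligne

open Polynomial

/-! ### Diagonalizable matrices -/

section Diagonalizable

variable {m : Type*} [Fintype m] [DecidableEq m]

theorem aeval_map_matrix {R K : Type*} [CommRing R] [CommRing K] (f : R →+* K)
    (S : Matrix m m R) (P : R[X]) :
    aeval (S.map f) (P.map f) = (aeval S P).map f := by
  induction P using Polynomial.induction_on' with
  | add p q hp hq => rw [Polynomial.map_add, map_add, map_add, hp, hq, Matrix.map_add _ (map_add f)]
  | monomial k c =>
    rw [Polynomial.map_monomial, aeval_monomial, aeval_monomial, ← Algebra.smul_def,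
      ← Algebra.smul_def, Matrix.map_smul' f _ _ (map_mul f)]
    congr 1
    exact (Matrix.map_pow S f k).symm

theorem aeval_toLin' {K : Type*} [CommRing K] (S : Matrix m m K) (P : K[X]) :
    aeval (Matrix.toLin' S) P = Matrix.toLin' (aeval S P) :=
  Polynomial.aeval_algHom_apply (Matrix.toLinAlgEquiv' : Matrix m m K ≃ₐ[K] _).toAlgHom S P

theorem isSemisimple_toLin'_iff {S : Matrix m m ℚ} :
    Module.End.IsSemisimple (Matrix.toLin' S) ↔ Squarefree (minpoly ℚ S) := by
  have e : minpoly ℚ (Matrix.toLin' S) = minpoly ℚ S :=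
    minpoly.algEquiv_eq (Matrix.toLinAlgEquiv' : Matrix m m ℚ ≃ₐ[ℚ] _) S
  constructor
  · intro h; rw [← e]; exact h.minpoly_squarefree
  · intro h
    exact Module.End.isSemisimple_of_squarefree_aeval_eq_zero (p := minpoly ℚ S) h
      (by rw [aeval_toLin', minpoly.aeval, map_zero])

/-- A rational matrix annihilated by a squarefree polynomial over an extension field has
squarefree minimal polynomial. -/
theorem squarefree_minpoly_of_aeval_map_eq_zero {K : Type*} [Field K] [CharZero K]
    {S : Matrix m m ℚ} {N : K[X]} (hN : Squarefree N)
    (h : aeval (S.map (Rat.castHom K)) N = 0) : Squarefree (minpoly ℚ S) := by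
  have hss : Module.End.IsSemisimple (Matrix.toLin' (S.map (Rat.castHom K))) :=
    Module.End.isSemisimple_of_squarefree_aeval_eq_zero hN (by rw [aeval_toLin', h, map_zero])
  intro d hd
  obtain ⟨e, he⟩ := hd
  have hm0 : minpoly ℚ S ≠ 0 := minpoly.ne_zero (Algebra.IsIntegral.isIntegral S)
  -- If the minimal polynomial is d²e, then (de)(S) has square zero. After extension to `K` it is
  -- also semisimple, being a polynomial in a semisimple endomorphism, so it vanishes; the minimal
  -- polynomial then divides de, which makes d a unit.
  have hT : aeval S (d * e) = 0 := by
    have h2 : aeval S (d * e) ^ 2 = 0 := by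
      rw [← map_pow, show (d * e) ^ 2 = minpoly ℚ S * e by rw [he]; ring, map_mul, minpoly.aeval,
        zero_mul]
    have h3 : IsNilpotent (aeval (Matrix.toLin' (S.map (Rat.castHom K)))
        ((d * e).map (Rat.castHom K))) := by
      refine ⟨2, ?_⟩
      rw [aeval_toLin', aeval_map_matrix, pow_two, Module.End.mul_eq_comp, ← Matrix.toLin'_mul,
        ← Matrix.map_mul, ← pow_two, h2, Matrix.map_zero _ (map_zero _), map_zero]
    have h4 := Module.End.eq_zero_of_isNilpotent_isSemisimple h3 (hss.aeval _)
    rw [aeval_toLin', aeval_map_matrix, LinearEquiv.map_eq_zero_iff] at h4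
    ext i j
    have := congrFun (congrFun h4 i) j
    exact (map_eq_zero (Rat.castHom K)).mp this
  have hdvd : minpoly ℚ S ∣ d * e := minpoly.dvd ℚ S hT
  have hde : d * e ≠ 0 := by
    rintro h0; rw [mul_assoc, h0, mul_zero] at he; exact hm0 he
  rw [he, mul_assoc] at hdvd
  obtain ⟨c, hc⟩ := hdvd
  have : d * c = 1 := by
    apply mul_left_cancel₀ hde
    rw [mul_one]
    conv_rhs => rw [hc]
    ring
  exact IsUnit.of_mul_eq_one _ this

/-- A squarefree rational polynomial divides the product of linear factors over its roots in an
algebraically closed field. -/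
theorem exists_finset_map_dvd_prod {K : Type*} [Field K] [CharZero K] [IsAlgClosed K] {P : ℚ[X]}
    (hP : Squarefree P) : ∃ s : Finset K, (∀ x ∈ s, aeval x P = 0) ∧
      P.map (Rat.castHom K) ∣ ∏ x ∈ s, (X - C x) := by
  classical
  have hsep : (P.map (Rat.castHom K)).Separable :=
    (PerfectField.separable_iff_squarefree.mpr hP).map
  have h0 : P.map (Rat.castHom K) ≠ 0 := hsep.ne_zero
  refine ⟨(P.map (Rat.castHom K)).roots.toFinset, fun x hx => ?_, ?_⟩
  · rw [Multiset.mem_toFinset, mem_roots h0, IsRoot.def, eval_map] at hx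
    exact hx
  · have hsp := (IsAlgClosed.splits (P.map (Rat.castHom K))).eq_prod_roots
    have hnd := nodup_roots hsep
    conv_lhs => rw [hsp]
    rw [Finset.prod, Multiset.toFinset_val, hnd.dedup]
    have hu : IsUnit (C (P.map (Rat.castHom K)).leadingCoeff) :=
      isUnit_C.mpr (leadingCoeff_ne_zero.mpr h0).isUnit
    exact hu.mul_left_dvd.mpr dvd_rfl

theorem squarefree_prod_X_sub_C {K : Type*} [Field K] (s : Finset K) :
    Squarefree (∏ x ∈ s, (X - C x)) :=
  (separable_prod_X_sub_C_iff' (f := fun x : K => x)).mpr (fun _ _ _ _ h => h) |>.squarefree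

open scoped MatrixOrder Matrix.Norms.L2Operator ComplexOrder in
theorem exists_eq_conjTranspose_mul_self {P : Matrix m m ℝ} (hP : P.PosSemidef) :
    ∃ Y : Matrix m m ℝ, P = Yᴴ * Y :=
  CStarAlgebra.nonneg_iff_eq_star_mul_self.mp hP.nonneg

/-- The quotient of two positive definite matrices is diagonalizable with positive eigenvalues. -/
theorem exists_finset_aeval_mul_inv {P P₀ : Matrix m m ℝ} (hP : P.PosDef) (hP₀ : P₀.PosDef) :
    ∃ s : Finset ℝ, (∀ x ∈ s, 0 < x) ∧ aeval (P * P₀⁻¹) (∏ x ∈ s, (X - C x)) = 0 := by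
  -- With P₀⁻¹ = ᵗYY one has PP₀⁻¹ = Y⁻¹(YPᵗY)Y. The middle factor is symmetric and positive
  -- definite, and the spectral theorem applies to it.
  obtain ⟨Y, hY⟩ := exists_eq_conjTranspose_mul_self hP₀.inv.posSemidef
  have hYu : IsUnit Y.det := by
    have h1 : IsUnit (P₀⁻¹).det := (Matrix.isUnit_iff_isUnit_det _).mp hP₀.inv.isUnit
    rw [hY, Matrix.det_mul] at h1
    exact isUnit_of_mul_isUnit_right h1
  have hYu' : IsUnit Y := (Matrix.isUnit_iff_isUnit_det _).mpr hYu
  let Q := Y * P * Yᴴ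
  have hQ : Q.PosDef := hP.mul_mul_conjTranspose_same (Matrix.vecMul_injective_of_isUnit hYu')
  refine ⟨Finset.univ.image hQ.1.eigenvalues, ?_, ?_⟩
  · intro x hx
    obtain ⟨i, -, rfl⟩ := Finset.mem_image.mp hx
    exact hQ.eigenvalues_pos i
  · set N := ∏ x ∈ Finset.univ.image hQ.1.eigenvalues, (X - C x) with hN
    have hQN : aeval Q N = 0 := by
      have h0 : aeval (Matrix.diagonal (RCLike.ofReal ∘ hQ.1.eigenvalues : m → ℝ)) N = 0 := by
        have : aeval (Matrix.diagonal (RCLike.ofReal ∘ hQ.1.eigenvalues : m → ℝ)) N =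
            Matrix.diagonal fun i => N.eval (hQ.1.eigenvalues i) := by
          have := Polynomial.aeval_algHom_apply (Matrix.diagonalAlgHom ℝ)
            (RCLike.ofReal ∘ hQ.1.eigenvalues : m → ℝ) N
          refine this.trans ?_
          change Matrix.diagonal _ = _
          congr 1
          ext i
          have := Polynomial.aeval_algHom_apply (Pi.evalAlgHom ℝ (fun _ : m => ℝ) i)
            (RCLike.ofReal ∘ hQ.1.eigenvalues : m → ℝ) N
          refine this.symm.trans ?_
          rw [coe_aeval_eq_eval]
          rfl
        rw [this, ← Matrix.diagonal_zero]
        congr 1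
        ext i
        rw [hN, eval_prod]
        refine Finset.prod_eq_zero (Finset.mem_image_of_mem _ (Finset.mem_univ i)) ?_
        simp
      have h1 := hQ.1.spectral_theorem
      rw [h1]
      have := Polynomial.aeval_algHom_apply
        (Unitary.conjStarAlgAut ℝ _ hQ.1.eigenvectorUnitary).toAlgEquiv.toAlgHom
        (Matrix.diagonal (RCLike.ofReal ∘ hQ.1.eigenvalues : m → ℝ)) N
      refine this.trans ?_
      rw [h0, map_zero]
    have hS : P * P₀⁻¹ = Y⁻¹ * Q * Y := by
      rw [hY]
      simp only [Q, ← Matrix.mul_assoc, Matrix.nonsing_inv_mul _ hYu, one_mul]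
    have hconj : ∀ R : ℝ[X], aeval (Y⁻¹ * Q * Y) R = Y⁻¹ * aeval Q R * Y := by
      intro R
      induction R using Polynomial.induction_on' with
      | add p q hp hq => rw [map_add, map_add, hp, hq, Matrix.mul_add, Matrix.add_mul]
      | monomial k c =>
        rw [aeval_monomial, aeval_monomial, ← Algebra.smul_def, ← Algebra.smul_def,
          Matrix.mul_smul, Matrix.smul_mul]
        congr 1
        induction k with
        | zero => rw [pow_zero, pow_zero, mul_one, Matrix.nonsing_inv_mul _ hYu]
        | succ k ih =>
          rw [pow_succ, ih, pow_succ]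
          simp only [Matrix.mul_assoc]
          rw [← Matrix.mul_assoc Y Y⁻¹, Matrix.mul_nonsing_inv _ hYu, one_mul]
    rw [hS, hconj, hQN, Matrix.mul_zero, Matrix.zero_mul]

end Diagonalizable

end RealDeligne

namespace RealDeligne

open Polynomial

/-! ### Definite forms on eigenspaces -/

section Definite

variable {n : ℕ}

/-- The form `ᵗvBv` is definite of sign `s β` on the `β`-eigenspace of `ᵗA`, for all `β`. -/
def DefiniteWith (s : ℝ → ℝ) (A B : Matrix (Fin n) (Fin n) ℝ) : Prop :=
  ∀ (β : ℝ) (v : Fin n → ℝ), v ≠ 0 → Aᵀ *ᵥ v = β • v → 0 < s β * (v ⬝ᵥ (B *ᵥ v))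

variable {m : Type*} [Fintype m] [DecidableEq m]

theorem aeval_transpose {K : Type*} [CommRing K] (A : Matrix m m K) (f : K[X]) :
    aeval Aᵀ f = (aeval A f)ᵀ := by
  induction f using Polynomial.induction_on' with
  | add p q hp hq => rw [map_add, map_add, hp, hq, Matrix.transpose_add]
  | monomial k c =>
    rw [aeval_monomial, aeval_monomial, ← Algebra.smul_def, ← Algebra.smul_def,
      Matrix.transpose_smul, Matrix.transpose_pow]

theorem aeval_mul_eq_mul_aeval {K : Type*} [CommRing K] {A A' B : Matrix m m K}
    (h : A * B = B * A') (f : K[X]) : aeval A f * B = B * aeval A' f := by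
  induction f using Polynomial.induction_on' with
  | add p q hp hq => rw [map_add, map_add, Matrix.add_mul, Matrix.mul_add, hp, hq]
  | monomial k c =>
    rw [aeval_monomial, aeval_monomial, ← Algebra.smul_def, ← Algebra.smul_def, Matrix.smul_mul,
      Matrix.mul_smul]
    congr 1
    induction k with
    | zero => simp
    | succ k ih => rw [pow_succ, Matrix.mul_assoc, h, ← Matrix.mul_assoc, ih, pow_succ,
        Matrix.mul_assoc]

/-- The annihilating polynomial is a product of distinct linear factors, so it divides every
polynomial vanishing on `t`. Thus f(S) depends only on the values of f on `t`. -/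
theorem aeval_congr_of_eval_eq {K : Type*} [Field K] {S : Matrix m m K} {t : Finset K}
    (ht : aeval S (∏ x ∈ t, (X - C x)) = 0) {f g : K[X]} (hfg : ∀ x ∈ t, f.eval x = g.eval x) :
    aeval S f = aeval S g := by
  have hdvd : ∏ x ∈ t, (X - C x) ∣ f - g := by
    refine Finset.prod_dvd_of_coprime
      (fun x _ y _ hxy => isCoprime_X_sub_C_of_isUnit_sub (sub_ne_zero.mpr hxy).isUnit)
      fun x hx => ?_
    rw [dvd_iff_isRoot, IsRoot.def, eval_sub, hfg x hx, sub_self]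
  obtain ⟨h, hh⟩ := hdvd
  have := congrArg (aeval S) hh
  rwa [map_mul, ht, zero_mul, map_sub, sub_eq_zero] at this

/-- The relation AB = BᵗA makes ᵗA self-adjoint for B, so its eigenspaces are B-orthogonal. On each
of them f(ᵗA) is multiplication by the sign of B there, which turns the definite form into a
positive one. -/
theorem posDef_mul_aeval {s : ℝ → ℝ} {A B : Matrix (Fin n) (Fin n) ℝ} (hB : B.IsSymm)
    (hAB : A * B = B * Aᵀ) {t : Finset ℝ} (ht : aeval A (∏ x ∈ t, (X - C x)) = 0)
    (hs : DefiniteWith s A B) {f : ℝ[X]} (hf : ∀ x ∈ t, f.eval x = s x) :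
    (B * aeval Aᵀ f).PosDef := by
  have ht' : aeval Aᵀ (∏ x ∈ t, (X - C x)) = 0 := by rw [aeval_transpose, ht, transpose_zero]
  refine Matrix.PosDef.of_dotProduct_mulVec_pos ?_ fun v hv => ?_
  · rw [Matrix.IsHermitian, Matrix.conjTranspose_eq_transpose_of_trivial, Matrix.transpose_mul,
      ← aeval_transpose, Matrix.transpose_transpose, hB.eq, aeval_mul_eq_mul_aeval hAB]
  · rw [star_trivial]
    -- `w x` is the component of `v` in the `x`-eigenspace: the Lagrange basis polynomials,
    -- evaluated at ᵗA, are the spectral projections.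
    let w : ℝ → Fin n → ℝ := fun x => aeval Aᵀ (Lagrange.basis t id x) *ᵥ v
    have hw : ∀ g : ℝ[X], aeval Aᵀ g *ᵥ v = ∑ x ∈ t, g.eval x • w x := by
      intro g
      have e : aeval Aᵀ g = aeval Aᵀ (∑ x ∈ t, C (g.eval x) * Lagrange.basis t id x) := by
        refine aeval_congr_of_eval_eq ht' fun y hy => ?_
        rw [eval_finsetSum, Finset.sum_eq_single_of_mem y hy, eval_mul, eval_C,
          show (Lagrange.basis t id y).eval y = 1 from
            Lagrange.eval_basis_self (v := id) (Set.injOn_id _) hy, mul_one]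
        intro x hx hxy
        rw [eval_mul, show (Lagrange.basis t id x).eval y = 0 from
          Lagrange.eval_basis_of_ne (v := id) hxy hy, mul_zero]
      rw [e, map_sum, Matrix.sum_mulVec]
      refine Finset.sum_congr rfl fun x _ => ?_
      rw [map_mul, aeval_C, ← Algebra.smul_def, Matrix.smul_mulVec]
    have hv1 : v = ∑ x ∈ t, w x := by
      have := hw 1
      simpa using this
    have heig : ∀ x ∈ t, Aᵀ *ᵥ w x = x • w x := by
      intro x hx
      have e : aeval Aᵀ (X * Lagrange.basis t id x) = aeval Aᵀ (C x * Lagrange.basis t id x) := by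
        refine aeval_congr_of_eval_eq ht' fun y hy => ?_
        rw [eval_mul, eval_mul, eval_X, eval_C]
        by_cases hxy : x = y
        · rw [hxy]
        · rw [show (Lagrange.basis t id x).eval y = 0 from
            Lagrange.eval_basis_of_ne (v := id) hxy hy, mul_zero, mul_zero]
      rw [map_mul, aeval_X, map_mul, aeval_C, ← Algebra.smul_def] at e
      simp only [w]
      rw [Matrix.mulVec_mulVec, e, Matrix.smul_mulVec]
    have horth : ∀ x ∈ t, ∀ y ∈ t, x ≠ y → w x ⬝ᵥ (B *ᵥ w y) = 0 := by
      intro x hx y hy hxy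
      have e1 : (Aᵀ *ᵥ w x) ⬝ᵥ (B *ᵥ w y) = w x ⬝ᵥ (B *ᵥ (Aᵀ *ᵥ w y)) := by
        rw [Matrix.mulVec_transpose, ← Matrix.dotProduct_mulVec, Matrix.mulVec_mulVec _ A,
          Matrix.mulVec_mulVec _ B Aᵀ, hAB]
      rw [heig x hx, heig y hy, Matrix.mulVec_smul, dotProduct_smul, smul_dotProduct, smul_eq_mul,
        smul_eq_mul] at e1
      have : (x - y) * (w x ⬝ᵥ (B *ᵥ w y)) = 0 := by rw [sub_mul, e1, sub_self]
      exact (mul_eq_zero.mp this).resolve_left (sub_ne_zero.mpr hxy)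
    have hsum : v ⬝ᵥ ((B * aeval Aᵀ f) *ᵥ v) = ∑ x ∈ t, s x * (w x ⬝ᵥ (B *ᵥ w x)) := by
      rw [← Matrix.mulVec_mulVec, hw f, Matrix.mulVec_sum, dotProduct_sum]
      refine Finset.sum_congr rfl fun x hx => ?_
      rw [Matrix.mulVec_smul, dotProduct_smul, smul_eq_mul, hf x hx]
      congr 1
      conv_lhs => rw [hv1]
      rw [sum_dotProduct]
      exact Finset.sum_eq_single_of_mem x hx fun y hy hyx => horth y hy x hx hyx
    rw [hsum]
    have hne : ∃ x ∈ t, w x ≠ 0 := by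
      by_contra! h
      exact hv (hv1.trans (Finset.sum_eq_zero h))
    refine Finset.sum_pos' (fun x hx => ?_) ?_
    · by_cases h0 : w x = 0
      · simp [h0]
      · exact (hs x _ h0 (heig x hx)).le
    · obtain ⟨x, hx, h0⟩ := hne
      exact ⟨x, hx, hs x _ h0 (heig x hx)⟩

/-- If `B` and `B₀` are definite of the same sign on the eigenspaces of `ᵗA`, then `B B₀⁻¹` is
diagonalizable with positive eigenvalues. -/
theorem exists_finset_of_definiteWith {s : ℝ → ℝ} (hs1 : ∀ β, s β * s β = 1)
    {A B B₀ : Matrix (Fin n) (Fin n) ℝ} (hB : B.IsSymm) (hB₀ : B₀.IsSymm)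
    (hAB : A * B = B * Aᵀ) (hAB₀ : A * B₀ = B₀ * Aᵀ) {t : Finset ℝ}
    (ht : aeval A (∏ x ∈ t, (X - C x)) = 0)
    (hs : DefiniteWith s A B) (hs₀ : DefiniteWith s A B₀) :
    ∃ u : Finset ℝ, (∀ x ∈ u, 0 < x) ∧ aeval (B * B₀⁻¹) (∏ x ∈ u, (X - C x)) = 0 := by
  let f := Lagrange.interpolate t id s
  have hf : ∀ x ∈ t, f.eval x = s x := fun x hx =>
    Lagrange.eval_interpolate_at_node (v := id) s (Set.injOn_id _) hx
  have ht' : aeval Aᵀ (∏ x ∈ t, (X - C x)) = 0 := by rw [aeval_transpose, ht, transpose_zero]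
  -- The values of f are ±1 at the eigenvalues, so f(ᵗA) is its own inverse. It cancels in the
  -- quotient of Bf(ᵗA) by B₀f(ᵗA), leaving BB₀⁻¹.
  have hff : aeval Aᵀ f * aeval Aᵀ f = 1 := by
    rw [← map_mul, ← map_one (aeval (R := ℝ) Aᵀ)]
    refine aeval_congr_of_eval_eq ht' fun x hx => ?_
    rw [eval_mul, hf x hx, hs1, eval_one]
  obtain ⟨u, hu, h⟩ := exists_finset_aeval_mul_inv (posDef_mul_aeval hB hAB ht hs hf)
    (posDef_mul_aeval hB₀ hAB₀ ht hs₀ hf)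
  refine ⟨u, hu, ?_⟩
  rwa [Matrix.mul_inv_rev, Matrix.inv_eq_left_inv hff, Matrix.mul_assoc,
    ← Matrix.mul_assoc (aeval Aᵀ f), hff, one_mul] at h

open Module in
theorem sigPos_eq_finrank_iff {V : Type*} [AddCommGroup V] [Module ℝ V] [FiniteDimensional ℝ V]
    (Q : QuadraticForm ℝ V) : sigPos Q = finrank ℝ V ↔ Q.PosDef := by
  constructor
  · intro h
    obtain ⟨W, hW, hpos⟩ := exists_finrank_eq_sigPos_and_posDef Q
    rw [h] at hW
    have hWtop := Submodule.eq_top_of_finrank_eq hW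
    intro x hx
    exact hpos ⟨x, hWtop ▸ Submodule.mem_top⟩ (by simpa [Subtype.ext_iff] using hx)
  · intro h
    refine le_antisymm (sigPos_le_finrank Q) ?_
    have := le_sigPos_of_posDef Q (V := ⊤) (fun x hx => h _ (by simpa using hx))
    rwa [finrank_top] at this

open Module in
theorem sigNeg_eq_zero_of_posDef {V : Type*} [AddCommGroup V] [Module ℝ V]
    [FiniteDimensional ℝ V] {Q : QuadraticForm ℝ V} (h : Q.PosDef) : sigNeg Q = 0 := by
  have h1 := QuadraticForm.sigPos_add_sigNeg_add_radical (Q := Q)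
  have h2 := (sigPos_eq_finrank_iff Q).mpr h
  omega

theorem eigenForm_apply (A B : Matrix (Fin n) (Fin n) ℚ) (β : ℝ)
    (v : Module.End.eigenspace (Matrix.toLin' (A.map (Rat.castHom ℝ))ᵀ) β) :
    eigenForm A B β v = v.1 ⬝ᵥ (B.map (Rat.castHom ℝ) *ᵥ v.1) := by
  change Matrix.toLinearMap₂' ℝ (B.map (Rat.castHom ℝ)) v.1 v.1 = _
  rw [Matrix.toLinearMap₂'_apply']

theorem definiteWith_iff {s : ℝ → ℝ} (hs1 : ∀ β, s β = 1 ∨ s β = -1)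
    (A B : Matrix (Fin n) (Fin n) ℚ) :
    DefiniteWith s (A.map (Rat.castHom ℝ)) (B.map (Rat.castHom ℝ)) ↔
      ∀ β, (s β = 1 → (eigenForm A B β).PosDef) ∧ (s β = -1 → (-eigenForm A B β).PosDef) := by
  constructor
  · intro h β
    refine ⟨fun hβ v hv => ?_, fun hβ v hv => ?_⟩ <;>
    · have := h β v.1 (by simpa [Subtype.ext_iff] using hv)
        (by have := Module.End.mem_eigenspace_iff.mp v.2; rwa [Matrix.toLin'_apply] at this)
      rw [hβ] at this
      try rw [_root_.neg_apply]
      rw [eigenForm_apply]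
      linarith
  · intro h β v hv hβ
    let v' : Module.End.eigenspace (Matrix.toLin' (A.map (Rat.castHom ℝ))ᵀ) β :=
      ⟨v, Module.End.mem_eigenspace_iff.mpr (by rwa [Matrix.toLin'_apply])⟩
    have hv' : v' ≠ 0 := fun h0 => hv (congrArg Subtype.val h0)
    rcases hs1 β with h1 | h1
    · have := (h β).1 h1 v' hv'
      rw [eigenForm_apply] at this
      rwa [h1, one_mul]
    · have := (h β).2 h1 v' hv'
      rw [_root_.neg_apply, eigenForm_apply] at this
      rwa [h1, neg_one_mul]

/-- For a form that is definite on the eigenspaces, having the same signatures amounts to being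
definite of the same signs. -/
theorem sameSignatures_iff_definiteWith {s : ℝ → ℝ} (hs1 : ∀ β, s β = 1 ∨ s β = -1)
    {A B B₀ : Matrix (Fin n) (Fin n) ℚ}
    (h₀ : DefiniteWith s (A.map (Rat.castHom ℝ)) (B₀.map (Rat.castHom ℝ))) :
    SameSignatures A B B₀ ↔
      DefiniteWith s (A.map (Rat.castHom ℝ)) (B.map (Rat.castHom ℝ)) := by
  rw [definiteWith_iff hs1] at h₀ ⊢
  -- Definiteness is visible in the signature: one of the two numbers is the dimension of the
  -- eigenspace and the other is zero.
  refine forall_congr' fun β => ?_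
  constructor
  · rintro ⟨h1, h2⟩
    refine ⟨fun hβ => ?_, fun hβ => ?_⟩
    · rw [← sigPos_eq_finrank_iff, h1, sigPos_eq_finrank_iff]
      exact (h₀ β).1 hβ
    · rw [← sigPos_eq_finrank_iff, sigPos_neg, h2, ← sigPos_neg, sigPos_eq_finrank_iff]
      exact (h₀ β).2 hβ
  · rintro ⟨h1, h2⟩
    rcases hs1 β with hβ | hβ
    · have e1 := h1 hβ
      have e2 := (h₀ β).1 hβ
      rw [sigNeg_eq_zero_of_posDef e1, sigNeg_eq_zero_of_posDef e2,
        (sigPos_eq_finrank_iff _).mpr e1, (sigPos_eq_finrank_iff _).mpr e2]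
      exact ⟨rfl, rfl⟩
    · have e1 := h2 hβ
      have e2 := (h₀ β).2 hβ
      rw [← sigPos_neg, ← sigPos_neg, ← sigNeg_neg, ← sigNeg_neg, sigNeg_eq_zero_of_posDef e1,
        sigNeg_eq_zero_of_posDef e2, (sigPos_eq_finrank_iff _).mpr e1,
        (sigPos_eq_finrank_iff _).mpr e2]
      exact ⟨rfl, rfl⟩

end Definite

end RealDeligne

namespace RealDeligne

open Polynomial

/-! ### The eigenvalues of Frobenius -/

section Roots

variable {p a n : ℕ} [Fact p.Prime] {O : ValuationSubring ℂ}

theorem IsCoordinates.charpoly_eq {M : RealPolarizedModule p a n O} {γ : GL (Idx n) ℚ}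
    {ψ : M.T →ₗ[ℤ] (Idx n → ℚ)} (h : IsCoordinates M γ ψ) :
    γ.val.charpoly = M.F.charpoly.map (Int.castRingHom ℚ) := by
  have h1 := LinearMap.charpoly_baseChange (A := ℚ) M.F
  have h2 := LinearEquiv.charpoly_conj (coordsEquiv ℚ M.toDeligneModule h.injective)
    (M.F.baseChange ℚ)
  have h3 : (coordsEquiv ℚ M.toDeligneModule h.injective).conj (M.F.baseChange ℚ) =
      Matrix.toLin' γ.val := by
    refine LinearMap.ext fun x => ?_
    obtain ⟨y, rfl⟩ := (coordsEquiv ℚ M.toDeligneModule h.injective).surjective x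
    rw [LinearEquiv.conj_apply_apply, LinearEquiv.symm_apply_apply, coordsEquiv_apply,
      extendCoords_baseChange ℚ h.map_F]
    rfl
  rw [h3, Matrix.charpoly_toLin', h1] at h2
  exact h2

/-- An eigenvalue of Frobenius in `ℚ̄_p` is a unit or divisible by `q`. -/
theorem DeligneModule.norm_root (M : DeligneModule p a n) (ha : 0 < a) {y : PadicAlgCl p}
    (hy : y ∈ (M.F.charpoly.map (Int.castRingHom (PadicAlgCl p))).roots) :
    y ^ 2 ≠ ((p ^ a : ℕ) : PadicAlgCl p) := by
  classical
  intro hyq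
  set q := ‖((p ^ a : ℕ) : PadicAlgCl p)‖ with hq
  have hp1 : ‖(p : PadicAlgCl p)‖ = (p : ℝ)⁻¹ := by
    have := PadicAlgCl.norm_extends p (p : ℚ_[p])
    rw [Padic.norm_p] at this
    rw [← this]
    simp
  have hq1 : q < 1 := by
    rw [hq, Nat.cast_pow, norm_pow, hp1]
    refine pow_lt_one₀ (by positivity) ?_ ha.ne'
    exact inv_lt_one_of_one_lt₀ (by exact_mod_cast (Fact.out : p.Prime).one_lt)
  have hq0 : 0 < q := by
    rw [hq, Nat.cast_pow, norm_pow, hp1]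
    have : (0 : ℝ) < p := by exact_mod_cast (Fact.out : p.Prime).pos
    positivity
  -- So ‖y‖ would lie strictly between ‖pᵃ‖ and 1, where no eigenvalue can be.
  have hyn : ‖y‖ ^ 2 = q := by rw [hq, ← hyq, norm_pow]
  set R := (M.F.charpoly.map (Int.castRingHom (PadicAlgCl p))).roots with hR
  have hcard : R.card = 2 * n := by
    have hmon : (M.F.charpoly.map (Int.castRingHom (PadicAlgCl p))).Monic :=
      (LinearMap.charpoly_monic M.F).map _
    rw [hR, ← (IsAlgClosed.splits _).natDegree_eq_card_roots,
      (LinearMap.charpoly_monic M.F).natDegree_map, LinearMap.charpoly_natDegree, M.finrank_eq]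
  have h1 : (R.filter fun z => ‖z‖ = 1).card = n := by
    convert M.half_units
  have h2 : (R.filter fun z => ‖z‖ ≤ q).card = n := by
    convert M.half_divisible
  have h3 : (R.filter fun z => ¬ ‖z‖ = 1).card = n := by
    have := congrArg Multiset.card (Multiset.filter_add_not (fun z => ‖z‖ = 1) R)
    rw [Multiset.card_add, h1, hcard] at this
    omega
  -- Of the 2n eigenvalues n are units, hence n are not. The n eigenvalues divisible by pᵃ are among
  -- the latter, and counting shows that they exhaust them.
  have h4 : (R.filter fun z => ‖z‖ ≤ q) = R.filter fun z => ¬ ‖z‖ = 1 := by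
    refine Multiset.eq_of_le_of_card_le ?_ (by rw [h2, h3])
    refine Multiset.monotone_filter_right R fun z hz h => ?_
    rw [h] at hz
    linarith
  by_cases hy1 : ‖y‖ = 1
  · rw [hy1] at hyn
    linarith
  · have : y ∈ R.filter fun z => ‖z‖ ≤ q := by
      rw [h4]; exact Multiset.mem_filter.mpr ⟨hy, hy1⟩
    have hle := (Multiset.mem_filter.mp this).2
    have := norm_nonneg y
    nlinarith

/-- The second condition says that no eigenvalue is real, and it is `p`-adic in origin. An
eigenvalue with z² = q would give the characteristic polynomial a common factor with X² − q over ℚ,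
and this factor would have a root in ℚ̄_p, against `DeligneModule.norm_root`. -/
theorem IsCoordinates.root {M : RealPolarizedModule p a n O} {γ : GL (Idx n) ℚ}
    {ψ : M.T →ₗ[ℤ] (Idx n → ℚ)} (h : IsCoordinates M γ ψ) (ha : 0 < a) {z : ℂ}
    (hz : aeval z (minpoly ℚ γ.val) = 0) :
    ‖z‖ ^ 2 = ((p ^ a : ℕ) : ℝ) ∧ z ^ 2 ≠ ((p ^ a : ℕ) : ℂ) := by
  have hz' : aeval z (M.F.charpoly.map (Int.castRingHom ℚ)) = 0 := by
    rw [← h.charpoly_eq]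
    obtain ⟨c, hc⟩ := Matrix.minpoly_dvd_charpoly γ.val
    rw [hc, map_mul, hz, zero_mul]
  have hmon : M.F.charpoly.Monic := LinearMap.charpoly_monic M.F
  constructor
  · have : ‖z‖ = Real.sqrt ((p ^ a : ℕ) : ℝ) := by
      refine M.weil z ?_
      rw [mem_roots (hmon.map _).ne_zero, IsRoot.def, eval_map]
      rw [aeval_def, eval₂_map] at hz'
      rwa [show (Int.castRingHom ℂ) = (algebraMap ℚ ℂ).comp (Int.castRingHom ℚ) from
        RingHom.ext_int _ _]
    rw [this, Real.sq_sqrt (Nat.cast_nonneg _)]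
  · intro hzq
    have hnc : ¬ IsCoprime (M.F.charpoly.map (Int.castRingHom ℚ))
        (X ^ 2 - C ((p ^ a : ℕ) : ℚ)) := by
      rintro ⟨u, v, huv⟩
      have := congrArg (aeval z) huv
      rw [map_add, map_mul, map_mul, hz', map_sub, map_pow, aeval_X, aeval_C, hzq] at this
      simp at this
    rw [Polynomial.isCoprime_iff_aeval_ne_zero_of_isAlgClosed ℚ (PadicAlgCl p)] at hnc
    push Not at hnc
    obtain ⟨y, hy1, hy2⟩ := hnc
    refine M.norm_root ha (y := y) ?_ ?_
    · rw [mem_roots (hmon.map _).ne_zero, IsRoot.def, eval_map]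
      rw [aeval_def, eval₂_map] at hy1
      rwa [show (Int.castRingHom (PadicAlgCl p)) =
        (algebraMap ℚ (PadicAlgCl p)).comp (Int.castRingHom ℚ) from RingHom.ext_int _ _]
    · rw [map_sub, map_pow, aeval_X, aeval_C, sub_eq_zero] at hy2
      rw [hy2]
      simp

end Roots

/-! ### The real eigenvalues of `A` -/

section RealEigenvalues

variable {n : ℕ}

theorem aeval_fromBlocks {K : Type*} [CommRing K] (A D : Matrix (Fin n) (Fin n) K) (f : K[X]) :
    aeval (fromBlocks A 0 0 D) f = fromBlocks (aeval A f) 0 0 (aeval D f) := by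
  induction f using Polynomial.induction_on' with
  | add p q hp hq => rw [map_add, map_add, map_add, hp, hq, fromBlocks_add, add_zero]
  | monomial k c =>
    simp only [aeval_monomial, ← Algebra.smul_def]
    have : ∀ k : ℕ, (fromBlocks A 0 0 D) ^ k = fromBlocks (A ^ k) 0 0 (D ^ k) := fun k => by
      induction k with
      | zero => simp [fromBlocks_one]
      | succ k ih => rw [pow_succ, ih, fromBlocks_multiply]; simp [pow_succ]
    rw [this, fromBlocks_smul, smul_zero]

/-- If the eigenvalues of the inversive element `(A, B; C, ᵗA)` are nonreal of absolute value
`√q`, then `A` is diagonalizable over `ℝ`, with eigenvalues in the interval `(-√q, √q)`. -/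
theorem exists_finset_aeval_eq_zero {q : ℕ} {γ : GL (Idx n) ℚ}
    {A B C' : Matrix (Fin n) (Fin n) ℚ} (hγ : γ.val = fromBlocks A B C' Aᵀ)
    (hb : InversiveBlocks (q : ℚ) A B C') (hss : Squarefree (minpoly ℚ γ.val))
    (hroot : ∀ z : ℂ, aeval z (minpoly ℚ γ.val) = 0 → ‖z‖ ^ 2 = (q : ℝ) ∧ z ^ 2 ≠ (q : ℂ)) :
    ∃ t : Finset ℝ, (∀ b ∈ t, b ^ 2 < q) ∧
      aeval (A.map (Rat.castHom ℝ)) (∏ b ∈ t, (X - C b)) = 0 := by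
  classical
  obtain ⟨s, hs, hdvd⟩ := exists_finset_map_dvd_prod (K := ℂ) hss
  refine ⟨s.image Complex.re, ?_, ?_⟩
  · intro b hb'
    obtain ⟨z, hz, rfl⟩ := Finset.mem_image.mp hb'
    obtain ⟨h1, h2⟩ := hroot z (hs z hz)
    rw [← Complex.normSq_eq_norm_sq, Complex.normSq_apply] at h1
    have him : z.im ≠ 0 := by
      intro h0
      apply h2
      apply Complex.ext
      · rw [pow_two, Complex.mul_re, h0, Complex.natCast_re]; rw [h0] at h1; linarith
      · rw [pow_two, Complex.mul_im, h0, Complex.natCast_im]; ring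
    have : 0 < z.im * z.im := mul_self_pos.mpr him
    nlinarith
  · set t := s.image Complex.re
    -- Each factor is the real minimal polynomial of a conjugate pair of eigenvalues with real part
    -- b and absolute value √q. The roots in `s` being distinct, it is enough to check that each of
    -- them is a root of `Q`.
    let Q : ℝ[X] := ∏ b ∈ t, (X ^ 2 - C (2 * b) * X + C (q : ℝ))
    have hQ : (minpoly ℚ γ.val).map (Rat.castHom ℝ) ∣ Q := by
      rw [← Polynomial.map_dvd_map' (algebraMap ℝ ℂ), Polynomial.map_map]
      have e : (algebraMap ℝ ℂ).comp (Rat.castHom ℝ) = Rat.castHom ℂ := RingHom.ext_rat _ _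
      rw [e]
      refine hdvd.trans (Finset.prod_dvd_of_coprime
        (fun x _ y _ hxy => isCoprime_X_sub_C_of_isUnit_sub (sub_ne_zero.mpr hxy).isUnit)
        fun z hz => ?_)
      rw [dvd_iff_isRoot, IsRoot.def, Polynomial.map_prod, eval_prod]
      refine Finset.prod_eq_zero (Finset.mem_image_of_mem _ hz) ?_
      have h1 : ((q : ℝ) : ℂ) = z * (starRingEnd ℂ) z := by
        rw [Complex.mul_conj, Complex.normSq_eq_norm_sq, (hroot z (hs z hz)).1]
      have h2 : ((2 * z.re : ℝ) : ℂ) = z + (starRingEnd ℂ) z := (Complex.add_conj z).symm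
      simp only [Polynomial.map_add, Polynomial.map_sub, Polynomial.map_mul, Polynomial.map_pow,
        map_X, map_C, eval_add, eval_sub, eval_mul, eval_pow, eval_X, eval_C,
        Complex.coe_algebraMap]
      rw [h1, h2]
      ring
    set G := γ.val.map (Rat.castHom ℝ) with hG
    have hGQ : aeval G Q = 0 := by
      obtain ⟨c, hc⟩ := hQ
      rw [hc, map_mul, hG, aeval_map_matrix, minpoly.aeval, Matrix.map_zero _ (map_zero _),
        zero_mul]
    set D : Matrix (Idx n) (Idx n) ℝ :=
      fromBlocks (A.map (Rat.castHom ℝ)) 0 0 (A.map (Rat.castHom ℝ))ᵀ with hD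
    -- The second identity is γ + qγ⁻¹ = 2 diag(A, ᵗA), multiplied by γ.
    have hGD : G * D = D * G ∧ G * G + (q : ℝ) • 1 = (2 : ℝ) • (G * D) := by
      have e1 : fromBlocks A B C' Aᵀ * fromBlocks A 0 0 Aᵀ =
          fromBlocks A 0 0 Aᵀ * fromBlocks A B C' Aᵀ := by
        rw [fromBlocks_multiply, fromBlocks_multiply]
        simp [hb.AB, hb.CA]
      have e2 : fromBlocks A B C' Aᵀ * fromBlocks A B C' Aᵀ + (q : ℚ) • 1 =
          (2 : ℚ) • (fromBlocks A B C' Aᵀ * fromBlocks A 0 0 Aᵀ) := by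
        rw [fromBlocks_multiply, fromBlocks_multiply, ← fromBlocks_one, fromBlocks_smul,
          fromBlocks_smul, fromBlocks_add]
        rw [hb.BC, hb.CB, hb.AB, hb.CA, pow_two, pow_two]
        simp only [two_smul, mul_zero, add_zero, zero_add, smul_zero]
        congr 1 <;> abel
      have eD : D = (fromBlocks A 0 0 Aᵀ).map (Rat.castHom ℝ) := by
        rw [fromBlocks_map, Matrix.map_zero _ (map_zero _), hD, Matrix.transpose_map]
      rw [hG, eD, hγ]
      constructor
      · rw [← Matrix.map_mul, ← Matrix.map_mul, e1]
      · rw [← Matrix.map_mul, ← Matrix.map_mul]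
        have := congrArg (fun N => N.map (Rat.castHom ℝ)) e2
        ext i j
        have := congrFun (congrFun this i) j
        simpa [Matrix.one_apply, apply_ite] using this
    -- By the previous identity G² − 2bG + q = 2G(D − b), and G commutes with D. As G is invertible,
    -- Q(G) = 0 yields the vanishing of the product of the D − b.
    have hprod : ∀ t : Finset ℝ, aeval G (∏ b ∈ t, (X ^ 2 - C (2 * b) * X + C (q : ℝ))) =
        ((2 : ℝ) • G) ^ t.card * aeval D (∏ b ∈ t, (X - C b)) := by
      intro t
      induction t using Finset.induction_on with
      | empty => simp
      | insert b t hbt ih =>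
        rw [Finset.prod_insert hbt, map_mul (aeval G), ih, Finset.prod_insert hbt, map_mul (aeval D),
          Finset.card_insert_of_notMem hbt, pow_succ ((2 : ℝ) • G)]
        have e3 : aeval G (X ^ 2 - C (2 * b) * X + C (q : ℝ)) =
            ((2 : ℝ) • G) * aeval D (X - C b) := by
          simp only [map_add, map_sub, map_mul, aeval_X, aeval_C,
            Algebra.algebraMap_eq_smul_one, Matrix.smul_mul, one_mul, Matrix.mul_sub,
            Matrix.mul_smul, mul_one, pow_two]
          rw [← hGD.2]
          abel
        have hcomm : Commute (aeval D (X - C b)) (((2 : ℝ) • G) ^ t.card) := by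
          refine Commute.pow_right (Commute.smul_right ?_ _) _
          rw [map_sub, aeval_X, aeval_C]
          exact Commute.sub_left hGD.1.symm (Algebra.commutes b G)
        rw [e3, (Commute.pow_self ((2 : ℝ) • G) t.card).eq, mul_assoc, ← mul_assoc _ _ (aeval D _),
          hcomm.eq, mul_assoc, mul_assoc]
    have hGu : IsUnit (((2 : ℝ) • G) ^ t.card) := by
      refine IsUnit.pow _ ?_
      have : IsUnit G := (ratMap ℝ γ).isUnit
      exact this.smul (Units.mk0 (2 : ℝ) two_ne_zero)
    rw [hprod, hGu.mul_right_eq_zero, hD, aeval_fromBlocks] at hGQ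
    have := congrArg toBlocks₁₁ hGQ
    rwa [toBlocks_fromBlocks₁₁] at this

end RealEigenvalues

end RealDeligne

namespace RealDeligne

open Polynomial

/-! ### Positivity -/

section Positivity

variable {p a n : ℕ} [Fact p.Prime] {O : ValuationSubring ℂ}

/-- Since b² < q for every b in `t`, the annihilating product is coprime to X² − q. Through BC = A²
− q this is what makes the block B invertible. -/
theorem isUnit_det_sq_sub {q : ℕ} {A : Matrix (Fin n) (Fin n) ℚ} {t : Finset ℝ}
    (ht : ∀ b ∈ t, b ^ 2 < q)
    (hA : aeval (A.map (Rat.castHom ℝ)) (∏ b ∈ t, (X - C b)) = 0) :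
    IsUnit (A ^ 2 - (q : ℚ) • (1 : Matrix (Fin n) (Fin n) ℚ)).det := by
  have hcop : IsCoprime (∏ b ∈ t, (X - C b)) (X ^ 2 - C (q : ℝ)) := by
    refine IsCoprime.prod_left fun b hb => ?_
    rw [(irreducible_X_sub_C b).coprime_iff_not_dvd, dvd_iff_isRoot, IsRoot.def, eval_sub, eval_pow,
      eval_X, eval_C]
    exact (sub_neg.mpr (ht b hb)).ne
  obtain ⟨u, v, huv⟩ := hcop
  have h1 := congrArg (aeval (A.map (Rat.castHom ℝ))) huv
  rw [map_add, map_mul, map_mul, hA, mul_zero, zero_add, map_one, map_sub, map_pow, aeval_X,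
    aeval_C] at h1
  have h2 : (A.map (Rat.castHom ℝ)) ^ 2 - algebraMap ℝ _ (q : ℝ) =
      (A ^ 2 - (q : ℚ) • (1 : Matrix (Fin n) (Fin n) ℚ)).map (Rat.castHom ℝ) := by
    rw [Algebra.algebraMap_eq_smul_one, ← Matrix.map_pow]
    ext i j
    simp only [Matrix.sub_apply, Matrix.smul_apply, Matrix.map_apply, Matrix.one_apply]
    split_ifs <;> simp
  rw [h2] at h1
  have h3 := IsUnit.of_mul_eq_one_right _ h1
  rw [Matrix.isUnit_iff_isUnit_det, ← RingHom.mapMatrix_apply, ← RingHom.map_det] at h3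
  exact isUnit_map_iff (Rat.castHom ℝ) _ |>.mp h3

/-- Density of the rational vectors gives only semidefiniteness over ℝ. Strictness holds because a
degenerate rational form has a nonzero rational vector in its kernel. -/
theorem posDef_map_of_rat {m : Type*} [Fintype m] [DecidableEq m] {H : Matrix m m ℚ}
    (hs : H.IsSymm) (hp : ∀ v, v ≠ 0 → 0 < v ⬝ᵥ (H *ᵥ v)) :
    (H.map (Rat.castHom ℝ)).PosDef := by
  have hpos : (H.map (Rat.castHom ℝ)).PosSemidef := by
    refine Matrix.PosSemidef.of_dotProduct_mulVec_nonneg ?_ fun v => ?_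
    · rw [Matrix.IsHermitian, Matrix.conjTranspose_eq_transpose_of_trivial, ← Matrix.transpose_map,
        hs.eq]
    · rw [star_trivial]
      have hd : DenseRange (Pi.map fun _ : m => ((↑) : ℚ → ℝ)) :=
        DenseRange.piMap fun _ => Rat.denseRange_cast
      have hc : IsClosed {v : m → ℝ | 0 ≤ v ⬝ᵥ (H.map (Rat.castHom ℝ) *ᵥ v)} := by
        refine isClosed_le continuous_const ?_
        simp only [dotProduct, mulVec]
        fun_prop
      refine hd.induction_on (p := fun v => 0 ≤ v ⬝ᵥ (H.map (Rat.castHom ℝ) *ᵥ v)) v hc fun w => ?_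
      have e : (Pi.map (fun _ : m => ((↑) : ℚ → ℝ)) w) ⬝ᵥ
          (H.map (Rat.castHom ℝ) *ᵥ (Pi.map (fun _ : m => ((↑) : ℚ → ℝ)) w)) =
          ((w ⬝ᵥ (H *ᵥ w) : ℚ) : ℝ) := by
        simp [dotProduct, mulVec]
      rw [e]
      by_cases hw : w = 0
      · simp [hw]
      · exact_mod_cast (hp w hw).le
  rw [hpos.posDef_iff_det_ne_zero, ← RingHom.mapMatrix_apply, ← RingHom.map_det]
  intro h0
  obtain ⟨v, hv, hv0⟩ := Matrix.exists_mulVec_eq_zero_iff.mpr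
    ((map_eq_zero (Rat.castHom ℝ)).mp h0)
  have := hp v hv
  rw [hv0, dotProduct_zero] at this
  exact lt_irrefl _ this

theorem extendCoords_aeval {M : DeligneModule p a n} {ψ : M.T →ₗ[ℤ] (Idx n → ℚ)}
    {A : Matrix (Idx n) (Idx n) ℚ} (h : ∀ x, ψ (M.F x) = A *ᵥ ψ x) (P : ℚ[X])
    (x : ℚ ⊗[ℤ] M.T) :
    extendCoords ℚ ψ (aeval (M.F.baseChange ℚ) P x) = aeval A P *ᵥ extendCoords ℚ ψ x := by
  have hA : A.map (Rat.castHom ℚ) = A := by ext; simp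
  induction P using Polynomial.induction_on' with
  | add P Q hP hQ => rw [map_add, LinearMap.add_apply, map_add, hP, hQ, map_add, Matrix.add_mulVec]
  | monomial k c =>
    simp only [aeval_monomial, ← Algebra.smul_def, LinearMap.smul_apply, map_smul,
      Matrix.smul_mulVec]
    congr 1
    induction k generalizing x with
    | zero => simp
    | succ k ih =>
      rw [pow_succ, Module.End.mul_apply, ih, extendCoords_baseChange ℚ h, hA, pow_succ,
        Matrix.mulVec_mulVec]

theorem exists_aeval_of_mem_QF {M : DeligneModule p a n} (x : M.QF) :
    ∃ P : ℚ[X], x = aeval M.genF P := by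
  obtain ⟨x, hx⟩ := x
  have hx' : x ∈ Algebra.adjoin ℚ {M.F.baseChange ℚ} := hx
  rw [Algebra.adjoin_singleton_eq_range_aeval] at hx'
  obtain ⟨P, hP⟩ := hx'
  refine ⟨P, Subtype.ext ?_⟩
  have := Polynomial.aeval_algHom_apply M.QF.val M.genF P
  rw [show M.QF.val (aeval M.genF P) = ((aeval M.genF P : M.QF) : Module.End ℚ _) from rfl] at this
  rw [← this]
  exact hP.symm

/-- ℚ[F] is the quotient of ℚ[X] by the annihilator of F, so a common complex zero of this
annihilator defines a homomorphism. This turns a condition on all φ into one on complex eigenvalues.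
-/
theorem exists_algHom_QF {M : DeligneModule p a n} {z : ℂ}
    (hz : ∀ P : ℚ[X], aeval (M.F.baseChange ℚ) P = 0 → aeval z P = 0) :
    ∃ φ : M.QF →ₐ[ℚ] ℂ, φ M.genF = z := by
  have hs : Function.Surjective (aeval M.genF : ℚ[X] →ₐ[ℚ] M.QF) := fun x =>
    let ⟨P, hP⟩ := exists_aeval_of_mem_QF x
    ⟨P, hP.symm⟩
  have hval : ∀ P : ℚ[X], ((aeval M.genF P : M.QF) : Module.End ℚ _) =
      aeval (M.F.baseChange ℚ) P := fun P =>
    (Polynomial.aeval_algHom_apply M.QF.val M.genF P).symm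
  let φ : M.QF →+* ℂ := RingHom.liftOfRightInverse (aeval M.genF : ℚ[X] →ₐ[ℚ] M.QF).toRingHom
    (Function.surjInv hs) (Function.rightInverse_surjInv hs)
    ⟨(aeval z : ℚ[X] →ₐ[ℚ] ℂ).toRingHom, fun P hP => hz P (by
      rw [← hval, show aeval M.genF P = 0 from hP]; rfl)⟩
  have h := fun Q : ℚ[X] => RingHom.liftOfRightInverse_comp_apply (aeval M.genF : ℚ[X] →ₐ[ℚ] M.QF).toRingHom
    (Function.surjInv hs) (Function.rightInverse_surjInv hs)
    ⟨(aeval z : ℚ[X] →ₐ[ℚ] ℂ).toRingHom, fun P hP => hz P (by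
      rw [← hval, show aeval M.genF P = 0 from hP]; rfl)⟩ Q
  change ∀ Q : ℚ[X], φ (aeval M.genF Q) = aeval z Q at h
  refine ⟨{ φ with commutes' := fun r => ?_ }, ?_⟩
  · have := h (C r)
    rwa [aeval_C, aeval_C] at this
  · have := h X
    rwa [aeval_X, aeval_X] at this

/-- The polynomial `P` takes purely imaginary values at the roots of `μ`, with positive imaginary
part at those of positive valuation. -/
def IsPositiveImaginaryOn (O : ValuationSubring ℂ) (μ P : ℚ[X]) : Prop :=
  ∀ z : ℂ, aeval z μ = 0 → (aeval z P).re = 0 ∧ (z ∈ O.nonunits → 0 < (aeval z P).im)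

/-- The positivity of a polarization, in coordinates. -/
theorem IsCoordinates.exists_positive {M : RealPolarizedModule p a n O} {γ : GL (Idx n) ℚ}
    {ψ : M.T →ₗ[ℤ] (Idx n → ℚ)} (h : IsCoordinates M γ ψ) :
    ∃ P : ℚ[X], M.IsPositiveImaginary (M.cmType O) (aeval M.genF P) ∧
      IsPositiveImaginaryOn O (minpoly ℚ γ.val) P ∧
      ((stdJ n ℚ * aeval γ.val P).map (Rat.castHom ℝ)).PosDef := by
  obtain ⟨ι, hι, hsymm, hpos⟩ := M.positive
  obtain ⟨P, rfl⟩ := exists_aeval_of_mem_QF ι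
  have hval : ((aeval M.genF P : M.QF) : Module.End ℚ _) = aeval (M.F.baseChange ℚ) P :=
    (Polynomial.aeval_algHom_apply M.QF.val M.genF P).symm
  rw [hval] at hsymm hpos
  have hform : ∀ x y, (M.ω.baseChange ℚ) x (aeval (M.F.baseChange ℚ) P y) =
      extendCoords ℚ ψ x ⬝ᵥ ((stdJ n ℚ * aeval γ.val P) *ᵥ extendCoords ℚ ψ y) := fun x y => by
    rw [baseChange_form_eq ℚ h.map_ω, extendCoords_aeval h.map_F, map_stdJ, Matrix.mulVec_mulVec]
  have hsurj : ∀ u, ∃ x, extendCoords ℚ ψ x = u :=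
    (coordsEquiv ℚ M.toDeligneModule h.injective).surjective
  refine ⟨P, hι, fun z hz => ?_, posDef_map_of_rat ?_ fun v hv => ?_⟩
  · obtain ⟨φ, hφ⟩ := exists_algHom_QF (M := M.toDeligneModule) (z := z) fun Q hQ => by
      have h0 : aeval γ.val Q = 0 := by
        refine matrix_ext_of_coords M.toDeligneModule h.injective fun x => ?_
        have := extendCoords_aeval h.map_F Q (1 ⊗ₜ x)
        rw [hQ, LinearMap.zero_apply, map_zero, extendCoords_tmul, one_smul] at this
        rw [Matrix.zero_mulVec, this]
        congr 1
      obtain ⟨c, hc⟩ := minpoly.dvd ℚ γ.val h0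
      rw [hc, map_mul, hz, zero_mul]
    have hP : φ (aeval M.genF P) = aeval z P := by
      rw [← Polynomial.aeval_algHom_apply, hφ]
    rw [← hP]
    exact ⟨hι.1 φ, fun hzO => hι.2 φ (by rw [DeligneModule.cmType, Set.mem_ofPred_eq, hφ]; exact hzO)⟩
  · ext i j
    obtain ⟨x, hx⟩ := hsurj (Pi.single j 1)
    obtain ⟨y, hy⟩ := hsurj (Pi.single i 1)
    have := hsymm x y
    rw [hform, hform, hx, hy] at this
    simpa using this
  · obtain ⟨x, rfl⟩ := hsurj v
    rw [← hform]
    exact hpos x fun h0 => hv (by rw [h0, map_zero])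

/-- The sign of the form `ᵗvBv` on the `β`-eigenspace of `ᵗA` that is forced by positivity. -/
def forcedSign (O : ValuationSubring ℂ) (q : ℕ) (β : ℝ) : ℝ :=
  open scoped Classical in
  if ((β : ℂ) + Real.sqrt (q - β ^ 2) * Complex.I) ∈ O.nonunits then -1 else 1

theorem forcedSign_eq (O : ValuationSubring ℂ) (q : ℕ) (β : ℝ) :
    forcedSign O q β = 1 ∨ forcedSign O q β = -1 := by
  unfold forcedSign
  split_ifs <;> simp

/-- The product of z and its conjugate is q, which has valuation less than 1, so the two factors
cannot both have valuation at least 1. -/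
theorem conj_mem_nonunits {q : ℕ} (hq : (q : ℂ) ∈ O.nonunits) {z : ℂ}
    (hz : ‖z‖ ^ 2 = (q : ℝ)) (hzO : z ∉ O.nonunits) : (starRingEnd ℂ) z ∈ O.nonunits := by
  have e : z * (starRingEnd ℂ) z = q := by
    rw [Complex.mul_conj, Complex.normSq_eq_norm_sq, hz]
    simp
  rw [O.mem_nonunits_iff] at hq hzO ⊢
  rw [not_lt] at hzO
  by_contra hcon
  rw [not_lt] at hcon
  rw [← e, map_mul] at hq
  exact absurd hq (not_lt.mpr (one_le_mul hzO hcon))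

end Positivity

end RealDeligne

namespace RealDeligne

open Polynomial

/-! ### The sign on eigenspaces forced by positivity -/

section ForcedSign

variable {n : ℕ} {O : ValuationSubring ℂ}

theorem InversiveBlocks.map {K L : Type*} [Field K] [Field L] (f : K →+* L) {q : K}
    {A B C : Matrix (Fin n) (Fin n) K} (h : InversiveBlocks q A B C) :
    InversiveBlocks (f q) (A.map f) (B.map f) (C.map f) where
  symm_B := by rw [Matrix.IsSymm, ← Matrix.transpose_map, h.symm_B.eq]
  symm_C := by rw [Matrix.IsSymm, ← Matrix.transpose_map, h.symm_C.eq]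
  AB := by rw [← Matrix.transpose_map, ← Matrix.map_mul, ← Matrix.map_mul, h.AB]
  CA := by rw [← Matrix.transpose_map, ← Matrix.map_mul, ← Matrix.map_mul, h.CA]
  BC := by
    rw [← Matrix.map_mul, h.BC, ← Matrix.map_pow]
    ext i j
    simp only [Matrix.sub_apply, Matrix.smul_apply, Matrix.map_apply, Matrix.one_apply]
    split_ifs <;> simp
  CB := by
    rw [← Matrix.map_mul, h.CB, ← Matrix.transpose_map, ← Matrix.map_pow]
    ext i j
    simp only [Matrix.sub_apply, Matrix.smul_apply, Matrix.map_apply, Matrix.one_apply]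
    split_ifs <;> simp

theorem aeval_mulVec_of_eigen {K m : Type*} [Field K] [Fintype m] [DecidableEq m]
    {S : Matrix m m K} {v : m → K} {β : K} (h : S *ᵥ v = β • v) (f : K[X]) :
    aeval S f *ᵥ v = f.eval β • v := by
  induction f using Polynomial.induction_on' with
  | add p q hp hq => rw [map_add, Matrix.add_mulVec, hp, hq, eval_add, add_smul]
  | monomial k c =>
    rw [aeval_monomial, ← Algebra.smul_def, eval_monomial, Matrix.smul_mulVec, mul_smul]
    congr 1
    induction k with
    | zero => simp
    | succ k ih => rw [pow_succ', ← Matrix.mulVec_mulVec, ih, Matrix.mulVec_smul, h, smul_smul,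
        pow_succ]

/-- On a vector killed by the minimal polynomial of the nonreal number `z`, the values `f(G)`
are computed like `f(z)`. -/
theorem aeval_mulVec_of_quadratic {m : Type*} [Fintype m] [DecidableEq m] {G : Matrix m m ℝ}
    {x : m → ℝ} {z : ℂ} (hz : z.im ≠ 0)
    (hx : G *ᵥ (G *ᵥ x) = (2 * z.re) • (G *ᵥ x) - (‖z‖ ^ 2) • x) (f : ℝ[X]) {u w : ℝ}
    (hf : aeval z f = u + w * z) : aeval G f *ᵥ x = u • x + w • (G *ᵥ x) := by
  -- The real polynomial f − (u + wX) vanishes at the nonreal number z, so it is divisible by X² − 2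
  -- Re(z) X + |z|², which kills `x` when evaluated at `G`.
  have h0 : aeval z (f - (C u + C w * X)) = 0 := by
    rw [map_sub, hf, map_add, map_mul, aeval_X, aeval_C, aeval_C]
    simp
  obtain ⟨k, hk⟩ := Polynomial.quadratic_dvd_of_aeval_eq_zero_im_ne_zero _ h0 hz
  have h1 := congrArg (fun g => aeval G g *ᵥ x) (sub_eq_iff_eq_add.mp hk)
  have h2 : aeval G (X ^ 2 - C (2 * z.re) * X + C (‖z‖ ^ 2)) *ᵥ x = 0 := by
    rw [map_add, map_sub, map_mul (aeval G), map_pow (aeval G), aeval_X, aeval_C, aeval_C,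
      ← Algebra.smul_def, Algebra.algebraMap_eq_smul_one, Matrix.add_mulVec, Matrix.sub_mulVec,
      pow_two, ← Matrix.mulVec_mulVec, hx, Matrix.smul_mulVec, Matrix.smul_mulVec,
      Matrix.one_mulVec]
    abel
  beta_reduce at h1
  rw [h1, map_add, mul_comm _ k, map_mul (aeval G) k, Matrix.add_mulVec, ← Matrix.mulVec_mulVec, h2,
    Matrix.mulVec_zero, zero_add, map_add, map_mul (aeval G), aeval_C, aeval_C, aeval_X,
    ← Algebra.smul_def, Algebra.algebraMap_eq_smul_one, Matrix.add_mulVec, Matrix.smul_mulVec,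
    Matrix.one_mulVec, Matrix.smul_mulVec]

theorem stdJ_mulVec {K : Type*} [Field K] (y₁ y₂ : Fin n → K) :
    stdJ n K *ᵥ Sum.elim y₁ y₂ = Sum.elim y₂ (-y₁) := by
  rw [stdJ, fromBlocks_mulVec]
  simp [Matrix.neg_mulVec]

/-- Positivity forces the sign of `ᵗvBv` on the eigenspaces of `ᵗA`. -/
theorem definiteWith_forcedSign {q : ℕ} (hq : (q : ℂ) ∈ O.nonunits) {γ : GL (Idx n) ℚ}
    {A B C' : Matrix (Fin n) (Fin n) ℚ} (hγ : γ.val = fromBlocks A B C' Aᵀ)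
    (hb : InversiveBlocks (q : ℚ) A B C') (hB : IsUnit B.det) {t : Finset ℝ}
    (ht : ∀ b ∈ t, b ^ 2 < q)
    (hA : aeval (A.map (Rat.castHom ℝ)) (∏ b ∈ t, (X - C b)) = 0) {P : ℚ[X]}
    (hP : IsPositiveImaginaryOn O (minpoly ℚ γ.val) P)
    (hpd : ((stdJ n ℚ * aeval γ.val P).map (Rat.castHom ℝ)).PosDef) :
    DefiniteWith (forcedSign O q) (A.map (Rat.castHom ℝ)) (B.map (Rat.castHom ℝ)) := by
  intro β v hv hβ
  have hb' := hb.map (Rat.castHom ℝ)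
  set A' := A.map (Rat.castHom ℝ)
  set B' := B.map (Rat.castHom ℝ) with hB'
  set C'' := C'.map (Rat.castHom ℝ)
  set G := γ.val.map (Rat.castHom ℝ) with hG
  have hGb : G = fromBlocks A' B' C'' A'ᵀ := by
    rw [hG, hγ, fromBlocks_map, Matrix.transpose_map]
  have hβq : β ^ 2 < q := by
    refine ht β ?_
    have h1 := aeval_mulVec_of_eigen hβ (∏ b ∈ t, (X - C b))
    rw [aeval_transpose, hA, Matrix.transpose_zero, Matrix.zero_mulVec] at h1
    have h2 := (smul_eq_zero.mp h1.symm).resolve_right hv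
    rw [eval_prod, Finset.prod_eq_zero_iff] at h2
    obtain ⟨b, hbt, hb0⟩ := h2
    rw [eval_sub, eval_X, eval_C, sub_eq_zero] at hb0
    rwa [hb0]
  set r := Real.sqrt (q - β ^ 2) with hr
  have hr0 : 0 < r := Real.sqrt_pos.mpr (sub_pos.mpr hβq)
  have hrr : r ^ 2 = q - β ^ 2 := Real.sq_sqrt (sub_pos.mpr hβq).le
  set z : ℂ := (β : ℂ) + r * Complex.I with hz
  have hzre : z.re = β := by simp [hz]
  have hzim : z.im = r := by simp [hz]
  have hznorm : ‖z‖ ^ 2 = (q : ℝ) := by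
    rw [← Complex.normSq_eq_norm_sq, Complex.normSq_apply, hzre, hzim]
    linarith
  -- The vectors x = (0, v) and Gx = (Bv, βv) span a plane stable under G, on which G satisfies the
  -- minimal polynomial of z = β + ir.
  set x : Idx n → ℝ := Sum.elim 0 v with hx
  have hGx : G *ᵥ x = Sum.elim (B' *ᵥ v) (β • v) := by
    rw [hGb, hx, fromBlocks_mulVec, hβ.symm]
    simp
  have hquad : G *ᵥ (G *ᵥ x) = (2 * z.re) • (G *ᵥ x) - (‖z‖ ^ 2) • x := by
    rw [hGx, hGb, fromBlocks_mulVec, hznorm, hzre]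
    have e1 : A' *ᵥ (B' *ᵥ v) = β • (B' *ᵥ v) := by
      rw [Matrix.mulVec_mulVec, hb'.AB, ← Matrix.mulVec_mulVec, hβ, Matrix.mulVec_smul]
    have e2 : C'' *ᵥ (B' *ᵥ v) = (β ^ 2 - q) • v := by
      rw [Matrix.mulVec_mulVec, hb'.CB, Matrix.sub_mulVec, pow_two, ← Matrix.mulVec_mulVec, hβ,
        Matrix.mulVec_smul, hβ, Matrix.smul_mulVec, Matrix.one_mulVec, smul_smul, sub_smul, pow_two]
      simp
    ext i
    rcases i with i | i
    · simp [hx, e1, Matrix.mulVec_smul]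
      ring
    · simp [hx, e2, Matrix.mulVec_smul, hβ]
      ring
  have hB0 : B' *ᵥ v ≠ 0 := by
    intro h0
    have hu : IsUnit B' := by
      rw [Matrix.isUnit_iff_isUnit_det, hB', ← RingHom.mapMatrix_apply, ← RingHom.map_det]
      exact hB.map _
    exact hv (Matrix.mulVec_injective_of_isUnit hu (by rw [h0, Matrix.mulVec_zero]))
  -- The coefficients solve f(z) = u + wz with u and w real: w = Im f(z)/r and u = Re f(z) − wβ.
  have hval : ∀ f : ℚ[X], aeval G (f.map (Rat.castHom ℝ)) *ᵥ x =
      ((aeval z f).re - (aeval z f).im / r * β) • x + ((aeval z f).im / r) • (G *ᵥ x) := by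
    intro f
    refine aeval_mulVec_of_quadratic (by rw [hzim]; exact hr0.ne') hquad _ ?_
    have e : aeval z (f.map (Rat.castHom ℝ)) = aeval z f := by
      rw [aeval_def, aeval_def, eval₂_map]
      congr 1
    rw [e]
    apply Complex.ext
    · simp [hzre]
    · simp [hzim, hr0.ne']
  have hroot : aeval z (minpoly ℚ γ.val) = 0 := by
    have h1 := hval (minpoly ℚ γ.val)
    rw [hG, aeval_map_matrix, minpoly.aeval, Matrix.map_zero _ (map_zero _), Matrix.zero_mulVec,
      ← hG, hGx, hx] at h1
    have h2 : ((aeval z (minpoly ℚ γ.val)).im / r) • (B' *ᵥ v) = 0 := by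
      ext i
      have := congrFun h1 (Sum.inl i)
      simpa using this.symm
    have h3 := (smul_eq_zero.mp h2).resolve_right hB0
    have h4 : (aeval z (minpoly ℚ γ.val)).re • v = 0 := by
      ext i
      have := congrFun h1 (Sum.inr i)
      rw [h3] at this
      simpa using this.symm
    apply Complex.ext
    · exact (smul_eq_zero.mp h4).resolve_right hv
    · exact (div_eq_zero_iff.mp h3).resolve_right hr0.ne'
  have hx0 : x ≠ 0 := by
    intro h0
    apply hv
    ext i
    exact congrFun h0 (Sum.inr i)
  have hpos := hpd.dotProduct_mulVec_pos hx0
  rw [star_trivial, Matrix.map_mul, map_stdJ, ← aeval_map_matrix, ← hG, ← Matrix.mulVec_mulVec,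
    hval, (hP z hroot).1, hGx] at hpos
  -- For purely imaginary P(z) the lower components cancel and P(G)x = (wBv, 0), where w = Im
  -- P(z)/r. The positive number ᵗxJP(G)x is therefore −w ᵗvBv.
  have hkey : 0 < -((aeval z P).im / r * (v ⬝ᵥ (B' *ᵥ v))) := by
    have e : (0 - (aeval z P).im / r * β) • x + ((aeval z P).im / r) •
        Sum.elim (B' *ᵥ v) (β • v) = Sum.elim (((aeval z P).im / r) • (B' *ᵥ v)) 0 := by
      ext i
      rcases i with i | i
      · simp [hx]
      · simp [hx]; ring
    rw [e, stdJ_mulVec, hx, sumElim_dotProduct_sumElim] at hpos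
    simpa using hpos
  have hconj : aeval ((starRingEnd ℂ) z) P = (starRingEnd ℂ) (aeval z P) :=
    Polynomial.aeval_algHom_apply ((Complex.conjAe.toAlgHom).restrictScalars ℚ) z P
  have hconj' : aeval ((starRingEnd ℂ) z) (minpoly ℚ γ.val) = 0 := by
    have := Polynomial.aeval_algHom_apply ((Complex.conjAe.toAlgHom).restrictScalars ℚ) z
      (minpoly ℚ γ.val)
    rw [hroot, map_zero] at this
    exact this
  unfold forcedSign
  rw [← hr, ← hz]
  -- If z has positive valuation then Im P(z) > 0 and the form is negative. Otherwise the conjugate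
  -- of z has positive valuation, so Im P(z) < 0 and the form is positive.
  split_ifs with hzO
  · have him := (hP z hroot).2 hzO
    have : 0 < (aeval z P).im / r := div_pos him hr0
    nlinarith
  · have him := (hP _ hconj').2 (conj_mem_nonunits hq hznorm hzO)
    rw [hconj, Complex.conj_im] at him
    have : (aeval z P).im / r < 0 := div_neg_of_neg_of_pos (by linarith) hr0
    nlinarith

end ForcedSign

end RealDeligne

namespace RealDeligne

open Polynomial

/-! ### Conjugation by `δ(lam, X)` over extension fields -/

section Conjugation

variable {n : ℕ} {K : Type*} [Field K]

theorem GL_val_mul_inv {m : Type*} [Fintype m] [DecidableEq m] (g : GL m K) :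
    g.val * (g⁻¹).val = 1 := by rw [← Units.val_mul, mul_inv_cancel, Units.val_one]

theorem GL_inv_mul_val {m : Type*} [Fintype m] [DecidableEq m] (g : GL m K) :
    (g⁻¹).val * g.val = 1 := by rw [← Units.val_mul, inv_mul_cancel, Units.val_one]

theorem deltaGL_mul (lam lam' : Kˣ) (X X' : GL (Fin n) K) :
    deltaGL lam X * deltaGL lam' X' = deltaGL (lam * lam') (X * X') := by
  ext1
  rw [Units.val_mul, deltaGL_val, deltaGL_val, deltaGL_val, delta, delta, delta,
    fromBlocks_multiply]
  simp [Matrix.transpose_mul, smul_smul, mul_comm]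

theorem deltaGL_inj_right {lam lam' : Kˣ} {X X' : GL (Fin n) K}
    (h : deltaGL lam X = deltaGL lam' X') : X = X' := by
  have h1 := congrArg Units.val h
  rw [deltaGL_val, deltaGL_val, delta, delta, fromBlocks_inj] at h1
  have h2 : (X⁻¹).val = (X'⁻¹).val := Matrix.transpose_injective h1.2.2.2
  exact inv_injective (Units.ext h2)

theorem ratMap_val {m : Type*} [Fintype m] [DecidableEq m] (K : Type*) [Field K] [CharZero K]
    (γ : GL m ℚ) : (ratMap K γ).val = γ.val.map (Rat.castHom K) := rfl

theorem map_fromBlocks_transpose {L : Type*} [Field L] (f : K →+* L)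
    (A B C : Matrix (Fin n) (Fin n) K) :
    (fromBlocks A B C Aᵀ).map f = fromBlocks (A.map f) (B.map f) (C.map f) (A.map f)ᵀ := by
  rw [fromBlocks_map, Matrix.transpose_map]

theorem isUnit_det_map {m : Type*} [Fintype m] [DecidableEq m] {L : Type*} [Field L]
    (f : K →+* L) {B : Matrix m m K} (h : IsUnit B.det) : IsUnit (B.map f).det := by
  rw [← RingHom.mapMatrix_apply, ← RingHom.map_det]
  exact h.map _

theorem map_matrix_injective {m : Type*} {L : Type*} [Field L] (f : K →+* L) :
    Function.Injective fun B : Matrix m m K => B.map f :=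
  Matrix.map_injective f.injective

theorem conjBy_iff {G : Type*} [Group G] {H : Subgroup G} {x y : G} :
    ConjBy H x y ↔ ∃ h ∈ H, h * x = y * h :=
  exists_congr fun _ => and_congr_right fun _ => mul_inv_eq_iff_eq_mul

theorem ConjBy.symm {G : Type*} [Group G] {H : Subgroup G} {x y : G} (h : ConjBy H x y) :
    ConjBy H y x := by
  obtain ⟨h, hh, e⟩ := h
  exact ⟨h⁻¹, inv_mem hh, by rw [← e]; group⟩

theorem ConjBy.trans {G : Type*} [Group G] {H : Subgroup G} {x y z : G} (h : ConjBy H x y)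
    (h' : ConjBy H y z) : ConjBy H x z := by
  obtain ⟨h, hh, e⟩ := h
  obtain ⟨k, hk, e'⟩ := h'
  exact ⟨k * h, mul_mem hk hh, by rw [← e', ← e]; group⟩

theorem ConjBy.ratMap (K : Type*) [Field K] [CharZero K] {γ γ' : GL (Idx n) ℚ}
    (h : ConjBy (GLstar n ℚ) γ γ') : ConjBy (GLstar n K) (ratMap K γ) (ratMap K γ') := by
  obtain ⟨h, hh, e⟩ := h
  exact ⟨RealDeligne.ratMap K h, map_mem_GLstar _ hh, by rw [← e, map_mul, map_mul, map_inv]⟩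

/-- Inversive elements are stable under conjugation by `GLₙ*`. -/
theorem IsInversive.conj {q : K} {γ γ' g : GL (Idx n) K} (h : IsInversive q γ)
    (hg : g ∈ GLstar n K) (e : g * γ = γ' * g) : IsInversive q γ' := by
  obtain ⟨⟨c, hc⟩, ht⟩ := hg
  have e' : g.val * γ.val = γ'.val * g.val := by rw [← Units.val_mul, e, Units.val_mul]
  have hgu : IsUnit g.val := g.isUnit
  have hgt : IsUnit (g.val)ᵀ := (Matrix.isUnit_transpose _).mpr hgu
  unfold HasMultiplier at hc
  constructor
  · refine hgu.mul_right_cancel (hgt.mul_left_cancel ?_)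
    calc (g.val)ᵀ * ((γ'.val)ᵀ * stdJ n K * γ'.val * g.val)
        = (γ'.val * g.val)ᵀ * stdJ n K * (γ'.val * g.val) := by
          rw [Matrix.transpose_mul]; simp only [Matrix.mul_assoc]
      _ = (γ.val)ᵀ * ((g.val)ᵀ * stdJ n K * g.val) * γ.val := by
          rw [← e', Matrix.transpose_mul]; simp only [Matrix.mul_assoc]
      _ = (c : K) • (q • stdJ n K) := by
          rw [hc, Matrix.mul_smul, Matrix.smul_mul, h.1]
      _ = (g.val)ᵀ * (q • stdJ n K * g.val) := by
          rw [Matrix.smul_mul, Matrix.mul_smul, ← Matrix.mul_assoc, hc, smul_comm]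
  · refine hgu.mul_right_cancel ?_
    calc tau0 n K * γ'.val * tau0 n K * γ'.val * g.val
        = tau0 n K * γ'.val * tau0 n K * (g.val * γ.val) := by
          rw [e']; simp only [Matrix.mul_assoc]
      _ = tau0 n K * γ'.val * (tau0 n K * g.val) * γ.val := by simp only [Matrix.mul_assoc]
      _ = tau0 n K * (γ'.val * g.val) * tau0 n K * γ.val := by
          rw [ht]; simp only [Matrix.mul_assoc]
      _ = (tau0 n K * g.val) * γ.val * tau0 n K * γ.val := by
          rw [← e']; simp only [Matrix.mul_assoc]
      _ = g.val * (tau0 n K * γ.val * tau0 n K * γ.val) := by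
          rw [ht]; simp only [Matrix.mul_assoc]
      _ = q • 1 * g.val := by rw [h.2, Matrix.mul_smul, Matrix.smul_mul, Matrix.mul_one,
          Matrix.one_mul]

theorem map_smul_matrix {m : Type*} {L : Type*} [Field L] (f : K →+* L) (c : K)
    (B : Matrix m m K) : (c • B).map f = f c • B.map f := by
  ext i j
  simp

variable [CharZero K]

/-- Conjugation by `δ(lam, X)` in terms of blocks. -/
theorem deltaGL_mul_ratMap_iff {q : ℚ} {γ γ' : GL (Idx n) ℚ}
    {A B C A' B' C' : Matrix (Fin n) (Fin n) ℚ}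
    (hγ : γ.val = fromBlocks A B C Aᵀ) (hγ' : γ'.val = fromBlocks A' B' C' A'ᵀ)
    (h : InversiveBlocks q A B C) (h' : InversiveBlocks q A' B' C') (hB' : IsUnit B'.det)
    (lam : Kˣ) (X : GL (Fin n) K) :
    deltaGL lam X * ratMap K γ = ratMap K γ' * deltaGL lam X ↔
      X.val * A.map (Rat.castHom K) = A'.map (Rat.castHom K) * X.val ∧
        (lam : K) • (X.val * B.map (Rat.castHom K) * (X.val)ᵀ) = B'.map (Rat.castHom K) := by
  rw [← delta_mul_eq_iff (h.map (Rat.castHom K)) (h'.map (Rat.castHom K))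
    (isUnit_det_map _ hB'), Units.ext_iff, Units.val_mul, Units.val_mul, deltaGL_val,
    ratMap_val, ratMap_val, hγ, hγ', map_fromBlocks_transpose, map_fromBlocks_transpose]

/-- `δ(lam, X) ↦ X` identifies `I₀` with `Z(A₀) ∩ GO(B₀)`. -/
theorem exists_I0_mulEquiv {q : ℚ} {γ₀ : GL (Idx n) ℚ} {A₀ B₀ C₀ : Matrix (Fin n) (Fin n) ℚ}
    (hγ₀ : γ₀.val = fromBlocks A₀ B₀ C₀ A₀ᵀ) (hb : InversiveBlocks q A₀ B₀ C₀)
    (hB : IsUnit B₀.det) :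
    ∃ e : I0 γ₀ K ≃* centralizerGO A₀ B₀ K, ∀ x : I0 γ₀ K,
      ∃ lam : Kˣ, x.1.val = delta lam (e x).1 := by
  have key : ∀ (lam : Kˣ) (X : GL (Fin n) K), deltaGL lam X ∈ I0 γ₀ K ↔
      X.val * A₀.map (Rat.castHom K) = A₀.map (Rat.castHom K) * X.val ∧
        (lam : K) • (X.val * B₀.map (Rat.castHom K) * (X.val)ᵀ) = B₀.map (Rat.castHom K) :=
    fun lam X => by
      rw [mem_I0_iff, deltaGL_mul_ratMap_iff hγ₀ hγ₀ hb hb hB]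
      exact and_iff_right (deltaGL_mem lam X)
  choose lam X hX using fun x : I0 γ₀ K => exists_eq_deltaGL (mem_I0_iff.mp x.2).1
  have hk := fun x => (key (lam x) (X x)).mp (hX x ▸ x.2)
  let φ : I0 γ₀ K →* centralizerGO A₀ B₀ K := MonoidHom.mk'
    -- Centralizing γ₀ means lam · XB₀ᵗX = B₀, so X multiplies B₀ by the inverse of the multiplier
    -- of δ(lam, X).
    (fun x => ⟨X x, (hk x).1, (lam x)⁻¹, by
      rw [← (hk x).2, smul_smul, Units.inv_mul, one_smul]
      conv_lhs => rw [(hk x).2]⟩)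
    (fun x y => Subtype.ext (deltaGL_inj_right (lam := lam (x * y)) (lam' := lam x * lam y) (by
      change deltaGL (lam (x * y)) (X (x * y)) = deltaGL (lam x * lam y) (X x * X y)
      rw [← deltaGL_mul, ← hX, ← hX, ← hX]
      rfl)))
  have hφ : Function.Bijective φ := by
    constructor
    -- The relation lam · XB₀ᵗX = B₀ determines the matrix lam · X from X. It is this product and
    -- not lam itself that is compared, so n = 0 needs no separate treatment.
    · intro x y hxy
      have hXY : X x = X y := congrArg Subtype.val hxy
      have h1 := (hk x).2.trans (hk y).2.symm
      rw [hXY] at h1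
      have hu : IsUnit (B₀.map (Rat.castHom K) * ((X y).val)ᵀ) := by
        rw [Matrix.isUnit_iff_isUnit_det, Matrix.det_mul, Matrix.det_transpose]
        exact (isUnit_det_map _ hB).mul ((Matrix.isUnit_iff_isUnit_det _).mp (X y).isUnit)
      rw [Matrix.mul_assoc, ← Matrix.smul_mul, ← Matrix.smul_mul] at h1
      have h2 := hu.mul_right_cancel h1
      refine Subtype.ext (Units.ext ?_)
      rw [hX x, hX y, deltaGL_val, deltaGL_val, delta, delta, hXY, h2]
    · rintro ⟨Y, hY, μ, hμ⟩
      have hm : deltaGL μ⁻¹ Y ∈ I0 γ₀ K := (key _ _).mpr ⟨hY, by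
        rw [hμ, smul_smul, Units.inv_mul, one_smul]⟩
      exact ⟨⟨_, hm⟩, Subtype.ext (deltaGL_inj_right (hX ⟨_, hm⟩).symm)⟩
  refine ⟨MulEquiv.ofBijective φ hφ, fun x => ⟨lam x, ?_⟩⟩
  rw [hX x]
  rfl

theorem isInversive_ratMap_iff {q : ℚ} {γ : GL (Idx n) ℚ} :
    IsInversive (q : K) (ratMap K γ) ↔ IsInversive q γ := by
  unfold IsInversive HasMultiplier
  rw [← (map_matrix_injective (Rat.castHom K)).eq_iff,
    ← (map_matrix_injective (Rat.castHom K)).eq_iff (b := q • 1)]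
  simp only [Matrix.map_mul, ratMap_val, map_smul_matrix, map_stdJ, map_tau0,
    ← Matrix.transpose_map, Matrix.map_one _ (map_zero (Rat.castHom K)) (map_one _)]
  rfl

/-- Matrices that are conjugate over an extension field have the same minimal polynomial. -/
theorem squarefree_minpoly_of_conj {m : Type*} [Fintype m] [DecidableEq m] {γ γ' : GL m ℚ}
    {g : GL m K} (e : g * ratMap K γ = ratMap K γ' * g) (h : Squarefree (minpoly ℚ γ.val)) :
    Squarefree (minpoly ℚ γ'.val) := by
  have e' : (ratMap K γ').val * g.val = g.val * (ratMap K γ).val := by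
    rw [← Units.val_mul, ← e, Units.val_mul]
  refine h.squarefree_of_dvd (minpoly.dvd ℚ _ ?_)
  have h1 := aeval_mul_eq_mul_aeval e' ((minpoly ℚ γ.val).map (Rat.castHom K))
  rw [ratMap_val, ratMap_val, aeval_map_matrix, aeval_map_matrix, minpoly.aeval,
    Matrix.map_zero _ (map_zero _), Matrix.mul_zero] at h1
  have h2 := g.isUnit.mul_right_cancel (h1.trans (Matrix.zero_mul g.val).symm)
  exact map_matrix_injective (Rat.castHom K) (h2.trans (Matrix.map_zero _ (map_zero _)).symm)

/-- Semisimplicity passes to γ' as squarefreeness of the rational minimal polynomial, which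
annihilates γ' as well; the inversive relations are stable under conjugation by `GLₙ*` over `K` and
can be read over ℚ. -/
theorem IsQInversive.of_conj {q : ℕ} {γ γ' : GL (Idx n) ℚ} (h : IsQInversive q γ)
    (hc : ConjBy (GLstar n K) (ratMap K γ) (ratMap K γ')) : IsQInversive q γ' := by
  obtain ⟨g, hg, e⟩ := conjBy_iff.mp hc
  rw [isQInversive_iff, isSemisimple_toLin'_iff] at h ⊢
  exact ⟨squarefree_minpoly_of_conj e h.1,
    isInversive_ratMap_iff.mp ((isInversive_ratMap_iff.mpr h.2).conj hg e)⟩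

/-- Over an extension field, conjugacy under `GLₙ*` can be made to fix the upper left block by
conjugation over `ℚ`. -/
theorem exists_conj_block_eq {q : ℚ} {γ₀ γ : GL (Idx n) ℚ} {A₀ B₀ C₀ : Matrix (Fin n) (Fin n) ℚ}
    (hγ₀ : γ₀.val = fromBlocks A₀ B₀ C₀ A₀ᵀ) (hγ : IsInversive q γ)
    (hc : ConjBy (GLstar n K) (ratMap K γ₀) (ratMap K γ)) :
    ∃ g ∈ GLstar n ℚ, ∃ γ' : GL (Idx n) ℚ, g * γ = γ' * g ∧ HasMultiplier g 1 ∧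
      ∃ B C, γ'.val = fromBlocks A₀ B C A₀ᵀ ∧ InversiveBlocks q A₀ B C := by
  obtain ⟨g, hg, e⟩ := conjBy_iff.mp hc
  obtain ⟨lam, X, rfl⟩ := exists_eq_deltaGL hg
  obtain ⟨A, B, C, hA, hb⟩ := exists_inversiveBlocks hγ
  have h1 : X.val * A₀.map (Rat.castHom K) = A.map (Rat.castHom K) * X.val := by
    have := congrArg Units.val e
    rw [Units.val_mul, Units.val_mul, ratMap_val, ratMap_val, hγ₀, hA, map_fromBlocks_transpose,
      map_fromBlocks_transpose, deltaGL_val, delta, fromBlocks_multiply, fromBlocks_multiply,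
      fromBlocks_inj] at this
    have h := this.1
    rw [Matrix.zero_mul, Matrix.mul_zero, add_zero, add_zero, Matrix.smul_mul,
      Matrix.mul_smul] at h
    exact smul_right_injective _ lam.ne_zero h
  -- The upper left blocks are similar over `K`, hence over ℚ; nothing is claimed about B and C.
  obtain ⟨Y, hY⟩ := exists_rat_similar (J := Unit) (fun _ => A₀) (fun _ => A) X fun _ => h1
  have hY := hY ()
  -- The scalar 1 gives `g` multiplier 1, so that it also acts on coordinates of a module without
  -- changing the polarization.
  let g := deltaGL (1 : ℚˣ) Y⁻¹
  have e₁ : g * γ = (g * γ * g⁻¹) * g := by group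
  have hg₁ : g ∈ GLstar n ℚ := deltaGL_mem _ _
  obtain ⟨A', B', C', hA', hb'⟩ := exists_inversiveBlocks (hγ.conj hg₁ e₁)
  have h2 : A' = A₀ := by
    have := congrArg Units.val e₁
    rw [Units.val_mul, Units.val_mul, hA, hA', deltaGL_val, delta, fromBlocks_multiply,
      fromBlocks_multiply, fromBlocks_inj] at this
    have h := this.1
    rw [Matrix.zero_mul, Matrix.mul_zero, add_zero, add_zero, Units.val_one, one_smul] at h
    refine (Y⁻¹).isUnit.mul_right_cancel ?_
    calc A' * (Y⁻¹).val = (Y⁻¹).val * A * (Y.val * (Y⁻¹).val) := by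
          rw [GL_val_mul_inv, Matrix.mul_one, h]
      _ = (Y⁻¹).val * (A * Y.val) * (Y⁻¹).val := by simp only [Matrix.mul_assoc]
      _ = ((Y⁻¹).val * Y.val) * A₀ * (Y⁻¹).val := by rw [← hY]; simp only [Matrix.mul_assoc]
      _ = _ := by rw [GL_inv_mul_val, Matrix.one_mul]
  subst h2
  exact ⟨g, hg₁, _, e₁, by simpa using hasMultiplier_deltaGL (1 : ℚˣ) Y⁻¹, B', C', hA', hb'⟩

end Conjugation

end RealDeligne

namespace RealDeligne

open Polynomial

/-! ### Normal forms with upper left block `A₀` -/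

section NormalForm

variable {n : ℕ}

theorem ratMap_val_eq_fromBlocks (K : Type*) [Field K] [CharZero K] {γ : GL (Idx n) ℚ}
    {A B C : Matrix (Fin n) (Fin n) ℚ} (hγ : γ.val = fromBlocks A B C Aᵀ) :
    (ratMap K γ).val = fromBlocks (A.map (Rat.castHom K)) (B.map (Rat.castHom K))
      (C.map (Rat.castHom K)) (A.map (Rat.castHom K))ᵀ := by
  rw [ratMap_val, hγ, map_fromBlocks_transpose]

/-- The data of an inversive element whose block `B` is definite, with prescribed sign `s`, on
the eigenspaces of `ᵗA`. -/
structure DefiniteBlocks (s : ℝ → ℝ) (q : ℕ) (γ : GL (Idx n) ℚ)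
    (A B C : Matrix (Fin n) (Fin n) ℚ) : Prop where
  sign : ∀ β, s β = 1 ∨ s β = -1
  val_eq : γ.val = fromBlocks A B C Aᵀ
  blocks : InversiveBlocks (q : ℚ) A B C
  squarefree : Squarefree (minpoly ℚ γ.val)
  exists_finset : ∃ t : Finset ℝ, (∀ b ∈ t, b ^ 2 < q) ∧
    aeval (A.map (Rat.castHom ℝ)) (∏ b ∈ t, (X - Polynomial.C b)) = 0
  definite : DefiniteWith s (A.map (Rat.castHom ℝ)) (B.map (Rat.castHom ℝ))

/-- `γ` is `GLₙ*(ℚ)`-conjugate to an element with upper left block `A₀` and definite block `B`. -/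
def HasNormalForm (s : ℝ → ℝ) (q : ℕ) (A₀ : Matrix (Fin n) (Fin n) ℚ) (γ : GL (Idx n) ℚ) : Prop :=
  ∃ γ' : GL (Idx n) ℚ, ConjBy (GLstar n ℚ) γ' γ ∧ ∃ B C, γ'.val = fromBlocks A₀ B C A₀ᵀ ∧
    InversiveBlocks (q : ℚ) A₀ B C ∧
    DefiniteWith s (A₀.map (Rat.castHom ℝ)) (B.map (Rat.castHom ℝ))

variable {s : ℝ → ℝ} {q : ℕ} {γ₀ : GL (Idx n) ℚ} {A₀ B₀ C₀ : Matrix (Fin n) (Fin n) ℚ}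

theorem DefiniteBlocks.isUnit_det_of_blocks (D : DefiniteBlocks s q γ₀ A₀ B₀ C₀)
    {B C : Matrix (Fin n) (Fin n) ℚ} (hb : InversiveBlocks (q : ℚ) A₀ B C) : IsUnit B.det := by
  obtain ⟨t, ht, hA⟩ := D.exists_finset
  have := isUnit_det_sq_sub ht hA
  rw [← hb.BC, Matrix.det_mul] at this
  exact isUnit_of_mul_isUnit_left this

theorem DefiniteBlocks.isUnit_det (D : DefiniteBlocks s q γ₀ A₀ B₀ C₀) : IsUnit B₀.det :=
  D.isUnit_det_of_blocks D.blocks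

/-- B and B₀ are definite with the same sign on each eigenspace of ᵗA₀, so their quotient behaves
like a quotient of positive definite forms. Both the real and the algebraically closed conjugacy
statements are drawn from this. -/
theorem DefiniteBlocks.exists_squares (D : DefiniteBlocks s q γ₀ A₀ B₀ C₀)
    {B : Matrix (Fin n) (Fin n) ℚ} (hB : B.IsSymm) (hAB : A₀ * B = B * A₀ᵀ)
    (hdef : DefiniteWith s (A₀.map (Rat.castHom ℝ)) (B.map (Rat.castHom ℝ))) :
    ∃ u : Finset ℝ, (∀ x ∈ u, 0 < x) ∧
      aeval ((B * B₀⁻¹).map (Rat.castHom ℝ)) (∏ x ∈ u, (X - Polynomial.C x)) = 0 := by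
  obtain ⟨t, -, hA⟩ := D.exists_finset
  have hs1 : ∀ β, s β * s β = 1 := fun β => by rcases D.sign β with h | h <;> rw [h] <;> norm_num
  have e : ∀ M : Matrix (Fin n) (Fin n) ℚ, A₀ * M = M * A₀ᵀ →
      A₀.map (Rat.castHom ℝ) * M.map (Rat.castHom ℝ) =
        M.map (Rat.castHom ℝ) * (A₀.map (Rat.castHom ℝ))ᵀ := fun M h => by
    rw [← Matrix.transpose_map, ← Matrix.map_mul, h, Matrix.map_mul]
  have hsy : ∀ {M : Matrix (Fin n) (Fin n) ℚ}, M.IsSymm → (M.map (Rat.castHom ℝ)).IsSymm :=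
    fun h => by rw [Matrix.IsSymm, ← Matrix.transpose_map, h.eq]
  obtain ⟨u, hu, h⟩ := exists_finset_of_definiteWith hs1 (hsy hB) (hsy D.blocks.symm_B)
    (e B hAB) (e B₀ D.blocks.AB) hA hdef D.definite
  refine ⟨u, hu, ?_⟩
  have hinv : B₀⁻¹.map (Rat.castHom ℝ) = (B₀.map (Rat.castHom ℝ))⁻¹ := by
    refine (Matrix.inv_eq_right_inv ?_).symm
    rw [← Matrix.map_mul, Matrix.mul_nonsing_inv _ D.isUnit_det,
      Matrix.map_one _ (map_zero _) (map_one _)]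
  rwa [Matrix.map_mul, hinv]

/-- `S = B B₀⁻¹` has a square root over `K` if it is diagonalizable over `K` with squares as
eigenvalues. -/
theorem DefiniteBlocks.conjBy_of_squares (D : DefiniteBlocks s q γ₀ A₀ B₀ C₀)
    {K : Type*} [Field K] [CharZero K] {γ : GL (Idx n) ℚ} {B C : Matrix (Fin n) (Fin n) ℚ}
    (hγ : γ.val = fromBlocks A₀ B C A₀ᵀ) (hb : InversiveBlocks (q : ℚ) A₀ B C) {u : Finset K}
    (hu : ∀ x ∈ u, IsSquare x)
    (h : aeval ((B * B₀⁻¹).map (Rat.castHom K)) (∏ x ∈ u, (X - Polynomial.C x)) = 0) :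
    ∃ Y : GL (Fin n) K, deltaGL 1 Y * ratMap K γ₀ = ratMap K γ * deltaGL 1 Y := by
  have hB := D.isUnit_det_of_blocks hb
  have hbK := hb.map (Rat.castHom K)
  have hbK₀ := D.blocks.map (Rat.castHom K)
  have hinv : B₀⁻¹.map (Rat.castHom K) = (B₀.map (Rat.castHom K))⁻¹ := by
    refine (Matrix.inv_eq_right_inv ?_).symm
    rw [← Matrix.map_mul, Matrix.mul_nonsing_inv _ D.isUnit_det,
      Matrix.map_one _ (map_zero _) (map_one _)]
  rw [Matrix.map_mul, hinv] at h
  obtain ⟨Y, hY, hYB⟩ := exists_congr_of_diagonalizable hbK.symm_B hbK₀.symm_B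
    (isUnit_det_map _ hB) (isUnit_det_map _ D.isUnit_det) hbK.AB hbK₀.AB u h hu
  refine ⟨Y, (deltaGL_mul_ratMap_iff D.val_eq hγ D.blocks hb hB 1 Y).mpr ⟨hY, ?_⟩⟩
  rw [Units.val_one, one_smul, hYB]

theorem DefiniteBlocks.exists_real_conj (D : DefiniteBlocks s q γ₀ A₀ B₀ C₀)
    {γ : GL (Idx n) ℚ} {B C : Matrix (Fin n) (Fin n) ℚ}
    (hγ : γ.val = fromBlocks A₀ B C A₀ᵀ) (hb : InversiveBlocks (q : ℚ) A₀ B C)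
    (hdef : DefiniteWith s (A₀.map (Rat.castHom ℝ)) (B.map (Rat.castHom ℝ))) :
    ∃ Y : GL (Fin n) ℝ, deltaGL 1 Y * ratMap ℝ γ₀ = ratMap ℝ γ * deltaGL 1 Y := by
  obtain ⟨u, hu, h⟩ := D.exists_squares hb.symm_B hb.AB hdef
  exact D.conjBy_of_squares hγ hb (fun x hx => ⟨√x, (Real.mul_self_sqrt (hu x hx).le).symm⟩) h

/-- Diagonalizability of S = BB₀⁻¹ over ℝ makes its rational minimal polynomial squarefree, a fact
independent of ℝ. Over an algebraically closed `K` this polynomial splits with distinct roots, and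
all of them are squares. -/
theorem DefiniteBlocks.exists_conj (D : DefiniteBlocks s q γ₀ A₀ B₀ C₀)
    (K : Type*) [Field K] [CharZero K] [IsAlgClosed K]
    {γ : GL (Idx n) ℚ} {B C : Matrix (Fin n) (Fin n) ℚ}
    (hγ : γ.val = fromBlocks A₀ B C A₀ᵀ) (hb : InversiveBlocks (q : ℚ) A₀ B C)
    (hdef : DefiniteWith s (A₀.map (Rat.castHom ℝ)) (B.map (Rat.castHom ℝ))) :
    ∃ Y : GL (Fin n) K, deltaGL 1 Y * ratMap K γ₀ = ratMap K γ * deltaGL 1 Y := by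
  obtain ⟨u, -, h⟩ := D.exists_squares hb.symm_B hb.AB hdef
  have hsq := squarefree_minpoly_of_aeval_map_eq_zero (squarefree_prod_X_sub_C u) h
  obtain ⟨v, -, P, hP⟩ := exists_finset_map_dvd_prod (K := K) hsq
  refine D.conjBy_of_squares hγ hb (u := v) (fun x _ => IsAlgClosed.exists_eq_mul_self x) ?_
  rw [hP, map_mul, aeval_map_matrix, minpoly.aeval, Matrix.map_zero _ (map_zero _),
    Matrix.zero_mul]

theorem DefiniteBlocks.isQInversive (D : DefiniteBlocks s q γ₀ A₀ B₀ C₀) : IsQInversive q γ₀ := by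
  rw [isQInversive_iff, isSemisimple_toLin'_iff]
  exact ⟨D.squarefree, (isInversive_iff_blocks D.val_eq).mpr ⟨rfl, D.blocks⟩⟩

theorem DefiniteBlocks.conjBy_real (D : DefiniteBlocks s q γ₀ A₀ B₀ C₀)
    {γ : GL (Idx n) ℚ} (h : HasNormalForm s q A₀ γ) :
    ConjBy (GLstar n ℝ) (ratMap ℝ γ₀) (ratMap ℝ γ) := by
  obtain ⟨γ', hc, B, C, hγ', hb, hdef⟩ := h
  obtain ⟨Y, hY⟩ := D.exists_real_conj hγ' hb hdef
  exact (conjBy_iff.mpr ⟨_, deltaGL_mem _ _, hY⟩ : ConjBy (GLstar n ℝ) _ _).trans (hc.ratMap ℝ)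

theorem DefiniteBlocks.conjBy_algClosed (D : DefiniteBlocks s q γ₀ A₀ B₀ C₀)
    (K : Type*) [Field K] [CharZero K] [IsAlgClosed K]
    {γ : GL (Idx n) ℚ} (h : HasNormalForm s q A₀ γ) :
    ConjBy (GLstar n K) (ratMap K γ₀) (ratMap K γ) := by
  obtain ⟨γ', hc, B, C, hγ', hb, hdef⟩ := h
  obtain ⟨Y, hY⟩ := D.exists_conj K hγ' hb hdef
  exact (conjBy_iff.mpr ⟨_, deltaGL_mem _ _, hY⟩ : ConjBy (GLstar n K) _ _).trans (hc.ratMap K)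

theorem DefiniteBlocks.mem_setReal (D : DefiniteBlocks s q γ₀ A₀ B₀ C₀)
    {γ : GL (Idx n) ℚ} (h : HasNormalForm s q A₀ γ) :
    γ ∈ setReal q γ₀ :=
  ⟨D.isQInversive.of_conj (D.conjBy_real h), D.conjBy_real h⟩

theorem IsInversive.sum_eq {K : Type*} [Field K] {γ : GL (Idx n) K}
    {A B C : Matrix (Fin n) (Fin n) K} (hγ : γ.val = fromBlocks A B C Aᵀ) :
    γ.val + tau0 n K * γ.val * tau0 n K = (2 : K) • fromBlocks A 0 0 Aᵀ := by
  rw [hγ, tau0, fromBlocks_multiply, fromBlocks_multiply, fromBlocks_add, fromBlocks_smul]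
  simp [two_smul]

/-- A matrix conjugating inversive elements conjugates their `γ + q γ⁻¹`. -/
theorem IsInversive.mul_diag_eq {K : Type*} [Field K] [CharZero K] {k : K} {γ γ' g : GL (Idx n) K}
    {A B C A' B' C' : Matrix (Fin n) (Fin n) K} (h : IsInversive k γ) (h' : IsInversive k γ')
    (hγ : γ.val = fromBlocks A B C Aᵀ) (hγ' : γ'.val = fromBlocks A' B' C' A'ᵀ)
    (e : g * γ = γ' * g) :
    g.val * fromBlocks A 0 0 Aᵀ = fromBlocks A' 0 0 A'ᵀ * g.val := by
  have e' : g.val * γ.val = γ'.val * g.val := by rw [← Units.val_mul, e, Units.val_mul]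
  have h1 : g.val * (tau0 n K * γ.val * tau0 n K) = tau0 n K * γ'.val * tau0 n K * g.val := by
    refine γ.isUnit.mul_right_cancel ?_
    calc g.val * (tau0 n K * γ.val * tau0 n K) * γ.val
        = g.val * (tau0 n K * γ.val * tau0 n K * γ.val) := by rw [Matrix.mul_assoc]
      _ = (tau0 n K * γ'.val * tau0 n K * γ'.val) * g.val := by
          rw [h.2, h'.2, Matrix.mul_smul, Matrix.smul_mul, Matrix.mul_one, Matrix.one_mul]
      _ = _ := by rw [Matrix.mul_assoc _ γ'.val, ← e', ← Matrix.mul_assoc]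
  have h2 : g.val * ((2 : K) • fromBlocks A 0 0 Aᵀ) =
      ((2 : K) • fromBlocks A' 0 0 A'ᵀ) * g.val := by
    rw [← IsInversive.sum_eq hγ, ← IsInversive.sum_eq hγ', Matrix.mul_add, Matrix.add_mul, e', h1]
  rw [Matrix.mul_smul, Matrix.smul_mul] at h2
  exact smul_right_injective _ (two_ne_zero' K) h2

theorem dotProduct_stdJ_mulVec {K : Type*} [Field K] {A B C : Matrix (Fin n) (Fin n) K}
    (y₁ y₂ : Fin n → K) :
    Sum.elim y₁ y₂ ⬝ᵥ (stdJ n K *ᵥ (fromBlocks A B C Aᵀ *ᵥ Sum.elim y₁ y₂)) =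
      y₁ ⬝ᵥ (C *ᵥ y₁) - y₂ ⬝ᵥ (B *ᵥ y₂) := by
  rw [fromBlocks_mulVec, stdJ_mulVec, sumElim_dotProduct_sumElim]
  simp only [Sum.elim_comp_inl, Sum.elim_comp_inr, dotProduct_add, dotProduct_neg]
  have : y₁ ⬝ᵥ (Aᵀ *ᵥ y₂) = y₂ ⬝ᵥ (A *ᵥ y₁) := by
    rw [Matrix.mulVec_transpose, dotProduct_comm, Matrix.dotProduct_mulVec]
  rw [this]
  ring

/-- The form `ᵗvBv` is multiplied by the multiplier under conjugation by `GSp`. -/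
theorem DefiniteBlocks.exists_sign (D : DefiniteBlocks s q γ₀ A₀ B₀ C₀)
    {γ : GL (Idx n) ℚ} {B C : Matrix (Fin n) (Fin n) ℚ}
    (hγ : γ.val = fromBlocks A₀ B C A₀ᵀ) (hb : InversiveBlocks (q : ℚ) A₀ B C)
    (hc : ConjBy (GSp n ℝ) (ratMap ℝ γ₀) (ratMap ℝ γ)) :
    ∃ c : ℝ, c ≠ 0 ∧ ∀ (β : ℝ) (v : Fin n → ℝ), v ≠ 0 →
      (A₀.map (Rat.castHom ℝ))ᵀ *ᵥ v = β • v →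
        0 < s β * (c * (v ⬝ᵥ (B.map (Rat.castHom ℝ) *ᵥ v))) := by
  obtain ⟨g, ⟨c, hm⟩, e⟩ := conjBy_iff.mp hc
  refine ⟨c, c.ne_zero, fun β v hv hβ => ?_⟩
  have hval₀ := ratMap_val_eq_fromBlocks ℝ D.val_eq
  have hval := ratMap_val_eq_fromBlocks ℝ hγ
  have hi₀ : IsInversive (((q : ℚ) : ℝ)) (ratMap ℝ γ₀) :=
    isInversive_ratMap_iff.mpr ((isInversive_iff_blocks D.val_eq).mpr ⟨rfl, D.blocks⟩)
  have hi : IsInversive (((q : ℚ) : ℝ)) (ratMap ℝ γ) :=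
    isInversive_ratMap_iff.mpr ((isInversive_iff_blocks hγ).mpr ⟨rfl, hb⟩)
  -- `g` need not commute with τ₀, but it intertwines the elements γ + qγ⁻¹, which are twice the
  -- block diagonal matrices. So it matches the β-eigenspaces of diag(A₀, ᵗA₀).
  have hdiag := IsInversive.mul_diag_eq hi₀ hi hval₀ hval e
  have hb₀ := D.blocks.map (Rat.castHom ℝ)
  have hdef := D.definite
  have hBu := isUnit_det_map (Rat.castHom ℝ) D.isUnit_det
  obtain ⟨t, ht, hA⟩ := D.exists_finset
  set A' := A₀.map (Rat.castHom ℝ)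
  set B' := B.map (Rat.castHom ℝ)
  set B₀' := B₀.map (Rat.castHom ℝ)
  set C₀' := C₀.map (Rat.castHom ℝ)
  have hβq : β ^ 2 < q := by
    refine ht β ?_
    have h1 := aeval_mulVec_of_eigen hβ (∏ b ∈ t, (X - Polynomial.C b))
    rw [aeval_transpose, hA, Matrix.transpose_zero, Matrix.zero_mulVec] at h1
    have h2 := (smul_eq_zero.mp h1.symm).resolve_right hv
    rw [eval_prod, Finset.prod_eq_zero_iff] at h2
    obtain ⟨b, hbt, hb0⟩ := h2
    rw [eval_sub, eval_X, eval_C, sub_eq_zero] at hb0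
    rwa [hb0]
  set x : Idx n → ℝ := Sum.elim 0 v with hx
  obtain ⟨y₁, y₂, hy⟩ : ∃ y₁ y₂, g.val *ᵥ Sum.elim y₁ y₂ = x :=
    ⟨_, _, by rw [Sum.elim_comp_inl_inr ((g⁻¹).val *ᵥ x), Matrix.mulVec_mulVec, GL_val_mul_inv,
      Matrix.one_mulVec]⟩
  have hginj : Function.Injective (g.val *ᵥ ·) := Matrix.mulVec_injective_of_isUnit g.isUnit
  have hyβ : fromBlocks A' 0 0 A'ᵀ *ᵥ Sum.elim y₁ y₂ = β • Sum.elim y₁ y₂ := by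
    apply hginj
    change g.val *ᵥ _ = g.val *ᵥ _
    rw [Matrix.mulVec_mulVec, hdiag, ← Matrix.mulVec_mulVec, hy, Matrix.mulVec_smul, hy, hx,
      fromBlocks_mulVec]
    ext i
    rcases i with i | i
    · simp
    · simp [hβ]
  have hy₁ : A' *ᵥ y₁ = β • y₁ := by
    ext i
    have := congrFun hyβ (Sum.inl i)
    simpa [fromBlocks_mulVec] using this
  have hy₂ : A'ᵀ *ᵥ y₂ = β • y₂ := by
    ext i
    have := congrFun hyβ (Sum.inr i)
    simpa [fromBlocks_mulVec] using this
  have hBinj : Function.Injective (B₀' *ᵥ ·) :=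
    Matrix.mulVec_injective_of_isUnit ((Matrix.isUnit_iff_isUnit_det _).mpr hBu)
  -- B₀ carries the β-eigenspace of ᵗA₀ onto that of A₀. Writing y₁ = B₀w replaces ᵗy₁C₀y₁ by (β² −
  -- q) ᵗwB₀w.
  obtain ⟨w, rfl⟩ : ∃ w, B₀' *ᵥ w = y₁ := ⟨B₀'⁻¹ *ᵥ y₁, by
    rw [Matrix.mulVec_mulVec, Matrix.mul_nonsing_inv _ hBu, Matrix.one_mulVec]⟩
  have hw : A'ᵀ *ᵥ w = β • w := by
    apply hBinj
    change B₀' *ᵥ _ = B₀' *ᵥ _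
    rw [Matrix.mulVec_mulVec, ← hb₀.AB, ← Matrix.mulVec_mulVec, hy₁, Matrix.mulVec_smul]
  have hCB : C₀' *ᵥ (B₀' *ᵥ w) = (β ^ 2 - q) • w := by
    rw [Matrix.mulVec_mulVec, hb₀.CB, Matrix.sub_mulVec, pow_two, ← Matrix.mulVec_mulVec, hw,
      Matrix.mulVec_smul, hw, Matrix.smul_mulVec, Matrix.one_mulVec, smul_smul, sub_smul, pow_two]
    simp
  have hform : x ⬝ᵥ (stdJ n ℝ *ᵥ ((ratMap ℝ γ).val *ᵥ x)) =
      c * (Sum.elim (B₀' *ᵥ w) y₂ ⬝ᵥ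
        (stdJ n ℝ *ᵥ ((ratMap ℝ γ₀).val *ᵥ Sum.elim (B₀' *ᵥ w) y₂))) := by
    have e' : (ratMap ℝ γ).val * g.val = g.val * (ratMap ℝ γ₀).val := by
      rw [← Units.val_mul, ← e, Units.val_mul]
    unfold HasMultiplier at hm
    rw [← hy, Matrix.mulVec_mulVec (M := (ratMap ℝ γ).val), e', Matrix.mulVec_mulVec,
      ← Matrix.mul_assoc,
      ← Matrix.vecMul_transpose, ← Matrix.dotProduct_mulVec, Matrix.mulVec_mulVec,
      ← Matrix.mul_assoc, ← Matrix.mul_assoc, hm, Matrix.smul_mul, Matrix.smul_mulVec,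
      dotProduct_smul, smul_eq_mul, ← Matrix.mulVec_mulVec]
  rw [hval, hval₀, hx, dotProduct_stdJ_mulVec, dotProduct_stdJ_mulVec, hCB, zero_dotProduct,
    dotProduct_smul, smul_eq_mul, dotProduct_comm (B₀' *ᵥ w) w] at hform
  -- On the β-eigenspace of diag(A₀, ᵗA₀) the form ᵗyJγ₀y equals (β² − q) ᵗwB₀w − ᵗy₂B₀y₂, and both
  -- terms have sign −s(β). The form for γ at (0, v) is −ᵗvBv, and it is c times this.
  have hkey : s β * (c * (v ⬝ᵥ (B' *ᵥ v))) = (c : ℝ) ^ 2 *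
      ((q - β ^ 2) * (s β * (w ⬝ᵥ (B₀' *ᵥ w))) + s β * (y₂ ⬝ᵥ (B₀' *ᵥ y₂))) := by
    linear_combination -(s β * c) * hform
  rw [hkey]
  refine mul_pos (by have := c.ne_zero; positivity) ?_
  have hq0 : 0 < q - β ^ 2 := sub_pos.mpr hβq
  by_cases hw0 : w = 0
  · have hy0 : y₂ ≠ 0 := by
      rintro rfl
      rw [hw0, Matrix.mulVec_zero] at hy
      apply hv
      ext i
      have := congrFun hy (Sum.inr i)
      rw [show Sum.elim (0 : Fin n → ℝ) (0 : Fin n → ℝ) = 0 by ext j; rcases j <;> rfl,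
        Matrix.mulVec_zero] at this
      exact this.symm
    rw [hw0, zero_dotProduct, mul_zero, mul_zero, zero_add]
    exact hdef β _ hy0 hy₂
  · have h1 := mul_pos hq0 (hdef β w hw0 hw)
    by_cases hy0 : y₂ = 0
    · rw [hy0, zero_dotProduct, mul_zero, add_zero]
      exact h1
    · exact add_pos h1 (hdef β _ hy0 hy₂)

/-- Conjugacy to `γ₀` under `GSp(ℝ)` and under `GLₙ*` over some extension field gives the normal
form. -/
theorem DefiniteBlocks.hasNormalForm (D : DefiniteBlocks s q γ₀ A₀ B₀ C₀)
    {K : Type*} [Field K] [CharZero K] {γ : GL (Idx n) ℚ} (hq : IsQInversive q γ)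
    (h : ConjBy (GLstar n K) (ratMap K γ₀) (ratMap K γ))
    (hc : ConjBy (GSp n ℝ) (ratMap ℝ γ₀) (ratMap ℝ γ)) : HasNormalForm s q A₀ γ := by
  obtain ⟨g, hg, γ', e, -, B, C, hγ', hb⟩ :=
    exists_conj_block_eq D.val_eq (isQInversive_iff.mp hq).2 h
  have hγγ' : ConjBy (GLstar n ℚ) γ γ' := conjBy_iff.mpr ⟨g, hg, e⟩
  have hc' : ConjBy (GSp n ℝ) (ratMap ℝ γ₀) (ratMap ℝ γ') := by
    obtain ⟨k, hk, e'⟩ := hγγ'.ratMap ℝ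
    exact hc.trans ⟨k, hk.1, e'⟩
  obtain ⟨c, hc0, hdef⟩ := D.exists_sign hγ' hb hc'
  -- ε is the sign of the multiplier c, the same for all β. Conjugation by δ(ε, 1) is rational,
  -- fixes A₀ and replaces B by εB, which restores the prescribed signs.
  obtain ⟨ε, hε⟩ : ∃ ε : ℚˣ, ∀ x y : ℝ, 0 < x * (c * y) → 0 < x * ((ε : ℚ) * y) := by
    rcases lt_or_gt_of_ne hc0 with h0 | h0
    · refine ⟨-1, fun x y h => ?_⟩
      have : 0 < (-c) * (x * (((-1 : ℚˣ) : ℚ) * y)) := by push_cast; linarith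
      exact pos_of_mul_pos_right this (neg_pos.mpr h0).le
    · refine ⟨1, fun x y h => ?_⟩
      have : 0 < c * (x * (((1 : ℚˣ) : ℚ) * y)) := by push_cast; linarith
      exact pos_of_mul_pos_right this h0.le
  have hgε : deltaGL ε (1 : GL (Fin n) ℚ) ∈ GLstar n ℚ := deltaGL_mem _ _
  have e₂ : deltaGL ε 1 * γ' = (deltaGL ε 1 * γ' * (deltaGL ε 1)⁻¹) * deltaGL ε 1 := by group
  set γ'' := deltaGL ε 1 * γ' * (deltaGL ε 1)⁻¹ with hγ''
  have hi : IsInversive (q : ℚ) γ'' :=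
    ((isInversive_iff_blocks hγ').mpr ⟨rfl, hb⟩).conj hgε e₂
  obtain ⟨A'', B'', C'', hA'', hb''⟩ := exists_inversiveBlocks hi
  have e₃ := congrArg Units.val e₂
  rw [Units.val_mul, Units.val_mul, hγ', hA'', deltaGL_val, delta, fromBlocks_multiply,
    fromBlocks_multiply, fromBlocks_inj] at e₃
  simp only [inv_one, Units.val_one, Matrix.transpose_one, Matrix.mul_one, Matrix.one_mul,
    Matrix.zero_mul, Matrix.mul_zero, add_zero, zero_add, Matrix.smul_mul, Matrix.mul_smul] at e₃
  have hAA : A₀ = A'' := smul_right_injective _ ε.ne_zero e₃.1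
  subst hAA
  refine ⟨γ'', (hγγ'.trans (conjBy_iff.mpr ⟨_, hgε, e₂⟩)).symm, B'', C'', hA'', hb'',
    fun β v hv hβ => ?_⟩
  rw [← e₃.2.1, map_smul_matrix, Matrix.smul_mulVec, dotProduct_smul]
  exact hε _ _ (hdef β v hv hβ)

theorem DefiniteBlocks.mem_setReal_iff (D : DefiniteBlocks s q γ₀ A₀ B₀ C₀) {γ : GL (Idx n) ℚ} :
    γ ∈ setReal q γ₀ ↔ HasNormalForm s q A₀ γ := by
  refine ⟨fun ⟨hq, h⟩ => D.hasNormalForm hq h ?_, D.mem_setReal⟩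
  obtain ⟨g, hg, e⟩ := h
  exact ⟨g, hg.1, e⟩

/-- Each description yields the normal form, since `GLₙ*(ℝ)` lies in GSp(ℝ). The normal form in turn
gives conjugacy both over ℝ and over ℚ̄, because the needed square roots exist over both fields. -/
theorem DefiniteBlocks.setQBarReal_eq (D : DefiniteBlocks s q γ₀ A₀ B₀ C₀) :
    setQBarReal q γ₀ = setReal q γ₀ := by
  have : IsAlgClosed QBar := IsAlgClosure.isAlgClosed ℚ
  ext γ
  constructor
  · rintro ⟨hq, h, hc⟩
    exact D.mem_setReal (D.hasNormalForm hq h hc)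
  · intro h
    obtain ⟨g, hg, e⟩ := h.2
    exact ⟨h.1, D.conjBy_algClosed QBar (D.mem_setReal_iff.mp h), g, hg.1, e⟩

end NormalForm

end RealDeligne

namespace RealDeligne

open Polynomial

/-! ### Construction of modules from coordinates -/

section Bijections

variable {p a n : ℕ} [Fact p.Prime] {O : ValuationSubring ℂ}

/-- The coordinates of a real polarized Deligne module give definite blocks. -/
theorem IsCoordinates.definiteBlocks (hp : (p : ℂ) ∈ O.nonunits) (ha : 0 < a)
    {M : RealPolarizedModule p a n O} {γ : GL (Idx n) ℚ} {ψ : M.T →ₗ[ℤ] (Idx n → ℚ)}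
    (h : IsCoordinates M γ ψ) {A B C : Matrix (Fin n) (Fin n) ℚ}
    (hγ : γ.val = fromBlocks A B C Aᵀ) :
    DefiniteBlocks (forcedSign O (p ^ a)) (p ^ a) γ A B C := by
  have hi := h.isQInversive
  rw [isQInversive_iff, isSemisimple_toLin'_iff, isInversive_iff_blocks hγ] at hi
  obtain ⟨hss, -, hb⟩ := hi
  have hq : ((p ^ a : ℕ) : ℂ) ∈ O.nonunits := by
    rw [ValuationSubring.mem_nonunits_iff] at hp ⊢
    rw [Nat.cast_pow, map_pow]
    exact pow_lt_one₀ zero_le hp ha.ne'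
  obtain ⟨t, ht, hA⟩ := exists_finset_aeval_eq_zero hγ hb hss fun z hz => h.root ha hz
  have hB : IsUnit B.det := by
    have := isUnit_det_sq_sub ht hA
    rw [← hb.BC, Matrix.det_mul] at this
    exact isUnit_of_mul_isUnit_left this
  obtain ⟨P, -, hP, hpd⟩ := h.exists_positive
  exact ⟨forcedSign_eq O _, hγ, hb, hss, ⟨t, ht, hA⟩,
    definiteWith_forcedSign hq hγ hb hB ht hA hP hpd⟩

theorem mulVec_dotProduct_mulVec_mulVec {K m : Type*} [Field K] [Fintype m]
    (g H : Matrix m m K) (u v : m → K) :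
    (g *ᵥ u) ⬝ᵥ (H *ᵥ (g *ᵥ v)) = u ⬝ᵥ ((gᵀ * H * g) *ᵥ v) := by
  rw [← Matrix.vecMul_transpose, ← Matrix.dotProduct_mulVec, Matrix.mulVec_mulVec,
    Matrix.mulVec_mulVec]

/-- Multiplication by a matrix, as a map of abelian groups. -/
def mulVecInt (g : Matrix (Idx n) (Idx n) ℚ) : (Idx n → ℚ) →ₗ[ℤ] (Idx n → ℚ) :=
  (Matrix.toLin' g).restrictScalars ℤ

@[simp] theorem mulVecInt_apply (g : Matrix (Idx n) (Idx n) ℚ) (v : Idx n → ℚ) :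
    mulVecInt g v = g *ᵥ v := by simp [mulVecInt]

/-- Change of coordinates by a matrix in `GLₙ*` with multiplier `1`. -/
theorem IsCoordinates.conj {M : RealPolarizedModule p a n O} {γ γ' g : GL (Idx n) ℚ}
    {ψ : M.T →ₗ[ℤ] (Idx n → ℚ)} (h : IsCoordinates M γ ψ) (hg : g ∈ GLstar n ℚ)
    (hm : HasMultiplier g 1) (e : g * γ = γ' * g) :
    IsCoordinates M γ' (mulVecInt g.val ∘ₗ ψ) where
  injective := fun x y hxy => h.injective (Matrix.mulVec_injective_of_isUnit g.isUnit (by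
    simpa using hxy))
  map_F x := by
    rw [LinearMap.comp_apply, LinearMap.comp_apply, mulVecInt_apply, mulVecInt_apply, h.map_F,
      Matrix.mulVec_mulVec, Matrix.mulVec_mulVec, ← Units.val_mul, e, Units.val_mul]
  map_ω x y := by
    unfold HasMultiplier at hm
    rw [h.map_ω, LinearMap.comp_apply, LinearMap.comp_apply, mulVecInt_apply, mulVecInt_apply,
      mulVec_dotProduct_mulVec_mulVec, hm, one_smul]
  map_τ x := by
    rw [LinearMap.comp_apply, LinearMap.comp_apply, mulVecInt_apply, mulVecInt_apply, h.map_τ,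
      Matrix.mulVec_mulVec, Matrix.mulVec_mulVec, hg.2]

/-- Conjugacy over one extension field is enough, with no condition over ℝ. After a rational change
of coordinates of multiplier 1 the upper left block is A₀, and positivity of the polarization of the
module itself then forces the signs of B. -/
theorem IsCoordinates.hasNormalForm (hp : (p : ℂ) ∈ O.nonunits) (ha : 0 < a)
    {M : RealPolarizedModule p a n O} {γ₀ γ : GL (Idx n) ℚ} {ψ : M.T →ₗ[ℤ] (Idx n → ℚ)}
    (h : IsCoordinates M γ ψ) {A₀ B₀ C₀ : Matrix (Fin n) (Fin n) ℚ}
    (hγ₀ : γ₀.val = fromBlocks A₀ B₀ C₀ A₀ᵀ) {K : Type*} [Field K] [CharZero K]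
    (hc : ConjBy (GLstar n K) (ratMap K γ₀) (ratMap K γ)) :
    HasNormalForm (forcedSign O (p ^ a)) (p ^ a) A₀ γ := by
  obtain ⟨g, hg, γ', e, hm, B, C, hγ', hb⟩ :=
    exists_conj_block_eq hγ₀ (isQInversive_iff.mp h.isQInversive).2 hc
  exact ⟨γ', ConjBy.symm (conjBy_iff.mpr ⟨g, hg, e⟩), B, C, hγ', hb,
    ((h.conj hg hm e).definiteBlocks hp ha hγ').definite⟩

theorem exists_nat_mul_eq_int {ι : Type*} [Fintype ι] (f : ι → ℚ) :
    ∃ N : ℕ, 0 < N ∧ ∀ i, ∃ m : ℤ, (m : ℚ) = N * f i := by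
  refine ⟨∏ i, (f i).den, Finset.prod_pos fun i _ => (f i).den_pos, fun i => ?_⟩
  obtain ⟨k, hk⟩ := Finset.dvd_prod_of_mem (fun i => (f i).den) (Finset.mem_univ i)
  refine ⟨k * (f i).num, ?_⟩
  rw [hk]
  push_cast
  rw [mul_comm ((f i).den : ℚ), mul_assoc, mul_comm ((f i).den : ℚ), Rat.mul_den_eq_num]

/-- Integrality of a form can be checked on a basis. -/
theorem exists_int_eq_of_basis {ι T : Type*} [AddCommGroup T] (b : Module.Basis ι ℤ T)
    (ψ : T →ₗ[ℤ] (Idx n → ℚ)) (H : Matrix (Idx n) (Idx n) ℚ)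
    (h : ∀ i j, ∃ m : ℤ, (m : ℚ) = ψ (b i) ⬝ᵥ (H *ᵥ ψ (b j))) (x y : T) :
    ∃ m : ℤ, (m : ℚ) = ψ x ⬝ᵥ (H *ᵥ ψ y) := by
  have key : ∀ v : Idx n → ℚ, (∀ i, ∃ m : ℤ, (m : ℚ) = ψ (b i) ⬝ᵥ v) →
      ∀ x, ∃ m : ℤ, (m : ℚ) = ψ x ⬝ᵥ v := by
    intro v h x
    have hx : x ∈ Submodule.span ℤ (Set.range b) := by rw [b.span_eq]; trivial
    induction hx using Submodule.span_induction with
    | mem x hx => obtain ⟨i, rfl⟩ := hx; exact h i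
    | zero => exact ⟨0, by simp⟩
    | add x y _ _ hx hy =>
      obtain ⟨m, hm⟩ := hx
      obtain ⟨k, hk⟩ := hy
      exact ⟨m + k, by rw [map_add, add_dotProduct, Int.cast_add, hm, hk]⟩
    | smul c x _ hx =>
      obtain ⟨m, hm⟩ := hx
      exact ⟨c * m, by rw [map_smul, smul_dotProduct, Int.cast_mul, hm, zsmul_eq_mul]⟩
  refine key _ (fun i => ?_) x
  have e : ∀ y, ψ (b i) ⬝ᵥ (H *ᵥ ψ y) = ψ y ⬝ᵥ (Hᵀ *ᵥ ψ (b i)) := fun y => by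
    rw [Matrix.mulVec_transpose, dotProduct_comm (ψ y), Matrix.dotProduct_mulVec]
  rw [e]
  exact key _ (fun j => by rw [← e]; exact h i j) y

theorem exists_bilinForm_eq {T : Type*} [AddCommGroup T] (ψ : T →ₗ[ℤ] (Idx n → ℚ))
    (H : Matrix (Idx n) (Idx n) ℚ) (h : ∀ x y, ∃ m : ℤ, (m : ℚ) = ψ x ⬝ᵥ (H *ᵥ ψ y)) :
    ∃ ω : LinearMap.BilinForm ℤ T, ∀ x y, ((ω x y : ℤ) : ℚ) = ψ x ⬝ᵥ (H *ᵥ ψ y) := by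
  choose m hm using h
  refine ⟨LinearMap.mk₂ ℤ m (fun x x' y => ?_) (fun c x y => ?_) (fun x y y' => ?_)
    (fun c x y => ?_), fun x y => by rw [LinearMap.mk₂_apply, hm]⟩ <;>
  · rw [← Int.cast_inj (α := ℚ)]
    push_cast [smul_eq_mul]
    simp only [hm, map_add, map_smul, add_dotProduct, Matrix.mulVec_add, dotProduct_add,
      smul_dotProduct, Matrix.mulVec_smul, dotProduct_smul]
    try rw [zsmul_eq_mul]

theorem isSymm_and_pos_of_posDef_map {m : Type*} [Fintype m] {H : Matrix m m ℚ}
    (h : (H.map (Rat.castHom ℝ)).PosDef) : H.IsSymm ∧ ∀ v, v ≠ 0 → 0 < v ⬝ᵥ (H *ᵥ v) := by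
  constructor
  · have h1 := h.isHermitian
    rw [Matrix.IsHermitian, Matrix.conjTranspose_eq_transpose_of_trivial,
      ← Matrix.transpose_map] at h1
    exact map_matrix_injective (Rat.castHom ℝ) h1
  · intro v hv
    have hv' : (fun i => (v i : ℝ)) ≠ 0 := fun h0 => hv (by
      ext i
      have := congrFun h0 i
      simpa using this)
    have h1 := h.dotProduct_mulVec_pos hv'
    rw [star_trivial] at h1
    have e : (fun i => (v i : ℝ)) ⬝ᵥ (H.map (Rat.castHom ℝ) *ᵥ fun i => (v i : ℝ)) =
        ((v ⬝ᵥ (H *ᵥ v) : ℚ) : ℝ) := by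
      simp [Matrix.mulVec, dotProduct]
    rw [e] at h1
    exact_mod_cast h1

/-- The polarization of a real polarized Deligne module may be replaced by any form that is
standard in coordinates in which the involution is standard. -/
theorem exists_module_of_coordinates (M₀ : RealPolarizedModule p a n O) {γ : GL (Idx n) ℚ}
    {ψ : M₀.T →ₗ[ℤ] (Idx n → ℚ)} (hψ : Function.Injective ψ)
    (hF : ∀ x, ψ (M₀.F x) = γ.val *ᵥ ψ x) (hτ : ∀ x, ψ (M₀.τ x) = tau0 n ℚ *ᵥ ψ x)
    (hint : ∀ x y, ∃ m : ℤ, (m : ℚ) = ψ x ⬝ᵥ (stdJ n ℚ *ᵥ ψ y))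
    (hγ : HasMultiplier γ ((p ^ a : ℕ) : ℚ)) {P : ℚ[X]}
    (hP : M₀.IsPositiveImaginary (M₀.cmType O) (aeval M₀.genF P))
    (hpd : ((stdJ n ℚ * aeval γ.val P).map (Rat.castHom ℝ)).PosDef) :
    ∃ (M : RealPolarizedModule p a n O) (ψ' : M.T →ₗ[ℤ] (Idx n → ℚ)), IsCoordinates M γ ψ' := by
  obtain ⟨ω, hω⟩ := exists_bilinForm_eq ψ (stdJ n ℚ) hint
  have hform := baseChange_form_eq ℚ hω
  have hJJ : stdJ n ℚ * stdJ n ℚ = -1 := by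
    rw [stdJ, fromBlocks_multiply, ← fromBlocks_one, fromBlocks_neg]
    simp
  have hJT : (stdJ n ℚ)ᵀ = -stdJ n ℚ := by
    rw [stdJ, fromBlocks_transpose, fromBlocks_neg]
    simp
  have hanti : ∀ u v : Idx n → ℚ, u ⬝ᵥ (stdJ n ℚ *ᵥ v) = -(v ⬝ᵥ (stdJ n ℚ *ᵥ u)) := fun u v => by
    rw [← dotProduct_neg, ← Matrix.neg_mulVec, ← hJT, Matrix.mulVec_transpose,
      dotProduct_comm v, ← Matrix.dotProduct_mulVec]
  have hsurj : ∀ u, ∃ x, extendCoords ℚ ψ x = u :=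
    (coordsEquiv ℚ M₀.toDeligneModule hψ).surjective
  have hinj : Function.Injective (extendCoords ℚ ψ) :=
    (coordsEquiv ℚ M₀.toDeligneModule hψ).injective
  have hzero : ∀ u : Idx n → ℚ, (∀ v, v ⬝ᵥ (stdJ n ℚ *ᵥ u) = 0) → u = 0 := fun u hu => by
    have h1 : stdJ n ℚ *ᵥ u = 0 := dotProduct_eq_zero _ fun v => by
      rw [dotProduct_comm]; exact hu v
    have h2 : (stdJ n ℚ * stdJ n ℚ) *ᵥ u = 0 := by
      rw [← Matrix.mulVec_mulVec, h1, Matrix.mulVec_zero]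
    rw [hJJ, Matrix.neg_mulVec, Matrix.one_mulVec] at h2
    exact neg_eq_zero.mp h2
  have hq0 : ((p ^ a : ℕ) : ℚ) ≠ 0 := by
    exact_mod_cast (pow_pos (Fact.out : p.Prime).pos a).ne'
  have hmul : ∀ u v : Idx n → ℚ, (γ.val *ᵥ u) ⬝ᵥ (stdJ n ℚ *ᵥ (γ.val *ᵥ v)) =
      ((p ^ a : ℕ) : ℚ) * (u ⬝ᵥ (stdJ n ℚ *ᵥ v)) := fun u v => by
    unfold HasMultiplier at hγ
    rw [mulVec_dotProduct_mulVec_mulVec, hγ, Matrix.smul_mulVec, dotProduct_smul,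
      smul_eq_mul]
  have hval : ((aeval M₀.genF P : M₀.QF) : Module.End ℚ _) = aeval (M₀.F.baseChange ℚ) P :=
    (Polynomial.aeval_algHom_apply M₀.QF.val M₀.genF P).symm
  have hformP : ∀ x y, (ω.baseChange ℚ) x (aeval (M₀.F.baseChange ℚ) P y) =
      extendCoords ℚ ψ x ⬝ᵥ ((stdJ n ℚ * aeval γ.val P) *ᵥ extendCoords ℚ ψ y) := fun x y => by
    rw [hform, extendCoords_aeval hF, map_stdJ, Matrix.mulVec_mulVec]
  obtain ⟨hsymm, hpos⟩ := isSymm_and_pos_of_posDef_map hpd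
  refine ⟨{ M₀.toDeligneModule with
    ω := ω
    alternating := fun x => ?_
    nondegenerate := ⟨fun x hx => ?_, fun x hx => ?_⟩
    ω_F := fun x y => ?_
    positive := ⟨aeval M₀.genF P, hP, fun x y => ?_, fun x hx => ?_⟩
    τ := M₀.τ
    τ_τ := M₀.τ_τ
    τ_F := M₀.τ_F
    ω_τ := fun x y => ?_ }, ψ, hψ, hF, hω, hτ⟩
  · have := hanti (ψ x) (ψ x)
    rw [← hω] at this
    have h1 : (ω x x : ℚ) = 0 := by linarith
    exact_mod_cast h1
  · refine hinj ((hzero _ fun v => ?_).trans (map_zero _).symm)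
    obtain ⟨y, rfl⟩ := hsurj v
    have := hx y
    rw [hform, map_stdJ, hanti] at this
    exact neg_eq_zero.mp this
  · refine hinj ((hzero _ fun v => ?_).trans (map_zero _).symm)
    obtain ⟨y, rfl⟩ := hsurj v
    have := hx y
    rwa [hform, map_stdJ] at this
  -- Apply the multiplier relation ω(Fx, Fz) = qω(x, z) to z = Vy, use FV = q, and cancel q.
  · have h1 : γ.val *ᵥ ψ (M₀.V y) = ((p ^ a : ℕ) : ℚ) • ψ y := by
      rw [← hF, M₀.F_V, map_nsmul, Nat.cast_smul_eq_nsmul]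
    have h2 := hmul (ψ x) (ψ (M₀.V y))
    rw [h1, Matrix.mulVec_smul, dotProduct_smul, smul_eq_mul, ← hF, ← hω, ← hω] at h2
    exact_mod_cast mul_left_cancel₀ hq0 h2
  · rw [hval, hformP, hformP, Matrix.dotProduct_mulVec, ← Matrix.mulVec_transpose, hsymm.eq,
      dotProduct_comm]
  · rw [hval, hformP]
    exact hpos _ fun h0 => hx (hinj (h0.trans (map_zero _).symm))
  · have h1 : ((tau0 n ℚ)ᵀ * stdJ n ℚ * tau0 n ℚ) = -stdJ n ℚ := by
      rw [tau0, stdJ, fromBlocks_transpose, fromBlocks_multiply, fromBlocks_multiply,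
        fromBlocks_neg]
      simp
    have h2 : ((ω (M₀.τ x) (M₀.τ y) : ℤ) : ℚ) = -(ω x y : ℤ) := by
      rw [hω, hω, hτ, hτ, mulVec_dotProduct_mulVec_mulVec, h1, Matrix.neg_mulVec,
        dotProduct_neg]
    exact_mod_cast h2

/-- Positivity is preserved by conjugation by a matrix with positive multiplier. -/
theorem posDef_of_conj {γ γ' : GL (Idx n) ℚ} {g : GL (Idx n) ℝ} {c : ℝ} (hm : HasMultiplier g c)
    (hc : 0 < c) (e : g * ratMap ℝ γ = ratMap ℝ γ' * g) {P : ℚ[X]}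
    (h : ((stdJ n ℚ * aeval γ.val P).map (Rat.castHom ℝ)).PosDef) :
    ((stdJ n ℚ * aeval γ'.val P).map (Rat.castHom ℝ)).PosDef := by
  have e' : (ratMap ℝ γ').val * g.val = g.val * (ratMap ℝ γ).val := by
    rw [← Units.val_mul, ← e, Units.val_mul]
  have h1 := aeval_mul_eq_mul_aeval e' (P.map (Rat.castHom ℝ))
  unfold HasMultiplier at hm
  rw [Matrix.map_mul, map_stdJ, ← aeval_map_matrix, ← ratMap_val] at h ⊢
  rw [← Matrix.IsUnit.posDef_star_left_conjugate_iff g.isUnit, Matrix.star_eq_conjTranspose,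
    Matrix.conjTranspose_eq_transpose_of_trivial, Matrix.mul_assoc, Matrix.mul_assoc, h1,
    ← Matrix.mul_assoc, ← Matrix.mul_assoc, hm, Matrix.smul_mul]
  exact h.smul hc

end Bijections

end RealDeligne

namespace RealDeligne

open Polynomial

/-! ### Congruence classes, conjugacy classes and isogeny classes -/

section Bijections

variable {p a n : ℕ} [Fact p.Prime] {O : ValuationSubring ℂ} {s : ℝ → ℝ} {q : ℕ}
  {γ₀ : GL (Idx n) ℚ} {A₀ B₀ C₀ : Matrix (Fin n) (Fin n) ℚ}

theorem inversiveBlocks_of_symm {k : ℚ} {A B : Matrix (Fin n) (Fin n) ℚ} (hB : B.IsSymm)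
    (hu : IsUnit B.det) (hAB : A * B = B * Aᵀ) :
    InversiveBlocks k A B (B⁻¹ * (A ^ 2 - k • (1 : Matrix (Fin n) (Fin n) ℚ))) := by
  have hBA : B⁻¹ * A = Aᵀ * B⁻¹ := by
    calc B⁻¹ * A = B⁻¹ * (A * B) * B⁻¹ := by
          rw [Matrix.mul_assoc, Matrix.mul_assoc A, Matrix.mul_nonsing_inv _ hu, Matrix.mul_one]
      _ = _ := by rw [hAB, ← Matrix.mul_assoc, Matrix.nonsing_inv_mul _ hu, Matrix.one_mul]
  have hBA2 : B⁻¹ * (A ^ 2 - k • (1 : Matrix (Fin n) (Fin n) ℚ)) =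
      (Aᵀ ^ 2 - k • (1 : Matrix (Fin n) (Fin n) ℚ)) * B⁻¹ := by
    rw [Matrix.mul_sub, Matrix.sub_mul, pow_two, pow_two, ← Matrix.mul_assoc, hBA,
      Matrix.mul_assoc, hBA, Matrix.mul_assoc, Matrix.mul_smul, Matrix.smul_mul, Matrix.mul_one,
      Matrix.one_mul]
  refine ⟨hB, ?_, hAB, ?_, ?_, ?_⟩
  · rw [Matrix.IsSymm, Matrix.transpose_mul, Matrix.transpose_nonsing_inv, hB.eq,
      Matrix.transpose_sub, Matrix.transpose_smul, Matrix.transpose_one, Matrix.transpose_pow,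
      ← hBA2]
  · rw [Matrix.mul_assoc, ← Matrix.mul_assoc Aᵀ, ← hBA, Matrix.mul_assoc]
    congr 1
    rw [Matrix.sub_mul, Matrix.mul_sub, pow_two, Matrix.mul_assoc, Matrix.smul_mul,
      Matrix.mul_smul, Matrix.mul_one, Matrix.one_mul]
  · rw [← Matrix.mul_assoc, Matrix.mul_nonsing_inv _ hu, Matrix.one_mul]
  · rw [hBA2, Matrix.mul_assoc, Matrix.nonsing_inv_mul _ hu, Matrix.mul_one]

/-- The relations say that γ has inverse k⁻¹τ₀γτ₀, which is γ with the signs of the off-diagonal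
blocks changed, divided by k. -/
theorem InversiveBlocks.exists_GL {k : ℚ} (hk : k ≠ 0) {A B C : Matrix (Fin n) (Fin n) ℚ}
    (h : InversiveBlocks k A B C) : ∃ γ : GL (Idx n) ℚ, γ.val = fromBlocks A B C Aᵀ := by
  have e : (k⁻¹ • fromBlocks A (-B) (-C) Aᵀ) * fromBlocks A B C Aᵀ = 1 := by
    rw [Matrix.smul_mul, fromBlocks_multiply, Matrix.neg_mul, Matrix.neg_mul, Matrix.neg_mul,
      Matrix.neg_mul, h.BC, h.AB, h.CA, h.CB, ← pow_two, ← pow_two, ← fromBlocks_one,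
      fromBlocks_smul]
    congr 1 <;> simp [smul_smul, hk]
  exact ⟨⟨_, _, mul_eq_one_comm.mp e, e⟩, rfl⟩

theorem deltaGL_mul_iff {k : ℚ} {γ γ' : GL (Idx n) ℚ}
    {A B C A' B' C' : Matrix (Fin n) (Fin n) ℚ}
    (hγ : γ.val = fromBlocks A B C Aᵀ) (hγ' : γ'.val = fromBlocks A' B' C' A'ᵀ)
    (h : InversiveBlocks k A B C) (h' : InversiveBlocks k A' B' C') (hB' : IsUnit B'.det)
    (lam : ℚˣ) (X : GL (Fin n) ℚ) :
    deltaGL lam X * γ = γ' * deltaGL lam X ↔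
      X.val * A = A' * X.val ∧ (lam : ℚ) • (X.val * B * (X.val)ᵀ) = B' := by
  rw [← delta_mul_eq_iff h h' hB', Units.ext_iff, Units.val_mul, Units.val_mul, deltaGL_val, hγ,
    hγ']

/-- `B ↦ γ` is a bijection between congruence classes and conjugacy classes. -/
theorem DefiniteBlocks.exists_equiv_congruenceClasses (D : DefiniteBlocks s q γ₀ A₀ B₀ C₀)
    (hq : q ≠ 0) : ∃ e : Quotient (congruenceSetoid A₀ B₀) ≃ RealClasses q γ₀,
      ∀ B : setB A₀ B₀, ∃ γ : setReal q γ₀,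
        γ.1.val = Matrix.fromBlocks A₀ B.1
          (B.1⁻¹ * (A₀ ^ 2 - (q : ℚ) • (1 : Matrix (Fin n) (Fin n) ℚ))) A₀ᵀ ∧
        e (Quotient.mk _ B) = Quotient.mk _ γ := by
  have hb : ∀ B : setB A₀ B₀, InversiveBlocks (q : ℚ) A₀ B.1
      (B.1⁻¹ * (A₀ ^ 2 - (q : ℚ) • (1 : Matrix (Fin n) (Fin n) ℚ))) := fun B =>
    inversiveBlocks_of_symm B.2.1 B.2.2.1 B.2.2.2.1
  have hsig : ∀ {B : Matrix (Fin n) (Fin n) ℚ}, SameSignatures A₀ B B₀ ↔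
      DefiniteWith s (A₀.map (Rat.castHom ℝ)) (B.map (Rat.castHom ℝ)) :=
    sameSignatures_iff_definiteWith D.sign D.definite
  have hex : ∀ B : setB A₀ B₀, ∃ γ : setReal q γ₀, γ.1.val = Matrix.fromBlocks A₀ B.1
      (B.1⁻¹ * (A₀ ^ 2 - (q : ℚ) • (1 : Matrix (Fin n) (Fin n) ℚ))) A₀ᵀ := fun B => by
    obtain ⟨γ, hγ⟩ := (hb B).exists_GL (Nat.cast_ne_zero.mpr hq)
    exact ⟨⟨γ, D.mem_setReal ⟨γ, ⟨1, one_mem _, by simp⟩, _, _, hγ, hb B,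
      hsig.mp B.2.2.2.2⟩⟩, hγ⟩
  choose Γ hΓ using hex
  have key : ∀ B B' : setB A₀ B₀, (congruenceSetoid A₀ B₀).r B B' ↔
      (conjSetoid (GLstar n ℚ) (setReal q γ₀)).r (Γ B) (Γ B') := fun B B' => by
    change _ ↔ ConjBy _ _ _
    rw [conjBy_iff]
    constructor
    · rintro ⟨lam, X, hX, hB'⟩
      exact ⟨_, deltaGL_mem lam X, (deltaGL_mul_iff (hΓ B) (hΓ B') (hb B) (hb B') B'.2.2.1
        lam X).mpr ⟨hX, hB'.symm⟩⟩
    · rintro ⟨g, hg, e⟩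
      obtain ⟨lam, X, rfl⟩ := exists_eq_deltaGL hg
      obtain ⟨hX, hB'⟩ := (deltaGL_mul_iff (hΓ B) (hΓ B') (hb B) (hb B') B'.2.2.1 lam X).mp e
      exact ⟨lam, X, hX, hB'.symm⟩
  let φ : Quotient (congruenceSetoid A₀ B₀) → RealClasses q γ₀ :=
    Quotient.map Γ fun B B' h => (key B B').mp h
  have hφ : Function.Bijective φ := by
    constructor
    · intro x y
      induction x using Quotient.inductionOn with | _ B =>
      induction y using Quotient.inductionOn with | _ B' =>
      intro h
      exact Quotient.sound ((key B B').mpr (Quotient.exact h))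
    · intro x
      induction x using Quotient.inductionOn with | _ γ =>
      obtain ⟨γ', hc, B, C, hγ', hb', hdef⟩ := D.mem_setReal_iff.mp γ.2
      have hu := D.isUnit_det_of_blocks hb'
      let Bs : setB A₀ B₀ := ⟨B, hb'.symm_B, hu, hb'.AB, hsig.mpr hdef⟩
      refine ⟨Quotient.mk _ Bs, Quotient.sound ?_⟩
      -- The block C is determined by A₀ and B: it is B⁻¹(A₀² − q).
      have : (Γ Bs).1 = γ' := by
        refine Units.ext ?_
        rw [hΓ Bs, hγ', ← hb'.BC, ← Matrix.mul_assoc, Matrix.nonsing_inv_mul _ hu, Matrix.one_mul]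
      change ConjBy _ (Γ Bs).1 γ.1
      rw [this]
      exact hc
  exact ⟨Equiv.ofBijective φ hφ, fun B => ⟨Γ B, hΓ B, rfl⟩⟩

/-- An element in normal form is, up to conjugation, the Frobenius of a real polarized Deligne
module. -/
theorem exists_module_of_hasNormalForm {M₀ : RealPolarizedModule p a n O}
    {ψ₀ : M₀.T →ₗ[ℤ] (Idx n → ℚ)} (h₀ : IsCoordinates M₀ γ₀ ψ₀)
    (D : DefiniteBlocks s (p ^ a) γ₀ A₀ B₀ C₀) {γ : GL (Idx n) ℚ}
    (hγ : HasNormalForm s (p ^ a) A₀ γ) :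
    ∃ (M : RealPolarizedModule p a n O) (γ' : GL (Idx n) ℚ) (ψ : M.T →ₗ[ℤ] (Idx n → ℚ)),
      IsCoordinates M γ' ψ ∧ ConjBy (GLstar n ℚ) γ γ' := by
  obtain ⟨γ₁, hc, B, C, hγ₁, hb, hdef⟩ := hγ
  obtain ⟨Y, hY⟩ := D.exists_real_conj hγ₁ hb hdef
  have hYτ : (deltaGL 1 Y).val * tau0 n ℝ = tau0 n ℝ * (deltaGL 1 Y).val :=
    (deltaGL_mem (1 : ℝˣ) Y).2.symm
  -- The real conjugation intertwines γ₀ with γ₁ and commutes with τ₀, so a rational matrix `Z` does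
  -- both. `Z` need not be symplectic, so it preserves the lattice with F and τ but changes the
  -- polarization.
  obtain ⟨Z, hZ⟩ := exists_rat_similar (J := Bool) (fun b => cond b γ₀.val (tau0 n ℚ))
    (fun b => cond b γ₁.val (tau0 n ℚ)) (deltaGL 1 Y) (by
      rintro (_ | _)
      · change _ * (tau0 n ℚ).map _ = (tau0 n ℚ).map _ * _
        rw [map_tau0, hYτ]
      · change _ * (ratMap ℝ γ₀).val = (ratMap ℝ γ₁).val * _
        rw [← Units.val_mul, ← Units.val_mul, hY])
  have hZγ : Z * γ₀ = γ₁ * Z := Units.ext (hZ true)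
  have hZτ : Z.val * tau0 n ℚ = tau0 n ℚ * Z.val := hZ false
  -- The form pulled back through `Z` is only rational on the lattice. `N` clears its denominators
  -- on a basis, and following `Z` by δ(N, 1) multiplies the form by `N`.
  obtain ⟨N, hN, hNint⟩ := exists_nat_mul_eq_int fun ij : Idx n × Idx n =>
    ψ₀ (M₀.basis ij.1) ⬝ᵥ (((Z.val)ᵀ * stdJ n ℚ * Z.val) *ᵥ ψ₀ (M₀.basis ij.2))
  let N' : ℚˣ := Units.mk0 (N : ℚ) (Nat.cast_ne_zero.mpr hN.ne')
  let δ : GL (Idx n) ℚ := deltaGL N' 1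
  have hδ : δ ∈ GLstar n ℚ := deltaGL_mem _ _
  have hδm : HasMultiplier δ (N : ℚ) := hasMultiplier_deltaGL N' 1
  let γ' := δ * γ₁ * δ⁻¹
  have e₁ : δ * γ₁ = γ' * δ := by simp only [γ']; group
  have hγ₁i : IsInversive ((p ^ a : ℕ) : ℚ) γ₁ :=
    (isInversive_iff_blocks hγ₁).mpr ⟨rfl, hb⟩
  have hγ'i := hγ₁i.conj hδ e₁
  let W := δ * Z
  have hWγ : W * γ₀ = γ' * W := by
    simp only [W]
    rw [mul_assoc, hZγ, ← mul_assoc, e₁, mul_assoc]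
  have hWτ : W.val * tau0 n ℚ = tau0 n ℚ * W.val := by
    simp only [W, Units.val_mul]
    rw [Matrix.mul_assoc, hZτ, ← Matrix.mul_assoc, ← hδ.2, Matrix.mul_assoc]
  have hWJ : (W.val)ᵀ * stdJ n ℚ * W.val = (N : ℚ) • ((Z.val)ᵀ * stdJ n ℚ * Z.val) := by
    unfold HasMultiplier at hδm
    calc (W.val)ᵀ * stdJ n ℚ * W.val = (Z.val)ᵀ * ((δ.val)ᵀ * stdJ n ℚ * δ.val) * Z.val := by
          simp only [W, Units.val_mul, Matrix.transpose_mul, Matrix.mul_assoc]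
      _ = _ := by rw [hδm, Matrix.mul_smul, Matrix.smul_mul]
  obtain ⟨P, hP, -, hpd⟩ := h₀.exists_positive
  let N'' : ℝˣ := Units.mk0 (N : ℝ) (Nat.cast_ne_zero.mpr hN.ne')
  have hδ' : ratMap ℝ δ = deltaGL N'' 1 := by
    refine Units.ext ?_
    rw [ratMap_val, deltaGL_val, deltaGL_val, delta, delta, fromBlocks_map, inv_one, inv_one,
      map_smul_matrix, Units.val_one, Units.val_one, Matrix.map_one _ (map_zero _) (map_one _)]
    simp [N', N'', Matrix.map_one, Matrix.map_zero]
  -- Positivity of the new form cannot be read from `W`, which is not a similitude. It comes from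
  -- the real conjugation δ(N, 1)δ(1, Y), whose multiplier N is positive, with the same polynomial P
  -- as for the original polarization.
  have hgm : HasMultiplier (ratMap ℝ δ * deltaGL 1 Y) (N : ℝ) := by
    rw [hδ', deltaGL_mul, mul_one]
    exact hasMultiplier_deltaGL N'' _
  have hpd' := posDef_of_conj (γ' := γ') hgm (Nat.cast_pos.mpr hN) (by
    rw [mul_assoc, hY, ← mul_assoc, ← map_mul, e₁, map_mul, mul_assoc]) hpd
  obtain ⟨M, ψ, hM⟩ := exists_module_of_coordinates M₀ (γ := γ')
    (ψ := mulVecInt W.val ∘ₗ ψ₀)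
    (fun x y hxy => h₀.injective (Matrix.mulVec_injective_of_isUnit W.isUnit (by simpa using hxy)))
    (fun x => by
      rw [LinearMap.comp_apply, LinearMap.comp_apply, mulVecInt_apply, mulVecInt_apply, h₀.map_F,
        Matrix.mulVec_mulVec, Matrix.mulVec_mulVec, ← Units.val_mul, hWγ, Units.val_mul])
    (fun x => by
      rw [LinearMap.comp_apply, LinearMap.comp_apply, mulVecInt_apply, mulVecInt_apply, h₀.map_τ,
        Matrix.mulVec_mulVec, Matrix.mulVec_mulVec, hWτ])
    (fun x y => by
      simp only [LinearMap.comp_apply, mulVecInt_apply, mulVec_dotProduct_mulVec_mulVec, hWJ]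
      refine exists_int_eq_of_basis M₀.basis ψ₀ _ (fun i j => ?_) x y
      obtain ⟨m, hm⟩ := hNint (i, j)
      exact ⟨m, by rw [hm, Matrix.smul_mulVec, dotProduct_smul, smul_eq_mul]⟩)
    hγ'i.1 hP hpd'
  exact ⟨M, γ', ψ, hM, hc.symm.trans ⟨δ, hδ, rfl⟩⟩

/-- Isogeny classes of modules correspond to conjugacy classes of matrices. -/
theorem exists_equiv_isogenyClasses (hp : (p : ℂ) ∈ O.nonunits) (ha : 0 < a)
    {M₀ : RealPolarizedModule p a n O} {ψ₀ : M₀.T →ₗ[ℤ] (Idx n → ℚ)}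
    (h₀ : IsCoordinates M₀ γ₀ ψ₀) (hγ₀ : γ₀.val = fromBlocks A₀ B₀ C₀ A₀ᵀ) :
    ∃ e : Quotient (isogenySetoid ℚ QBar M₀) ≃ RealClasses (p ^ a) γ₀,
      ∀ M : {M : RealPolarizedModule p a n O // Isogenous QBar M M₀},
        (∃ γ ψ, IsCoordinates M.1 γ ψ) ∧
        ∀ γ ψ, IsCoordinates M.1 γ ψ →
          ∃ hγ : γ ∈ setReal (p ^ a) γ₀, e (Quotient.mk _ M) = Quotient.mk _ ⟨γ, hγ⟩ := by
  have : IsAlgClosed QBar := IsAlgClosure.isAlgClosed ℚ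
  have D := h₀.definiteBlocks hp ha hγ₀
  have hmem : ∀ (M : {M : RealPolarizedModule p a n O // Isogenous QBar M M₀}) (γ ψ),
      IsCoordinates M.1 γ ψ → γ ∈ setReal (p ^ a) γ₀ := fun M γ ψ h =>
    D.mem_setReal (h.hasNormalForm hp ha hγ₀ ((isogenous_iff h h₀).mp M.2).symm)
  choose Γ Ψ hΓ using fun M : {M : RealPolarizedModule p a n O // Isogenous QBar M M₀} =>
    exists_isCoordinates M.1
  have hiff : ∀ {M₁ M₂ : RealPolarizedModule p a n O} {γ₁ γ₂ : GL (Idx n) ℚ} {ψ₁ ψ₂},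
      IsCoordinates M₁ γ₁ ψ₁ → IsCoordinates M₂ γ₂ ψ₂ →
      (Isogenous ℚ M₁ M₂ ↔ ConjBy (GLstar n ℚ) γ₁ γ₂) := fun {_ _ γ₁ γ₂ _ _} h₁ h₂ => by
    have hid : ∀ γ : GL (Idx n) ℚ, ratMap ℚ γ = γ := fun γ => by ext; simp [ratMap]
    rw [isogenous_iff h₁ h₂, hid, hid]
  let φ : Quotient (isogenySetoid ℚ QBar M₀) → RealClasses (p ^ a) γ₀ :=
    Quotient.map (fun M => ⟨Γ M, hmem M _ _ (hΓ M)⟩) fun M N h => (hiff (hΓ M) (hΓ N)).mp h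
  have hφ : Function.Bijective φ := by
    constructor
    · intro x y
      induction x using Quotient.inductionOn with | _ M =>
      induction y using Quotient.inductionOn with | _ N =>
      intro h
      exact Quotient.sound ((hiff (hΓ M) (hΓ N)).mpr (Quotient.exact h))
    · intro x
      induction x using Quotient.inductionOn with | _ γ =>
      have hnf := D.mem_setReal_iff.mp γ.2
      obtain ⟨M, γ', ψ, hM, hc⟩ := exists_module_of_hasNormalForm h₀ D hnf
      have hiso : Isogenous QBar M M₀ :=
        (isogenous_iff hM h₀).mpr ((D.conjBy_algClosed QBar hnf).trans (hc.ratMap QBar)).symm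
      let Ms : {M : RealPolarizedModule p a n O // Isogenous QBar M M₀} := ⟨M, hiso⟩
      refine ⟨Quotient.mk _ Ms, Quotient.sound ?_⟩
      change ConjBy _ (Γ Ms) γ.1
      exact ((hiff (hΓ Ms) hM).mp ⟨_, IsIsogeny.refl ℚ M⟩).trans hc.symm
  refine ⟨Equiv.ofBijective φ hφ, fun M => ⟨⟨_, _, hΓ M⟩, fun γ ψ h => ⟨hmem M γ ψ h,
    Quotient.sound ?_⟩⟩⟩
  exact (hiff (hΓ M) h).mp ⟨_, IsIsogeny.refl ℚ M.1⟩

end Bijections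

end RealDeligne

namespace RealDeligne

/-! ### Hilbert's Theorem 90 for `GLₙ*` -/

section Cohomology

variable {n : ℕ} {K L : Type*} [Field K] [Field L]

theorem map_GL_injective {m : Type*} [Fintype m] [DecidableEq m] (f : K →+* L) :
    Function.Injective (Matrix.GeneralLinearGroup.map f : GL m K →* GL m L) := fun _ _ h =>
  Units.ext (map_matrix_injective f (congrArg Units.val h))

theorem map_deltaGL (f : K →+* L) (lam : Kˣ) (X : GL (Fin n) K) :
    Matrix.GeneralLinearGroup.map f (deltaGL lam X) =
      deltaGL (Units.map f lam) (Matrix.GeneralLinearGroup.map f X) := by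
  refine Units.ext ?_
  change (delta lam X).map f = delta _ _
  rw [delta, delta, fromBlocks_map, map_smul_matrix, ← map_inv, Matrix.map_zero _ (map_zero f),
    Matrix.transpose_map]
  rfl

theorem deltaGL_inj_left [NeZero n] {lam lam' : Kˣ} {X X' : GL (Fin n) K}
    (h : deltaGL lam X = deltaGL lam' X') : lam = lam' := by
  have hX := deltaGL_inj_right h
  have h1 := congrArg Units.val h
  rw [deltaGL_val, deltaGL_val, delta, delta, fromBlocks_inj, hX] at h1
  exact Units.ext (smul_left_injective K X'.ne_zero h1.1)

/-- Membership in `GLₙ*` descends along field extensions. -/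
theorem mem_GLstar_of_map (f : K →+* L) {y : GL (Idx n) K}
    (h : Matrix.GeneralLinearGroup.map f y ∈ GLstar n L) : y ∈ GLstar n K := by
  obtain ⟨⟨c, hc⟩, ht⟩ := h
  have hv : (Matrix.GeneralLinearGroup.map f y).val = y.val.map f := rfl
  refine ⟨?_, map_matrix_injective f ?_⟩
  · unfold HasMultiplier at hc
    rw [hv, ← Matrix.transpose_map, ← map_stdJ f, ← Matrix.map_mul, ← Matrix.map_mul] at hc
    -- For n > 0 the multiplier is an entry of ᵗyJy and so lies in `K`. For n = 0 the relation is
    -- empty, the multiplier given over `L` says nothing, and 1 is taken.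
    rcases n with _ | n
    · exact ⟨1, Matrix.ext fun i => by rcases i with i | i <;> exact i.elim0⟩
    · have h1 := congrFun (congrFun hc (Sum.inl 0)) (Sum.inr 0)
      set r := ((y.val)ᵀ * stdJ (n + 1) K * y.val) (Sum.inl 0) (Sum.inr 0) with hr
      have h2 : f r = c := by
        rw [Matrix.map_apply, ← hr, Matrix.smul_apply, Matrix.map_apply] at h1
        simpa [stdJ] using h1
      have hr0 : r ≠ 0 := fun h0 => c.ne_zero (by rw [← h2, h0, map_zero])
      refine ⟨Units.mk0 r hr0, map_matrix_injective f ?_⟩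
      change _ = (r • stdJ (n + 1) K).map f
      rw [map_smul_matrix, h2]
      exact hc
  · change (tau0 n K * y.val).map f = (y.val * tau0 n K).map f
    rw [Matrix.map_mul, Matrix.map_mul, map_tau0, ← hv, ht]

/-- Hilbert's theorem 90 for `GLₙ*`. -/
theorem exists_mem_GLstar_eq_inv_mul_map [CharZero L] [IsGalois ℚ L]
    (f : Gal(L/ℚ) → GL (Idx n) L) (hf : IsLocallyConstant f) (hmem : ∀ σ, f σ ∈ GLstar n L)
    (hc : ∀ σ τ : Gal(L/ℚ), f (σ * τ) =
      f σ * Matrix.GeneralLinearGroup.map (σ : L →+* L) (f τ)) :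
    ∃ g ∈ GLstar n L, ∀ σ : Gal(L/ℚ),
      f σ = g⁻¹ * Matrix.GeneralLinearGroup.map (σ : L →+* L) g := by
  -- For n = 0 the empty matrix does not determine the scalar, so the scalars of a cocycle need not
  -- form a cocycle; this trivial case is treated apart.
  rcases Nat.eq_zero_or_pos n with rfl | hn
  · refine ⟨1, one_mem _, fun σ => Units.ext (Matrix.ext fun i => ?_)⟩
    rcases i with i | i <;> exact i.elim0
  have : NeZero n := ⟨hn.ne'⟩
  choose lam X hX using fun g : GLstar n L => exists_eq_deltaGL g.2
  have hf' : IsLocallyConstant fun σ => (⟨f σ, hmem σ⟩ : GLstar n L) :=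
    IsLocallyConstant.desc _ Subtype.val hf Subtype.val_injective
  have hfX : ∀ σ, f σ = deltaGL (lam ⟨f σ, hmem σ⟩) (X ⟨f σ, hmem σ⟩) := fun σ =>
    hX ⟨f σ, hmem σ⟩
  have hmul : ∀ σ τ : Gal(L/ℚ), deltaGL (lam ⟨f (σ * τ), hmem (σ * τ)⟩)
      (X ⟨f (σ * τ), hmem (σ * τ)⟩) = deltaGL
        (lam ⟨f σ, hmem σ⟩ * Units.map ((σ : L →+* L) : L →* L) (lam ⟨f τ, hmem τ⟩))
        (X ⟨f σ, hmem σ⟩ * Matrix.GeneralLinearGroup.map (σ : L →+* L) (X ⟨f τ, hmem τ⟩)) :=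
    fun σ τ => by
      rw [← deltaGL_mul, ← map_deltaGL, ← hfX, ← hfX, ← hfX, hc]
  obtain ⟨Y, hY⟩ := exists_eq_inv_mul_map (fun σ => X ⟨f σ, hmem σ⟩) (hf'.comp X)
    fun σ τ => deltaGL_inj_right (hmul σ τ)
  -- The scalars are regarded as 1 × 1 matrices, so the theorem for the general linear group also
  -- covers the multiplicative group.
  let scal : Lˣ →* GL (Fin 1) L := Units.map (Matrix.scalar (Fin 1) : L →+* _).toMonoidHom
  have hscal : ∀ (σ : Gal(L/ℚ)) (u : Lˣ), Matrix.GeneralLinearGroup.map (σ : L →+* L) (scal u) =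
      scal (Units.map ((σ : L →+* L) : L →* L) u) := fun σ u => by
    ext i j
    simp [scal, Matrix.diagonal_apply]
    split_ifs <;> simp
  obtain ⟨Z, hZ⟩ := exists_eq_inv_mul_map (fun σ => scal (lam ⟨f σ, hmem σ⟩))
    (hf'.comp (scal ∘ lam)) fun σ τ => by
      rw [hscal, ← map_mul, deltaGL_inj_left (hmul σ τ)]
  have hdet : ∀ σ : Gal(L/ℚ), lam ⟨f σ, hmem σ⟩ = (Matrix.GeneralLinearGroup.det Z)⁻¹ *
      Units.map ((σ : L →+* L) : L →* L) (Matrix.GeneralLinearGroup.det Z) := fun σ => by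
    have h1 := congrArg Matrix.GeneralLinearGroup.det (hZ σ)
    rw [map_mul, map_inv] at h1
    have h2 : Matrix.GeneralLinearGroup.det (scal (lam ⟨f σ, hmem σ⟩)) = lam ⟨f σ, hmem σ⟩ := by
      ext
      simp [scal]
    have h3 : Matrix.GeneralLinearGroup.det (Matrix.GeneralLinearGroup.map (σ : L →+* L) Z) =
        Units.map ((σ : L →+* L) : L →* L) (Matrix.GeneralLinearGroup.det Z) := by
      ext
      simp
    rw [← h2, h1, h3]
  refine ⟨deltaGL (Matrix.GeneralLinearGroup.det Z) Y, deltaGL_mem _ _, fun σ => ?_⟩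
  rw [eq_inv_mul_iff_mul_eq, map_deltaGL, hfX, deltaGL_mul, hdet, hY, mul_inv_cancel_left,
    mul_inv_cancel_left]

end Cohomology

/-! ### Twists of `γ₀` and the kernel of the map of cohomology sets -/

section Kernel

variable {n q : ℕ} {γ₀ : GL (Idx n) ℚ}

/-- `g ∈ GLₙ*(ℚ̄)` conjugates `γ₀` into `γ`, and `f` is the cocycle `σ ↦ g⁻¹ σ(g)`. -/
structure IsTwist (γ₀ γ : GL (Idx n) ℚ) (g : GL (Idx n) QBar)
    (f : Cocycle Gal(QBar/ℚ) (I0 γ₀ QBar)) : Prop where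
  mem : g ∈ GLstar n QBar
  conj : g * ratMap QBar γ₀ = ratMap QBar γ * g
  cocycle : ∀ σ : Gal(QBar/ℚ), (f.1 σ).1 =
    g⁻¹ * Matrix.GeneralLinearGroup.map (σ : QBar →+* QBar) g

/-- As γ₀ and γ are rational, g and σ(g) conjugate the one to the other in the same way, so g⁻¹σ(g)
centralizes γ₀. It is locally constant in σ because g has finitely many entries. -/
theorem exists_isTwist {γ : GL (Idx n) ℚ} {g : GL (Idx n) QBar} (hg : g ∈ GLstar n QBar)
    (e : g * ratMap QBar γ₀ = ratMap QBar γ * g) : ∃ f, IsTwist γ₀ γ g f := by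
  have hmem : ∀ σ : Gal(QBar/ℚ),
      g⁻¹ * Matrix.GeneralLinearGroup.map (σ : QBar →+* QBar) g ∈ I0 γ₀ QBar := fun σ => by
    refine mem_I0_iff.mpr ⟨mul_mem (inv_mem hg) (map_mem_GLstar _ hg), ?_⟩
    have h1 := congrArg (Matrix.GeneralLinearGroup.map (σ : QBar →+* QBar)) e
    rw [map_mul, map_mul, map_ratMap, map_ratMap] at h1
    rw [mul_assoc, h1, ← mul_assoc, ← mul_assoc]
    congr 1
    rw [inv_mul_eq_iff_eq_mul, ← mul_assoc, e, mul_inv_cancel_right]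
  refine ⟨⟨fun σ => ⟨_, hmem σ⟩, IsLocallyConstant.desc _ Subtype.val
    ((isLocallyConstant_apply g).comp (g⁻¹ * ·)) Subtype.val_injective, fun σ τ => ?_⟩,
    hg, e, fun σ => rfl⟩
  refine Subtype.ext ?_
  change _ = (g⁻¹ * Matrix.GeneralLinearGroup.map (σ : QBar →+* QBar) g) *
    Matrix.GeneralLinearGroup.map (σ : QBar →+* QBar)
      (g⁻¹ * Matrix.GeneralLinearGroup.map (τ : QBar →+* QBar) g)
  rw [map_mul, map_inv, mul_assoc, mul_inv_cancel_left]
  rfl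

/-- If b relates the two cocycles, then g'b⁻¹g⁻¹ is Galois invariant, hence rational, and it
conjugates γ to γ'. Conversely, a rational y conjugating γ to γ' yields b = g⁻¹y⁻¹g'. -/
theorem IsTwist.cohomologous_iff {γ γ' : GL (Idx n) ℚ} {g g' : GL (Idx n) QBar}
    {f f' : Cocycle Gal(QBar/ℚ) (I0 γ₀ QBar)} (h : IsTwist γ₀ γ g f) (h' : IsTwist γ₀ γ' g' f') :
    (cohomologous _ _).r f f' ↔ ConjBy (GLstar n ℚ) γ γ' := by
  rw [conjBy_iff]
  constructor
  · rintro ⟨b, hb⟩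
    obtain ⟨hbs, hbc⟩ := mem_I0_iff.mp b.2
    have hfix : ∀ σ : Gal(QBar/ℚ), Matrix.GeneralLinearGroup.map (σ : QBar →+* QBar)
        (g' * b.1⁻¹ * g⁻¹) = g' * b.1⁻¹ * g⁻¹ := fun σ => by
      have h1 : (f'.1 σ).1 = b.1⁻¹ * (f.1 σ).1 *
        Matrix.GeneralLinearGroup.map (σ : QBar →+* QBar) b.1 := congrArg Subtype.val (hb σ)
      rw [h.cocycle, h'.cocycle, inv_mul_eq_iff_eq_mul] at h1
      rw [map_mul, map_mul, h1, map_inv, map_inv]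
      group
    obtain ⟨y, hy⟩ := exists_ratMap_eq _ hfix
    refine ⟨y, mem_GLstar_of_map (Rat.castHom QBar) ?_, map_GL_injective (Rat.castHom QBar) ?_⟩
    · change ratMap QBar y ∈ _
      rw [hy]
      exact mul_mem (mul_mem h'.mem (inv_mem hbs)) (inv_mem h.mem)
    · change ratMap QBar (y * γ) = ratMap QBar (γ' * y)
      have hbc' : b.1⁻¹ * ratMap QBar γ₀ = ratMap QBar γ₀ * b.1⁻¹ := by
        rw [inv_mul_eq_iff_eq_mul, ← mul_assoc, hbc, mul_inv_cancel_right]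
      have hg : g⁻¹ * ratMap QBar γ = ratMap QBar γ₀ * g⁻¹ := by
        rw [inv_mul_eq_iff_eq_mul, ← mul_assoc, h.conj, mul_inv_cancel_right]
      rw [map_mul, map_mul, hy, mul_assoc, hg, mul_assoc, ← mul_assoc _ _ g⁻¹, hbc', ← mul_assoc,
        ← mul_assoc, h'.conj]
      simp only [mul_assoc]
  · rintro ⟨y, hy, e⟩
    have e' : ratMap QBar y * ratMap QBar γ = ratMap QBar γ' * ratMap QBar y := by
      rw [← map_mul, e, map_mul]
    have hyi : (ratMap QBar y)⁻¹ * ratMap QBar γ' = ratMap QBar γ * (ratMap QBar y)⁻¹ := by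
      rw [inv_mul_eq_iff_eq_mul, ← mul_assoc, e', mul_inv_cancel_right]
    have hg : g⁻¹ * ratMap QBar γ = ratMap QBar γ₀ * g⁻¹ := by
      rw [inv_mul_eq_iff_eq_mul, ← mul_assoc, h.conj, mul_inv_cancel_right]
    have hb : g⁻¹ * (ratMap QBar y)⁻¹ * g' ∈ I0 γ₀ QBar := by
      refine mem_I0_iff.mpr ⟨mul_mem (mul_mem (inv_mem h.mem)
        (inv_mem (map_mem_GLstar (Rat.castHom QBar) hy))) h'.mem, ?_⟩
      rw [mul_assoc, h'.conj, mul_assoc, ← mul_assoc _ _ g', hyi, ← mul_assoc, ← mul_assoc, hg]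
      simp only [mul_assoc]
    refine ⟨⟨_, hb⟩, fun σ => Subtype.ext ?_⟩
    change (f'.1 σ).1 = (g⁻¹ * (ratMap QBar y)⁻¹ * g')⁻¹ * (f.1 σ).1 *
      Matrix.GeneralLinearGroup.map (σ : QBar →+* QBar) (g⁻¹ * (ratMap QBar y)⁻¹ * g')
    rw [h.cocycle, h'.cocycle, map_mul, map_mul, map_inv, map_inv, map_ratMap]
    group

theorem map_restrictGal (σ : Gal(ℂ/ℝ)) (g : GL (Idx n) QBar) :
    Matrix.GeneralLinearGroup.map (algebraMap QBar ℂ)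
      (Matrix.GeneralLinearGroup.map ((restrictGal σ : Gal(QBar/ℚ)) : QBar →+* QBar) g) =
    Matrix.GeneralLinearGroup.map (σ : ℂ →+* ℂ)
      (Matrix.GeneralLinearGroup.map (algebraMap QBar ℂ) g) := by
  ext i j
  exact AlgEquiv.restrictNormal_commutes (AlgEquiv.restrictScalars ℚ σ) QBar (g.val i j)

/-- A twist is trivial over `ℝ` exactly if it comes from conjugation over `ℝ`. -/
theorem IsTwist.realization_eq_base_iff {γ : GL (Idx n) ℚ} {g : GL (Idx n) QBar}
    {f : Cocycle Gal(QBar/ℚ) (I0 γ₀ QBar)} (h : IsTwist γ₀ γ g f) :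
    realization γ₀ (H1.mk f) = H1.base _ _ ↔
      ConjBy (GLstar n ℝ) (ratMap ℝ γ₀) (ratMap ℝ γ) := by
  set G := Matrix.GeneralLinearGroup.map (algebraMap QBar ℂ) g with hG
  have hGs : G ∈ GLstar n ℂ := map_mem_GLstar _ h.mem
  have hGc : G * ratMap ℂ γ₀ = ratMap ℂ γ * G := by
    have := congrArg (Matrix.GeneralLinearGroup.map (algebraMap QBar ℂ)) h.conj
    rwa [map_mul, map_mul, map_ratMap, map_ratMap] at this
  have hf : ∀ σ : Gal(ℂ/ℝ), (I0.map (algebraMap QBar ℂ) (f.1 (restrictGal σ))).1 =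
      G⁻¹ * Matrix.GeneralLinearGroup.map (σ : ℂ →+* ℂ) G := fun σ => by
    change Matrix.GeneralLinearGroup.map (algebraMap QBar ℂ) (f.1 (restrictGal σ)).1 = _
    rw [h.cocycle, map_mul, map_inv, map_restrictGal]
  have hfix : ∀ (σ : Gal(ℂ/ℝ)) (y : GL (Idx n) ℝ), Matrix.GeneralLinearGroup.map (σ : ℂ →+* ℂ)
      (Matrix.GeneralLinearGroup.map (algebraMap ℝ ℂ) y) =
        Matrix.GeneralLinearGroup.map (algebraMap ℝ ℂ) y := fun σ y => by
    ext i j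
    exact σ.commutes (y.val i j)
  rw [conjBy_iff]
  constructor
  · intro h1
    obtain ⟨b, hb⟩ := Quotient.exact h1.symm
    obtain ⟨hbs, hbc⟩ := mem_I0_iff.mp b.2
    have hb' : ∀ σ : Gal(ℂ/ℝ), G⁻¹ * Matrix.GeneralLinearGroup.map (σ : ℂ →+* ℂ) G =
        b.1⁻¹ * 1 * Matrix.GeneralLinearGroup.map (σ : ℂ →+* ℂ) b.1 := fun σ => by
      rw [← hf]
      exact congrArg Subtype.val (hb σ)
    -- If b trivializes the complex cocycle then Gb⁻¹ is fixed by Gal(ℂ/ℝ). It still conjugates γ₀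
    -- to γ, since b centralizes γ₀.
    obtain ⟨y, hy⟩ := exists_realMap_eq (G * b.1⁻¹) fun σ => by
      have := hb' σ
      rw [inv_mul_eq_iff_eq_mul] at this
      rw [map_mul, this, map_inv]
      group
    refine ⟨y, mem_GLstar_of_map (algebraMap ℝ ℂ) ?_, map_GL_injective (algebraMap ℝ ℂ) ?_⟩
    · rw [hy]
      exact mul_mem hGs (inv_mem hbs)
    · have hbc' : b.1⁻¹ * ratMap ℂ γ₀ = ratMap ℂ γ₀ * b.1⁻¹ := by
        rw [inv_mul_eq_iff_eq_mul, ← mul_assoc, hbc, mul_inv_cancel_right]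
      rw [map_mul, map_mul, map_ratMap, map_ratMap, hy, mul_assoc, hbc', ← mul_assoc, hGc,
        mul_assoc]
  · rintro ⟨y, hy, e⟩
    set Y := Matrix.GeneralLinearGroup.map (algebraMap ℝ ℂ) y with hY
    have hYs : Y ∈ GLstar n ℂ := map_mem_GLstar _ hy
    have hYc : Y * ratMap ℂ γ₀ = ratMap ℂ γ * Y := by
      have := congrArg (Matrix.GeneralLinearGroup.map (algebraMap ℝ ℂ)) e
      rwa [map_mul, map_mul, map_ratMap, map_ratMap] at this
    have hYi : Y⁻¹ * ratMap ℂ γ = ratMap ℂ γ₀ * Y⁻¹ := by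
      rw [inv_mul_eq_iff_eq_mul, ← mul_assoc, hYc, mul_inv_cancel_right]
    have hb : Y⁻¹ * G ∈ I0 γ₀ ℂ := mem_I0_iff.mpr ⟨mul_mem (inv_mem hYs) hGs, by
      rw [mul_assoc, hGc, ← mul_assoc, hYi, mul_assoc]⟩
    refine (Quotient.sound ?_).symm
    refine ⟨⟨_, hb⟩, fun σ => Subtype.ext ?_⟩
    change (I0.map (algebraMap QBar ℂ) (f.1 (restrictGal σ))).1 = (Y⁻¹ * G)⁻¹ * 1 *
      Matrix.GeneralLinearGroup.map (σ : ℂ →+* ℂ) (Y⁻¹ * G)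
    rw [hf, map_mul, map_inv, hY, hfix]
    group

/-- Every cocycle is a twist. -/
theorem exists_isTwist_of_cocycle (f : Cocycle Gal(QBar/ℚ) (I0 γ₀ QBar)) :
    ∃ γ g, IsTwist γ₀ γ g f := by
  have hI := fun σ => mem_I0_iff.mp (f.1 σ).2
  obtain ⟨g, hg, hfg⟩ := exists_mem_GLstar_eq_inv_mul_map (fun σ => (f.1 σ).1)
    (f.2.1.comp Subtype.val) (fun σ => (hI σ).1) fun σ τ => congrArg Subtype.val (f.2.2 σ τ)
  -- The values g⁻¹σ(g) of the cocycle centralize γ₀, so gγ₀g⁻¹ is Galois invariant and descends to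
  -- ℚ.
  obtain ⟨γ, hγ⟩ := exists_ratMap_eq (g * ratMap QBar γ₀ * g⁻¹) fun σ => by
    have h1 := (hfg σ).symm
    rw [inv_mul_eq_iff_eq_mul] at h1
    rw [map_mul, map_mul, map_inv, map_ratMap, h1, mul_assoc g, (hI σ).2]
    group
  exact ⟨γ, g, hg, by rw [hγ]; group, hfg⟩

/-- Conjugacy classes and Galois cohomology. -/
theorem exists_equiv_kerH1 (hq : IsQInversive q γ₀)
    (hQ : ∀ γ ∈ setReal q γ₀, ConjBy (GLstar n QBar) (ratMap QBar γ₀) (ratMap QBar γ)) :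
    ∃ e : RealClasses q γ₀ ≃ kerH1 γ₀,
      ∀ γ : setReal q γ₀,
        ConjBy (GLstar n QBar) (ratMap QBar γ₀) (ratMap QBar γ.1) ∧
        ∀ g ∈ GLstar n QBar, g * ratMap QBar γ₀ * g⁻¹ = ratMap QBar γ.1 →
          ∃ f : Cocycle Gal(QBar/ℚ) (I0 γ₀ QBar),
            (∀ σ : Gal(QBar/ℚ), (f.1 σ).1 =
              g⁻¹ * Matrix.GeneralLinearGroup.map (σ : QBar →+* QBar) g) ∧
            (e (Quotient.mk _ γ)).1 = H1.mk f := by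
  have hex : ∀ γ : setReal q γ₀, ∃ g f, IsTwist γ₀ γ.1 g f := fun γ => by
    obtain ⟨g, hg, e⟩ := conjBy_iff.mp (hQ γ.1 γ.2)
    exact ⟨g, exists_isTwist hg e⟩
  choose g f hgf using hex
  let φ : RealClasses q γ₀ → kerH1 γ₀ :=
    Quotient.lift (fun γ => ⟨H1.mk (f γ), (hgf γ).realization_eq_base_iff.mpr γ.2.2⟩)
      fun γ γ' h => Subtype.ext (Quotient.sound (((hgf γ).cohomologous_iff (hgf γ')).mpr h))
  have hφ : Function.Bijective φ := by
    constructor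
    · intro x y
      induction x using Quotient.inductionOn with | _ γ =>
      induction y using Quotient.inductionOn with | _ γ' =>
      intro h
      exact Quotient.sound (((hgf γ).cohomologous_iff (hgf γ')).mp
        (Quotient.exact (congrArg Subtype.val h)))
    · rintro ⟨c, hc⟩
      induction c using Quotient.inductionOn with | _ f' =>
      obtain ⟨γ, g', h'⟩ := exists_isTwist_of_cocycle f'
      have hγ : γ ∈ setReal q γ₀ :=
        ⟨hq.of_conj (K := QBar) (conjBy_iff.mpr ⟨g', h'.mem, h'.conj⟩),
          h'.realization_eq_base_iff.mp hc⟩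
      refine ⟨Quotient.mk _ ⟨γ, hγ⟩, Subtype.ext (Quotient.sound ?_)⟩
      exact ((hgf ⟨γ, hγ⟩).cohomologous_iff h').mpr ⟨1, one_mem _, by simp⟩
  -- Another conjugating element gives another cocycle for the same γ. It is cohomologous to the
  -- chosen one because γ is conjugate to itself.
  refine ⟨Equiv.ofBijective φ hφ, fun γ => ⟨hQ γ.1 γ.2, fun g' hg' e => ?_⟩⟩
  obtain ⟨f', h'⟩ := exists_isTwist hg' (mul_inv_eq_iff_eq_mul.mp e)
  exact ⟨f', h'.cocycle, Quotient.sound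
    (((hgf γ).cohomologous_iff h').mpr ⟨1, one_mem _, by simp⟩)⟩

end Kernel

end RealDeligne

end

open RealDeligne in
theorem mainTheorem8 (p a n : ℕ) [Fact p.Prime] (ha : 0 < a)
    (ε : WittVector p (AlgebraicClosure (ZMod p)) →+* ℂ)
    (O : ValuationSubring ℂ) (hO : LiesAbove ε O)
    (A₀ B₀ C₀ : Matrix (Fin n) (Fin n) ℚ) (γ₀ : GL (Idx n) ℚ)
    (hγ₀ : γ₀.val = Matrix.fromBlocks A₀ B₀ C₀ A₀ᵀ) (hq : IsQInversive (p ^ a) γ₀)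
    (M₀ : RealPolarizedModule p a n O) (ψ₀ : M₀.T →ₗ[ℤ] (Idx n → ℚ))
    (hψ₀ : IsCoordinates M₀ γ₀ ψ₀) :
    -- congruence classes of `B` and `GLₙ*(ℚ)`-classes, through `B ↦ γ`
    (∃ e : Quotient (congruenceSetoid A₀ B₀) ≃ RealClasses (p ^ a) γ₀,
      ∀ B : setB A₀ B₀, ∃ γ : setReal (p ^ a) γ₀,
        γ.1.val = Matrix.fromBlocks A₀ B.1
          (B.1⁻¹ * (A₀ ^ 2 - ((p ^ a : ℕ) : ℚ) • (1 : Matrix (Fin n) (Fin n) ℚ))) A₀ᵀ ∧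
        e (Quotient.mk _ B) = Quotient.mk _ γ) ∧
    -- isogeny classes and `GLₙ*(ℚ)`-classes, through coordinates
    (∃ e : Quotient (isogenySetoid ℚ QBar M₀) ≃ RealClasses (p ^ a) γ₀,
      ∀ M : {M : RealPolarizedModule p a n O // Isogenous QBar M M₀},
        (∃ γ ψ, IsCoordinates M.1 γ ψ) ∧
        ∀ γ ψ, IsCoordinates M.1 γ ψ →
          ∃ hγ : γ ∈ setReal (p ^ a) γ₀, e (Quotient.mk _ M) = Quotient.mk _ ⟨γ, hγ⟩) ∧
    -- the two descriptions of the set of `γ`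
    setQBarReal (p ^ a) γ₀ = setReal (p ^ a) γ₀ ∧
    -- `GLₙ*(ℚ)`-classes and Galois cohomology
    (∃ e : RealClasses (p ^ a) γ₀ ≃ kerH1 γ₀,
      ∀ γ : setReal (p ^ a) γ₀,
        ConjBy (GLstar n QBar) (ratMap QBar γ₀) (ratMap QBar γ.1) ∧
        ∀ g ∈ GLstar n QBar, g * ratMap QBar γ₀ * g⁻¹ = ratMap QBar γ.1 →
          ∃ f : Cocycle Gal(QBar/ℚ) (I0 γ₀ QBar),
            (∀ σ : Gal(QBar/ℚ), (f.1 σ).1 =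
              g⁻¹ * Matrix.GeneralLinearGroup.map (σ : QBar →+* QBar) g) ∧
            (e (Quotient.mk _ γ)).1 = H1.mk f) ∧
    -- the identifications of the group `I₀`
    ∀ (K : Type) [Field K] [CharZero K],
      (∃ e : selfIsogenies K M₀ ≃* I0 γ₀ K, ∀ (φ : selfIsogenies K M₀) (x : TensorProduct ℤ K M₀.T),
        extendCoords K ψ₀ (φ.1 x) = (e φ).1.val *ᵥ extendCoords K ψ₀ x) ∧
      (∃ e : I0 γ₀ K ≃* centralizerGO A₀ B₀ K, ∀ x : I0 γ₀ K,
        ∃ lam : Kˣ, x.1.val = delta lam (e x).1) := by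
  have : IsAlgClosed QBar := IsAlgClosure.isAlgClosed ℚ
  have D := hψ₀.definiteBlocks hO.p_mem ha hγ₀
  exact ⟨D.exists_equiv_congruenceClasses (pow_pos (Fact.out : p.Prime).pos a).ne',
    exists_equiv_isogenyClasses hO.p_mem ha hψ₀ hγ₀, D.setQBarReal_eq,
    exists_equiv_kerH1 hq fun γ hγ => D.conjBy_algClosed QBar (D.mem_setReal_iff.mp hγ),
    fun K _ _ => ⟨exists_selfIsogenies_mulEquiv K hψ₀, exists_I0_mulEquiv hγ₀ D.blocks D.isUnit_det⟩⟩
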